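/- Let $\Omega=\mathbb R^2/\langle x\mapsto x+2\pi\rangle$ be the flat cylinder with coordinates $(x,s)$, and for $c\in(-\infty,\infty]$ let $\Omega_{\le c}=\Omega\cap\{s\le c\}$ and $\Omega_{\ge c}=\Omega\cap\{s\ge c\}$ (so $\Omega_{\le\infty}=\Omega$ and $\Omega_{\ge\infty}=\emptyset$). For $D\subset\Omega$, $j\ge 0$, $\alpha\in(0,1)$ and a positive function $f$ on $D$, let $C^{j,\alpha}(D,f)$ be the space of functions $u$ of class $C^j$ on $D$ whose norm $$\|u:C^{j,\alpha}(D,f)\|=\sup_{p\in D}\frac1{f(p)}\,\|u:C^{j,\alpha}(D\cap B_1(p))\|$$ is finite, where $B_1(p)$ is the unit disc around $p$ and $$\|u:C^{j,\alpha}(S)\|=\sum_{i\le j}\ \sup_{|\beta|=i}\ \sup_{S}|D^\beta u|+\sup_{|\beta|=j}\ \sup_{y\ne z\in S}\frac{|D^\beta u(y)-D^\beta u(z)|}{|y-z|^\alpha}$$ is the usual Hölder norm, in the coordinates $(x,s)$. A function $u$ has zero average along meridians if $\int_{-\pi}^{\pi}u(x,s)\,dx=0$ for every $s$; let $\mathring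 C^{j,\alpha}(D,f)$ be the subspace of such functions in $C^{j,\alpha}(D,f)$. Let $\mathring C^{0,\alpha}_0(\Omega_{\le\ell},f)$ be the subspace of $\mathring C^{0,\alpha}(\Omega_{\le\ell},f)$ of the functions that vanish on the boundary $\{s=\ell\}$ (no condition if $\ell=\infty$); they are regarded as functions on $\Omega$ by extending them by zero. An intersection of two normed spaces carries the sum of the two norms. **Proposition.** Let $\rho\in(-1,1)\setminus\{0\}$, $k\ge 0$ an integer, $\ell\in(0,\infty]$ and $\alpha\in(0,1)$. There are a linear map $$\mathcal R:\ \mathring C^{0,\alpha}_0(\Omega_{\le\ell},\cosh^\rho(s))\ \longrightarrow\ \mathring C^{2,\alpha}(\Omega,\cosh^\rho(s))\cap C^{k,\alpha}\bigl(\Omega_{\ge\ell+1},\cosh^\rho(\ell)/\cosh(s)\bigr)$$ and a constant $C$ (which may depend on $\rho,k,\ell,\alpha$) such that, for every $E$ in the source space, 1. $\Delta_\Omega\mathcal R[E]=E$ on $\Omega$; 2. $\|\mathcal R[E]:C^{2,\alpha}(\Omega,\cosh^\rho(s))\|+\|\mathcal R[E]:C^{k,\alpha}(\Omega_{\ge\ell+1},\cosh^\rho(\ell)/\cosh(s))\|\le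 C\,\|E:C^{0,\alpha}(\Omega_{\le\ell},\cosh^\rho(s))\|$. For $\ell=\infty$ the second space in the intersection imposes no condition. -/

import Mathlib

open Set Real
open scoped ENNReal NNReal

noncomputable section

namespace FlatCylinder

/-- The Euclidean plane with coordinates `(x, s) = (p 0, p 1)`. -/
abbrev Plane : Type := EuclideanSpace ℝ (Fin 2)

/-- The flat cylinder, the quotient of the plane by the translation `x ↦ x + 2π`,
with coordinates `(x mod 2π, s)`. -/
abbrev Cylinder : Type := AddCircle (2 * π) × ℝ

/-- The quotient map from the plane to the cylinder, a local isometry which is injective on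
discs of radius one. -/
def cover (p : Plane) : Cylinder := ((p 0 : AddCircle (2 * π)), p 1)

/-- The function of the plane, `2π`-periodic in `x`, that a function on the cylinder lifts to. -/
def lift (u : Cylinder → ℝ) : Plane → ℝ := fun p => u (cover p)

/-- The part `s ≤ c` of the cylinder. It is the whole cylinder for `c = ∞`. -/
def below (c : EReal) : Set Cylinder := {q | (q.2 : EReal) ≤ c}

/-- The part `c ≤ s` of the cylinder. It is empty for `c = ∞`. -/
def above (c : EReal) : Set Cylinder := {q | c ≤ (q.2 : EReal)}

/-! ### Hölder norms on subsets of the plane -/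

/-- The iterated partial derivative of `u` on `S` in the coordinate directions
`β 0, …, β (j - 1)`. -/
def partialDeriv {j : ℕ} (β : Fin j → Fin 2) (S : Set Plane) (u : Plane → ℝ) (p : Plane) : ℝ :=
  iteratedFDerivWithin ℝ j u S p (fun i => EuclideanSpace.single (β i) 1)

/-- The Hölder seminorm of exponent `α` on `S`. -/
def holderSeminorm (α : ℝ) (S : Set Plane) (u : Plane → ℝ) : ℝ≥0∞ :=
  ⨆ (x ∈ S) (y ∈ S) (_ : x ≠ y), ‖u x - u y‖ₑ / edist x y ^ α

/-- The norm of `C^{k,α}(S)`, which is meant for functions that are `C^k` on `S`. -/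
def holderNorm (k : ℕ) (α : ℝ) (S : Set Plane) (u : Plane → ℝ) : ℝ≥0∞ :=
  (∑ j ∈ Finset.range (k + 1), ⨆ (β : Fin j → Fin 2) (x ∈ S), ‖partialDeriv β S u x‖ₑ)
    + ⨆ β : Fin k → Fin 2, holderSeminorm α S (partialDeriv β S u)

/-! ### Weighted Hölder spaces on subsets of the cylinder -/

/-- The weighted norm of `C^{k,α}(D, f)`: the supremum over the points `p` of `D` of `1 / f p`
times the `C^{k,α}` norm on the part of `D` in the unit disc around `p`. -/
def weightedNorm (k : ℕ) (α : ℝ) (D : Set Cylinder) (f : Cylinder → ℝ) (u : Cylinder → ℝ) :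
    ℝ≥0∞ :=
  ⨆ p ∈ cover ⁻¹' D,
    holderNorm k α (cover ⁻¹' D ∩ Metric.ball p 1) (lift u) / ENNReal.ofReal (f (cover p))

/-- The restriction of `u` to `D` belongs to `C^{k,α}(D, f)`. -/
def MemWeightedHolder (k : ℕ) (α : ℝ) (D : Set Cylinder) (f : Cylinder → ℝ) (u : Cylinder → ℝ) :
    Prop :=
  ContDiffOn ℝ k (lift u) (cover ⁻¹' D) ∧ weightedNorm k α D f u < ∞

/-- The function has zero average along meridians. -/
def ZeroMeridianAverage (u : Cylinder → ℝ) : Prop :=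
  ∀ s : ℝ, ∫ θ in (-π)..π, u ((θ : AddCircle (2 * π)), s) = 0

/-- The weight `cosh^ρ(s)`. -/
def coshWeight (ρ : ℝ) (q : Cylinder) : ℝ := cosh q.2 ^ ρ

/-- The weight `cosh^ρ(ℓ) / cosh(s)`. It is used on `above (ℓ + 1)` only, which is empty
for `ℓ = ∞`. -/
def decayWeight (ρ : ℝ) (l : EReal) (q : Cylinder) : ℝ := cosh l.toReal ^ ρ / cosh q.2

/-! ### The space of source terms -/

theorem holderNorm_zero (α : ℝ) (S : Set Plane) (u : Plane → ℝ) :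
    holderNorm 0 α S u = (⨆ x ∈ S, ‖u x‖ₑ) + holderSeminorm α S u := by
  have h : ∀ β : Fin 0 → Fin 2, partialDeriv β S u = u := fun β => by
    funext p; simp [partialDeriv]
  simp [holderNorm, h]

theorem weightedNorm_zero_add_le (α : ℝ) (D : Set Cylinder) (f u v : Cylinder → ℝ) :
    weightedNorm 0 α D f (u + v) ≤ weightedNorm 0 α D f u + weightedNorm 0 α D f v := by
  refine iSup₂_le fun p hp => ?_
  refine le_trans ?_ (add_le_add
    (le_iSup₂ (f := fun p (_ : p ∈ cover ⁻¹' D) =>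
      holderNorm 0 α (cover ⁻¹' D ∩ Metric.ball p 1) (lift u) / ENNReal.ofReal (f (cover p))) p hp)
    (le_iSup₂ (f := fun p (_ : p ∈ cover ⁻¹' D) =>
      holderNorm 0 α (cover ⁻¹' D ∩ Metric.ball p 1) (lift v) / ENNReal.ofReal (f (cover p))) p hp))
  rw [← ENNReal.add_div]
  refine ENNReal.div_le_div_right ?_ _
  simp only [holderNorm_zero]
  rw [add_add_add_comm]
  refine add_le_add (iSup₂_le fun x hx => ?_) ?_
  · refine le_trans (enorm_add_le (lift u x) (lift v x)) (add_le_add ?_ ?_)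
    · exact le_iSup₂ (f := fun x (_ : x ∈ _) => ‖lift u x‖ₑ) x hx
    · exact le_iSup₂ (f := fun x (_ : x ∈ _) => ‖lift v x‖ₑ) x hx
  · refine iSup₂_le fun x hx => iSup₂_le fun y hy => iSup_le fun hxy => ?_
    have key : ∀ w : Plane → ℝ, ‖w x - w y‖ₑ / edist x y ^ α
        ≤ holderSeminorm α (cover ⁻¹' D ∩ Metric.ball p 1) w := fun w =>
      le_iSup₂_of_le x hx (le_iSup₂_of_le y hy (le_iSup_of_le hxy le_rfl))
    refine le_trans ?_ (add_le_add (key (lift u)) (key (lift v)))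
    rw [← ENNReal.add_div]
    refine ENNReal.div_le_div_right ?_ _
    have : lift (u + v) x - lift (u + v) y
        = (lift u x - lift u y) + (lift v x - lift v y) := by
      simp only [lift, Pi.add_apply]; ring
    rw [this]
    exact enorm_add_le _ _

theorem weightedNorm_zero_smul_le (α : ℝ) (D : Set Cylinder) (f u : Cylinder → ℝ) (c : ℝ) :
    weightedNorm 0 α D f (c • u) ≤ ‖c‖ₑ * weightedNorm 0 α D f u := by
  refine iSup₂_le fun p hp => ?_
  refine le_trans ?_ (mul_le_mul_right
    (le_iSup₂ (f := fun p (_ : p ∈ cover ⁻¹' D) =>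
      holderNorm 0 α (cover ⁻¹' D ∩ Metric.ball p 1) (lift u) / ENNReal.ofReal (f (cover p))) p hp)
    ‖c‖ₑ)
  rw [← mul_div_assoc]
  refine ENNReal.div_le_div_right ?_ _
  simp only [holderNorm_zero]
  rw [mul_add]
  refine add_le_add (iSup₂_le fun x hx => ?_) ?_
  · have : ‖lift (c • u) x‖ₑ = ‖c‖ₑ * ‖lift u x‖ₑ := by simp [lift, enorm_mul]
    rw [this]
    exact mul_le_mul_right (le_iSup₂ (f := fun x (_ : x ∈ _) => ‖lift u x‖ₑ) x hx) _
  · refine iSup₂_le fun x hx => iSup₂_le fun y hy => iSup_le fun hxy => ?_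
    have : ‖lift (c • u) x - lift (c • u) y‖ₑ = ‖c‖ₑ * ‖lift u x - lift u y‖ₑ := by
      rw [← enorm_mul]; simp only [lift, Pi.smul_apply, smul_eq_mul]; ring_nf
    rw [this, mul_div_assoc]
    have key : ‖lift u x - lift u y‖ₑ / edist x y ^ α
        ≤ holderSeminorm α (cover ⁻¹' D ∩ Metric.ball p 1) (lift u) :=
      le_iSup₂_of_le x hx (le_iSup₂_of_le y hy (le_iSup_of_le hxy le_rfl))
    exact mul_le_mul_right key _

theorem intervalIntegrable_meridian {l : EReal} {u : Cylinder → ℝ}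
    (hc : ContDiffOn ℝ (0 : ℕ) (lift u) (cover ⁻¹' below l))
    (h0 : ∀ q ∈ above l, u q = 0) (s : ℝ) :
    IntervalIntegrable (fun θ : ℝ => u ((θ : AddCircle (2 * π)), s))
      MeasureTheory.volume (-π) π := by
  apply Continuous.intervalIntegrable
  rcases le_total (s : EReal) l with h | h
  · have h1 : ContinuousOn (lift u) (cover ⁻¹' below l) := hc.continuousOn
    have h2 : Continuous fun θ : ℝ => (!₂[θ, s] : Plane) := by fun_prop
    have h3 := h1.comp_continuous h2 (fun θ => by simpa [cover, below] using h)
    exact h3.congr fun θ => by simp [lift, cover]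
  · have : (fun θ : ℝ => u ((θ : AddCircle (2 * π)), s)) = fun _ => 0 :=
      funext fun θ => h0 _ h
    rw [this]
    exact continuous_const

/-- The space of the functions of class `C^{0,α}(Ω_{≤ ℓ}, cosh^ρ(s))` with zero average along
meridians that vanish on the boundary `s = ℓ`. Its elements are regarded as functions on the whole
cylinder through their extension by zero. For `ℓ = ∞` there is no boundary condition. -/
def sourceSpace (ρ α : ℝ) (l : EReal) : Submodule ℝ (Cylinder → ℝ) where
  carrier := {E | MemWeightedHolder 0 α (below l) (coshWeight ρ) E ∧
    (∀ q ∈ above l, E q = 0) ∧ ZeroMeridianAverage E}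
  zero_mem' := by
    refine ⟨⟨contDiffOn_const, ?_⟩, fun _ _ => rfl, fun s => by simp⟩
    simp [weightedNorm, holderNorm_zero, holderSeminorm, lift]
  add_mem' := by
    rintro u v ⟨⟨hu, hu'⟩, hu0, hum⟩ ⟨⟨hv, hv'⟩, hv0, hvm⟩
    refine ⟨⟨hu.add hv, (weightedNorm_zero_add_le _ _ _ _ _).trans_lt
      (ENNReal.add_lt_top.2 ⟨hu', hv'⟩)⟩, fun q hq => by simp [hu0 q hq, hv0 q hq], fun s => ?_⟩
    have := intervalIntegral.integral_add (intervalIntegrable_meridian hu hu0 s)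
      (intervalIntegrable_meridian hv hv0 s)
    rw [hum s, hvm s, add_zero] at this
    exact this
  smul_mem' := by
    rintro c u ⟨⟨hu, hu'⟩, hu0, hum⟩
    refine ⟨⟨hu.const_smul c, (weightedNorm_zero_smul_le _ _ _ _ _).trans_lt
      (ENNReal.mul_lt_top (by simp) hu')⟩, fun q hq => by simp [hu0 q hq], fun s => ?_⟩
    have := intervalIntegral.integral_const_mul (a := -π) (b := π) (μ := MeasureTheory.volume) c
      (fun θ : ℝ => u ((θ : AddCircle (2 * π)), s))
    rw [hum s, mul_zero] at this
    exact this

end FlatCylinder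

end

open FlatCylinder

/-! Everything is done on the plane, with `2π`-periodic lifts. The solution is a sum of two terms,
both superpositions of translates of `E`. Such superpositions are linear, descend to the cylinder
and preserve zero meridian averages.

The local term is the dyadic series `v = ∑ 4⁻ⁿ Ψ_{2⁻ⁿ} * E`, with `ΔΨ = 4φ(2·) - φ`. Its Laplacian
telescopes to `E - φ * E`. If `E` is `α`-Hölder, the second derivatives of the `n`-th term are
`O(2^{-αn})` and the third ones `O(2^{(1-α)n})`. Summing the better of the two bounds on a
difference of second derivatives gives the Schauder estimate `exists_dyadicPotential_estimate`
without singular integrals. The kernels have support of radius at most `1`, so the estimate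
localizes and holds with any weight that varies boundedly on unit discs.

The global term solves `Δg = φ * E`, where the right-hand side is smooth with zero averages. It is
the convolution with the Green function `-∑_{m≥1} (2πm)⁻¹ cos(mx) e^{-m|s|}`. The slowest mode
decays like `e^{-|s|}`, which is why `|ρ| < 1` suffices for the weight `cosh^ρ`. All derivatives
fall on `φ * E`, so only the integrability of the kernel matters. The identity
`laplacian_superpose_green` combines a one-dimensional Green formula for each mode with Fourier
inversion.

The decay comes from complex analysis. For `s > ℓ` the solution `u` is harmonic, so `∂ₓu - i ∂ₛu` is
a periodic holomorphic function of `z = x + is`, hence a function `F` of `q = e^{iz}` on a punctured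
disc. The growth `e^{|ρ|s}` makes the singularity at `0` removable, the zero averages force `F(0) =
0`, and the Schwarz lemma gives `|F| ≲ |q| = e^{-s}` (`norm_le_exp_of_periodic`). Cauchy estimates
then bound all derivatives. -/

noncomputable section

namespace FlatCylinder

open MeasureTheory Filter Topology
open scoped ContDiff

/-! ### Radial kernels -/

/-- The Laplacian of a radial function of the plane, written as a function of `‖y‖ ^ 2`. -/
theorem laplacian_comp_norm_sq {G P Q : ℝ → ℝ} (hG : ∀ t, HasDerivAt G (P t) t)
    (hP : ∀ t, HasDerivAt P (Q t) t) (y : Plane) :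
    Laplacian.laplacian (fun y : Plane => G (‖y‖ ^ 2)) y
      = 4 * ‖y‖ ^ 2 * Q (‖y‖ ^ 2) + 4 * P (‖y‖ ^ 2) := by
  set B : Plane →L[ℝ] Plane →L[ℝ] ℝ := LinearMap.toContinuousLinearMap
    (LinearMap.toContinuousLinearMap.toLinearMap ∘ₗ innerₗ Plane) with hB
  have Ba : ∀ u v, B u v = inner ℝ u v := fun u v => rfl
  have hn : ∀ y : Plane, HasFDerivAt (fun y : Plane => ‖y‖ ^ 2) ((2 : ℝ) • B y) y := fun y => by
    refine (hasStrictFDerivAt_norm_sq y).hasFDerivAt.congr_fderiv ?_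
    ext v
    simp [Ba, two_mul]
  have h1 : fderiv ℝ (fun y : Plane => G (‖y‖ ^ 2)) = fun y => (2 * P (‖y‖ ^ 2)) • B y := by
    funext y
    have := HasDerivAt.comp_hasFDerivAt (h₂ := G) y (hG (‖y‖ ^ 2)) (hn y)
    rw [show (fun y : Plane => G (‖y‖ ^ 2)) = G ∘ fun y : Plane => ‖y‖ ^ 2 from rfl, this.fderiv,
      smul_smul, mul_comm]
  have h2 : ∀ y : Plane, HasFDerivAt (fun y : Plane => (2 * P (‖y‖ ^ 2)) • B y)
      ((2 * P (‖y‖ ^ 2)) • B + ((2 * (Q (‖y‖ ^ 2) * 2)) • B y).smulRight (B y)) y := by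
    intro y
    have := (((HasDerivAt.comp_hasFDerivAt (h₂ := P) y (hP (‖y‖ ^ 2)) (hn y))).const_mul 2).smul
      B.hasFDerivAt
    refine HasFDerivAt.congr_fderiv this ?_
    simp [smul_smul]
  rw [InnerProductSpace.laplacian_eq_iteratedFDeriv_orthonormalBasis _
    (EuclideanSpace.basisFun (Fin 2) ℝ)]
  simp only [iteratedFDeriv_two_apply, h1, (h2 y).fderiv]
  have hy : ‖y‖ ^ 2 = y 0 ^ 2 + y 1 ^ 2 := by
    rw [EuclideanSpace.norm_sq_eq]; simp [Fin.sum_univ_two]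
  simp [Fin.sum_univ_two, Ba, EuclideanSpace.inner_single_right]
  rw [hy]
  ring

theorem exists_contDiff_primitive {P : ℝ → ℝ} (hP : ContDiff ℝ ∞ P) (c : ℝ) :
    ∃ G : ℝ → ℝ, ContDiff ℝ ∞ G ∧ (∀ t, HasDerivAt G (P t) t) ∧ ∀ t, G t = ∫ r in c..t, P r := by
  have h : ∀ t, HasDerivAt (fun t => ∫ r in c..t, P r) (P t) t := fun t =>
    intervalIntegral.integral_hasDerivAt_right (hP.continuous.intervalIntegrable _ _)
      hP.continuous.aestronglyMeasurable.stronglyMeasurableAtFilter hP.continuous.continuousAt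
  refine ⟨_, ?_, h, fun t => rfl⟩
  rw [contDiff_infty_iff_deriv]
  exact ⟨fun t => (h t).differentiableAt, by rwa [show deriv _ = P from funext fun t => (h t).deriv]⟩

/-- A mollifier `φ` and a kernel `Ψ` such that the Laplacian of `Ψ` is the difference of `φ`
at two consecutive dyadic scales. -/
theorem exists_dyadic_kernel : ∃ φ Ψ : Plane → ℝ, ContDiff ℝ ∞ φ ∧ ContDiff ℝ ∞ Ψ ∧
    Function.support φ ⊆ Metric.closedBall 0 1 ∧ Function.support Ψ ⊆ Metric.closedBall 0 1 ∧
    ∫ y, φ y = 1 ∧ ∀ y, Laplacian.laplacian Ψ y = 4 * φ ((2 : ℝ) • y) - φ y := by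
  -- In the variable `t = ‖y‖²` the Laplacian of `G(t)` is `(4 t G')'`. With `φ` proportional to
  -- `H'(t)`, the required equation integrates to `4 t G' = H(4t) - H(t)`.
  set H : ℝ → ℝ := fun t => Real.smoothTransition (2 * t - 1) with hH
  have H0 : ∀ t ≤ 1 / 2, H t = 0 := fun t ht =>
    Real.smoothTransition.zero_of_nonpos (by linarith)
  have H1 : ∀ t ≥ 1, H t = 1 := fun t ht => Real.smoothTransition.one_of_one_le (by linarith)
  have Hs : ContDiff ℝ ∞ H := Real.smoothTransition.contDiff.comp (by fun_prop)
  set η : ℝ → ℝ := deriv H with hη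
  have ηs : ContDiff ℝ ∞ η := (contDiff_infty_iff_deriv.1 Hs).2
  have Hd : ∀ t, HasDerivAt H (η t) t := fun t =>
    ((contDiff_infty_iff_deriv.1 Hs).1 t).hasDerivAt
  have η0 : ∀ t, 0 ≤ η t := by
    intro t
    refine Monotone.deriv_nonneg ?_
    exact Real.smoothTransition.monotone.comp (fun a b hab => by simpa using hab)
  have η1 : ∀ t > 1, η t = 0 := by
    intro t ht
    have : H =ᶠ[𝓝 t] fun _ => 1 := by
      filter_upwards [lt_mem_nhds ht] with s hs using H1 s hs.le
    rw [hη, this.deriv_eq, deriv_const]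
  -- Smooth across `t = 0` because the numerator vanishes for `t < 1/8`.
  set P : ℝ → ℝ := fun t => (H (4 * t) - H t) / (4 * t) with hP
  have P1 : ∀ t ≥ 1, P t = 0 := fun t ht => by
    simp [hP, H1 t ht, H1 (4 * t) (by linarith)]
  have P0 : ∀ t < 1 / 8, P t = 0 := fun t ht => by
    simp [hP, H0 t (by linarith), H0 (4 * t) (by linarith)]
  have Ps : ContDiff ℝ ∞ P := by
    rw [contDiff_iff_contDiffAt]
    intro t
    rcases lt_or_ge t (1 / 8) with h | h
    · have : P =ᶠ[𝓝 t] fun _ => 0 := by filter_upwards [gt_mem_nhds h] with s hs using P0 s hs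
      exact contDiffAt_const.congr_of_eventuallyEq this
    · refine ContDiffAt.div ?_ (by fun_prop) (by positivity)
      exact ((Hs.comp (by fun_prop : ContDiff ℝ ∞ fun t : ℝ => 4 * t)).sub Hs).contDiffAt
  have Pd : ∀ t, HasDerivAt P (deriv P t) t := fun t =>
    ((contDiff_infty_iff_deriv.1 Ps).1 t).hasDerivAt
  have Pe : ∀ t, 4 * t * deriv P t + 4 * P t = 4 * η (4 * t) - η t := by
    intro t
    have h1 : HasDerivAt (fun t => 4 * t * P t) (4 * P t + 4 * t * deriv P t) t := by
      have := ((hasDerivAt_id t).const_mul 4).mul (Pd t)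
      rwa [mul_one] at this
    have h2 : (fun t => 4 * t * P t) = fun t => H (4 * t) - H t := by
      funext t
      rcases eq_or_ne t 0 with rfl | h
      · simp
      · simp only [hP]; field_simp
    have h3 : HasDerivAt (fun t => H (4 * t) - H t) (4 * η (4 * t) - η t) t := by
      have := HasDerivAt.comp (h₂ := H) t (Hd (4 * t)) ((hasDerivAt_id t).const_mul 4)
      have := this.sub (Hd t)
      rwa [mul_one, mul_comm] at this
    rw [h2] at h1
    linarith [h1.unique h3]
  -- The base point `1` makes the primitive vanish for `t ≥ 1`, so that `Ψ` is supported in the unit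
  -- disc.
  obtain ⟨G, Gs, Gd, Ge⟩ := exists_contDiff_primitive Ps 1
  have G1 : ∀ t ≥ 1, G t = 0 := by
    intro t ht
    rw [Ge, intervalIntegral.integral_congr (g := fun _ => 0)]
    · simp
    · intro r hr
      rw [uIcc_of_le ht] at hr
      exact P1 r hr.1
  have hns : ContDiff ℝ ∞ fun y : Plane => ‖y‖ ^ 2 := contDiff_norm_sq ℝ
  have hball : ∀ y : Plane, y ∉ Metric.closedBall (0 : Plane) 1 → 1 < ‖y‖ ^ 2 := by
    intro y hy
    rw [mem_closedBall_zero_iff, not_le] at hy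
    nlinarith
  have hsupp : Function.support (fun y : Plane => η (‖y‖ ^ 2)) ⊆ Metric.closedBall 0 1 := by
    intro y hy
    by_contra h
    exact hy (η1 _ (hball y h))
  set c : ℝ := ∫ y : Plane, η (‖y‖ ^ 2) with hc
  have hcpos : 0 < c := by
    have hcont : Continuous fun y : Plane => η (‖y‖ ^ 2) := (ηs.comp hns).continuous
    obtain ⟨t, ht⟩ : ∃ t, η t ≠ 0 := by
      by_contra! h
      have := is_const_of_deriv_eq_zero (fun t => (Hd t).differentiableAt) h 0 1
      rw [H0 0 (by norm_num), H1 1 le_rfl] at this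
      norm_num at this
    have ht0 : 0 ≤ t := by
      by_contra! h
      have : H =ᶠ[𝓝 t] fun _ => 0 := by
        filter_upwards [gt_mem_nhds h] with s hs using H0 s (by linarith)
      exact ht (by rw [hη, this.deriv_eq, deriv_const])
    refine hcont.integral_pos_of_hasCompactSupport_nonneg_nonzero
      (HasCompactSupport.intro (isCompact_closedBall 0 1) fun y hy => η1 _ (hball y hy))
      (fun y => η0 _) (x := EuclideanSpace.single 0 (√t)) ?_
    simpa [Real.sq_sqrt ht0] using ht
  refine ⟨fun y => c⁻¹ • η (‖y‖ ^ 2), fun y => c⁻¹ • G (‖y‖ ^ 2), (ηs.comp hns).const_smul _,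
    (Gs.comp hns).const_smul _, ?_, ?_, ?_, ?_⟩
  · exact (Function.support_const_smul_subset c⁻¹ fun y : Plane => η (‖y‖ ^ 2)).trans hsupp
  · intro y hy
    by_contra h
    exact hy (by simp [G1 _ (hball y h).le])
  · rw [integral_smul, ← hc, smul_eq_mul, inv_mul_cancel₀ hcpos.ne']
  · intro y
    have := InnerProductSpace.laplacian_smul (f := fun y : Plane => G (‖y‖ ^ 2)) (x := y) c⁻¹
      ((Gs.comp hns).contDiffAt.of_le (by norm_cast))
    rw [show (fun y : Plane => c⁻¹ • G (‖y‖ ^ 2)) = c⁻¹ • fun y : Plane => G (‖y‖ ^ 2) from rfl,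
      this, laplacian_comp_norm_sq Gd Pd, Pe]
    have : ‖(2 : ℝ) • y‖ ^ 2 = 4 * ‖y‖ ^ 2 := by rw [norm_smul]; norm_num; ring
    simp only [this, smul_eq_mul]
    ring

/-! ### Averages at scale `ε` -/

section ScaledAverage

variable {F : Type} [NormedAddCommGroup F] [NormedSpace ℝ F]

/-- The average of `f` around `x` at the scale `ε` against the kernel `Ψ`. -/
def scaledAverage (Ψ : Plane → F) (ε : ℝ) (f : Plane → ℝ) (x : Plane) : F :=
  ∫ z, f (x - ε • z) • Ψ z

theorem integrable_scaledAverage {Ψ : Plane → F} (hΨ : Continuous Ψ)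
    (hs : Function.support Ψ ⊆ Metric.closedBall 0 1) {f : Plane → ℝ} (hf : Continuous f)
    (ε : ℝ) (x : Plane) : Integrable fun z => f (x - ε • z) • Ψ z := by
  refine Continuous.integrable_of_hasCompactSupport (by fun_prop)
    (HasCompactSupport.intro (isCompact_closedBall 0 1) fun z hz => ?_)
  have : Ψ z = 0 := by
    by_contra h
    exact hz (hs h)
  rw [this, smul_zero]

theorem norm_scaledAverage_le {Ψ : Plane → F} (hΨ : Continuous Ψ)
    (hs : Function.support Ψ ⊆ Metric.closedBall 0 1) {f : Plane → ℝ} {ε : ℝ} (hε : 0 ≤ ε)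
    {x : Plane} {m : ℝ} (hm : ∀ y ∈ Metric.closedBall x ε, |f y| ≤ m) :
    ‖scaledAverage Ψ ε f x‖ ≤ (∫ z, ‖Ψ z‖) * m := by
  rw [mul_comm, ← integral_const_mul]
  have hi : Integrable Ψ := hΨ.integrable_of_hasCompactSupport
    (HasCompactSupport.intro (isCompact_closedBall 0 1) fun z hz => by
      by_contra h
      exact hz (hs h))
  refine norm_integral_le_of_norm_le (hi.norm.const_mul m) (Eventually.of_forall fun z => ?_)
  rw [norm_smul]
  by_cases hz : Ψ z = 0
  · simp [hz]
  · refine mul_le_mul_of_nonneg_right (hm _ ?_) (norm_nonneg _)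
    have := mem_closedBall_zero_iff.1 (hs hz)
    rw [Metric.mem_closedBall, dist_eq_norm, sub_sub_cancel_left, norm_neg, norm_smul,
      Real.norm_of_nonneg hε]
    nlinarith

/-- In the variable `ε⁻¹ x` the average is a convolution, so the derivative can be put on the smooth
kernel: `f` needs only continuity, and each derivative costs a factor `ε⁻¹`. -/
theorem hasFDerivAt_scaledAverage {Ψ : Plane → F} (hΨ : ContDiff ℝ ∞ Ψ)
    (hs : Function.support Ψ ⊆ Metric.closedBall 0 1) {f : Plane → ℝ} (hf : Continuous f)
    {ε : ℝ} (hε : ε ≠ 0) [CompleteSpace F] (x : Plane) :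
    HasFDerivAt (scaledAverage Ψ ε f) (ε⁻¹ • scaledAverage (fderiv ℝ Ψ) ε f x) x := by
  have hcs : HasCompactSupport Ψ :=
    HasCompactSupport.intro (isCompact_closedBall 0 1) fun z hz => by
      by_contra h
      exact hz (hs h)
  set L : F →L[ℝ] ℝ →L[ℝ] F := (ContinuousLinearMap.lsmul ℝ ℝ).flip with hL
  set g : Plane → ℝ := fun y => f (ε • y) with hg
  have hgc : Continuous g := by fun_prop
  have h1 := hcs.hasFDerivAt_convolution_left L (hΨ.of_le (by norm_cast))
    (hgc.locallyIntegrable (μ := volume)) (ε⁻¹ • x)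
  have h2 : scaledAverage Ψ ε f = fun x => (convolution Ψ g L volume) (ε⁻¹ • x) := by
    funext x
    simp only [scaledAverage, convolution, hL, hg, ContinuousLinearMap.flip_apply,
      ContinuousLinearMap.lsmul_apply, smul_sub, smul_smul, mul_inv_cancel₀ hε, one_smul]
  have h3 : HasFDerivAt (fun x : Plane => ε⁻¹ • x) (ε⁻¹ • ContinuousLinearMap.id ℝ Plane) x :=
    (hasFDerivAt_id x).const_smul ε⁻¹
  rw [h2]
  refine (HasFDerivAt.comp x h1 h3).congr_fderiv ?_
  rw [ContinuousLinearMap.comp_smul, ContinuousLinearMap.comp_id]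
  congr 1
  simp only [scaledAverage, convolution, hg, smul_sub, smul_smul, mul_inv_cancel₀ hε, one_smul]
  refine integral_congr_ae (Eventually.of_forall fun z => ?_)
  ext v
  simp [ContinuousLinearMap.precompL_apply, hL]

end ScaledAverage

theorem fderiv_scaledAverage {F : Type} [NormedAddCommGroup F] [NormedSpace ℝ F] [CompleteSpace F]
    {Ψ : Plane → F} (hΨ : ContDiff ℝ ∞ Ψ)
    (hs : Function.support Ψ ⊆ Metric.closedBall 0 1) {f : Plane → ℝ} (hf : Continuous f)
    {ε : ℝ} (hε : ε ≠ 0) :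
    fderiv ℝ (scaledAverage Ψ ε f) = ε⁻¹ • scaledAverage (fderiv ℝ Ψ) ε f :=
  funext fun x => (hasFDerivAt_scaledAverage hΨ hs hf hε x).fderiv

theorem support_fderiv_subset_closedBall {F : Type} [NormedAddCommGroup F] [NormedSpace ℝ F]
    {Ψ : Plane → F} (hs : Function.support Ψ ⊆ Metric.closedBall 0 1) :
    Function.support (fderiv ℝ Ψ) ⊆ Metric.closedBall 0 1 :=
  (support_fderiv_subset ℝ).trans (closure_minimal hs Metric.isClosed_closedBall)

theorem contDiff_fderiv_of_infty {E F : Type} [NormedAddCommGroup E] [NormedSpace ℝ E]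
    [NormedAddCommGroup F] [NormedSpace ℝ F]
    {Ψ : E → F} (hΨ : ContDiff ℝ ∞ Ψ) : ContDiff ℝ ∞ (fderiv ℝ Ψ) :=
  (contDiff_infty_iff_fderiv.1 hΨ).2

theorem contDiff_scaledAverage {F : Type} [NormedAddCommGroup F] [NormedSpace ℝ F]
    [CompleteSpace F] {Ψ : Plane → F} (hΨ : ContDiff ℝ ∞ Ψ)
    (hs : Function.support Ψ ⊆ Metric.closedBall 0 1) {f : Plane → ℝ} (hf : Continuous f)
    {ε : ℝ} (hε : ε ≠ 0) : ContDiff ℝ ∞ (scaledAverage Ψ ε f) := by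
  have hcs : HasCompactSupport Ψ :=
    HasCompactSupport.intro (isCompact_closedBall 0 1) fun z hz => by
      by_contra h
      exact hz (hs h)
  have h2 : scaledAverage Ψ ε f = fun x => (convolution Ψ (fun y => f (ε • y))
      (ContinuousLinearMap.lsmul ℝ ℝ).flip volume) (ε⁻¹ • x) := by
    funext x
    simp only [scaledAverage, convolution, ContinuousLinearMap.flip_apply,
      ContinuousLinearMap.lsmul_apply, smul_sub, smul_smul, mul_inv_cancel₀ hε, one_smul]
  rw [h2]
  exact (hcs.contDiff_convolution_left _ hΨ
    ((hf.comp (continuous_const_smul ε)).locallyIntegrable)).comp (contDiff_const_smul _)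

/-- Iterating the derivative formula, `C` is the `L¹` norm of the `j`-th derivative of the kernel.
The target space is quantified inside the induction because differentiating the kernel changes it.
-/
theorem exists_norm_iteratedFDeriv_scaledAverage_le (j : ℕ) :
    ∀ {F : Type} [NormedAddCommGroup F] [NormedSpace ℝ F] [CompleteSpace F] {Ψ : Plane → F},
      ContDiff ℝ ∞ Ψ → Function.support Ψ ⊆ Metric.closedBall 0 1 →
      ∃ C, 0 ≤ C ∧ ∀ (f : Plane → ℝ), Continuous f → ∀ ε > 0, ∀ (x : Plane) (m : ℝ),
        (∀ y ∈ Metric.closedBall x ε, |f y| ≤ m) →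
        ‖iteratedFDeriv ℝ j (scaledAverage Ψ ε f) x‖ ≤ C * (ε⁻¹ ^ j * m) := by
  induction j with
  | zero =>
    intro F _ _ _ Ψ hΨ hs
    refine ⟨∫ z, ‖Ψ z‖, integral_nonneg fun _ => norm_nonneg _, fun f hf ε hε x m hm => ?_⟩
    rw [norm_iteratedFDeriv_zero, pow_zero, one_mul]
    exact norm_scaledAverage_le hΨ.continuous hs hε.le hm
  | succ j ih =>
    intro F _ _ _ Ψ hΨ hs
    obtain ⟨C, hC, h⟩ := ih (contDiff_fderiv_of_infty hΨ) (support_fderiv_subset_closedBall hs)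
    refine ⟨C, hC, fun f hf ε hε x m hm => ?_⟩
    rw [← norm_iteratedFDeriv_fderiv, fderiv_scaledAverage hΨ hs hf hε.ne',
      iteratedFDeriv_const_smul_apply, norm_smul, norm_of_nonneg (inv_nonneg.2 hε.le)]
    · calc ε⁻¹ * ‖iteratedFDeriv ℝ j (scaledAverage (fderiv ℝ Ψ) ε f) x‖
          ≤ ε⁻¹ * (C * (ε⁻¹ ^ j * m)) :=
            mul_le_mul_of_nonneg_left (h f hf ε hε x m hm) (inv_nonneg.2 hε.le)
        _ = C * (ε⁻¹ ^ (j + 1) * m) := by ring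
    · exact ((contDiff_scaledAverage (contDiff_fderiv_of_infty hΨ)
        (support_fderiv_subset_closedBall hs) hf hε.ne').of_le (by exact_mod_cast le_top)).contDiffAt

theorem laplacian_scaledAverage {Ψ : Plane → ℝ} (hΨ : ContDiff ℝ ∞ Ψ)
    (hs : Function.support Ψ ⊆ Metric.closedBall 0 1) {f : Plane → ℝ} (hf : Continuous f)
    {ε : ℝ} (hε : ε ≠ 0) (x : Plane) :
    Laplacian.laplacian (scaledAverage Ψ ε f) x
      = ε⁻¹ ^ 2 * scaledAverage (Laplacian.laplacian Ψ) ε f x := by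
  have hΨ' := contDiff_fderiv_of_infty hΨ
  have hs' := support_fderiv_subset_closedBall hs
  have hs'' := support_fderiv_subset_closedBall hs'
  have hc := (contDiff_fderiv_of_infty hΨ').continuous
  have hd : ∀ x, HasFDerivAt (ε⁻¹ • scaledAverage (fderiv ℝ Ψ) ε f)
      (ε⁻¹ • ε⁻¹ • scaledAverage (fderiv ℝ (fderiv ℝ Ψ)) ε f x) x := fun x =>
    (hasFDerivAt_scaledAverage hΨ' hs' hf hε x).const_smul ε⁻¹
  have hi := integrable_scaledAverage hc hs'' hf ε x
  have e : ∀ v w : Plane, scaledAverage (fderiv ℝ (fderiv ℝ Ψ)) ε f x v w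
      = ∫ z, f (x - ε • z) * fderiv ℝ (fderiv ℝ Ψ) z v w := by
    intro v w
    rw [scaledAverage, ContinuousLinearMap.integral_apply hi,
      ContinuousLinearMap.integral_apply (hi.apply_continuousLinearMap v)]
    rfl
  rw [InnerProductSpace.laplacian_eq_iteratedFDeriv_orthonormalBasis _
    (EuclideanSpace.basisFun (Fin 2) ℝ), InnerProductSpace.laplacian_eq_iteratedFDeriv_orthonormalBasis _
    (EuclideanSpace.basisFun (Fin 2) ℝ)]
  simp only [iteratedFDeriv_two_apply, fderiv_scaledAverage hΨ hs hf hε, (hd _).fderiv,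
    Fin.sum_univ_two, scaledAverage, Matrix.cons_val_zero, Matrix.cons_val_one,
    smul_apply, smul_eq_mul]
  simp only [scaledAverage] at e
  rw [e, e]
  simp only [mul_add]
  rw [integral_add]
  · ring
  · exact ((hi.apply_continuousLinearMap _).apply_continuousLinearMap _)
  · exact ((hi.apply_continuousLinearMap _).apply_continuousLinearMap _)

/-! ### The Newtonian potential as a dyadic series -/

/-- The summation behind the Hölder seminorm. With `q = 2^{-α}`, the increasing series `d (2q)ⁿ` is
used up to `2⁻ⁿ ≈ d` and the decreasing series `qⁿ` afterwards. Both are geometric, since `1 < 2q`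
and `q < 1`, and both are dominated by their value at the crossing, about `d^α`. -/
theorem exists_tsum_min_le {α : ℝ} (hα : α ∈ Ioo (0 : ℝ) 1) :
    ∃ K, 0 ≤ K ∧ ∀ d > 0, ∑' n : ℕ, min (((1 / 2 : ℝ) ^ α) ^ n) (d * (2 * (1 / 2 : ℝ) ^ α) ^ n)
      ≤ K * d ^ α := by
  set q : ℝ := (1 / 2 : ℝ) ^ α with hq
  have q1 : q < 1 := Real.rpow_lt_one (by norm_num) (by norm_num) hα.1
  have q0 : 1 / 2 < q := by
    have := Real.rpow_lt_rpow_of_exponent_gt (x := 1 / 2) (by norm_num) (by norm_num) hα.2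
    rwa [Real.rpow_one] at this
  have hqs : Summable fun n => q ^ n := summable_geometric_of_lt_one (by linarith) q1
  have h0 : ∀ d > 0, ∀ n, 0 ≤ min (q ^ n) (d * (2 * q) ^ n) := fun d hd n =>
    le_min (by positivity) (by positivity)
  have hs : ∀ d > 0, Summable fun n => min (q ^ n) (d * (2 * q) ^ n) := fun d hd =>
    Summable.of_nonneg_of_le (h0 d hd) (fun n => min_le_left _ _) hqs
  have hK1 : 0 < 1 - q := by linarith
  have hK2 : 0 < 2 * q - 1 := by linarith
  refine ⟨2 / (2 * q - 1) + 1 / (1 - q), by positivity, fun d hd => ?_⟩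
  rcases lt_or_ge 1 d with h | h
  · have h1 : ∑' n, min (q ^ n) (d * (2 * q) ^ n) ≤ ∑' n, q ^ n :=
      (hs d hd).tsum_le_tsum (fun n => min_le_left _ _) hqs
    rw [tsum_geometric_of_lt_one (by linarith) q1] at h1
    have h2 : 1 ≤ d ^ α := Real.one_le_rpow h.le hα.1.le
    have h3 : 0 ≤ 2 / (2 * q - 1) := by positivity
    have h4 : 0 ≤ (1 - q)⁻¹ := by positivity
    rw [one_div]
    nlinarith
  · obtain ⟨m, hm1, hm2⟩ := exists_nat_pow_near_of_lt_one hd h (y := (1 / 2 : ℝ)) (by norm_num)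
      (by norm_num)
    have hqm : q ^ (m + 1) ≤ d ^ α := by
      rw [hq, ← Real.rpow_natCast, ← Real.rpow_mul (by norm_num), mul_comm, Real.rpow_mul
        (by norm_num), Real.rpow_natCast]
      exact Real.rpow_le_rpow (by positivity) hm1.le hα.1.le
    rw [← (hs d hd).sum_add_tsum_nat_add (m + 1), add_mul]
    refine add_le_add ?_ ?_
    · calc ∑ i ∈ Finset.range (m + 1), min (q ^ i) (d * (2 * q) ^ i)
          ≤ ∑ i ∈ Finset.range (m + 1), d * (2 * q) ^ i :=
            Finset.sum_le_sum fun i _ => min_le_right _ _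
        _ = d * (((2 * q) ^ (m + 1) - 1) / (2 * q - 1)) := by
            rw [← Finset.mul_sum, geom_sum_eq (by linarith)]
        _ ≤ d * ((2 * q) ^ (m + 1) / (2 * q - 1)) := by
            gcongr
            linarith
        _ = 2 / (2 * q - 1) * ((d * 2 ^ m) * q ^ (m + 1)) := by rw [mul_pow]; ring
        _ ≤ 2 / (2 * q - 1) * (1 * d ^ α) := by
            gcongr
            calc d * 2 ^ m ≤ (1 / 2) ^ m * 2 ^ m := by gcongr
              _ = 1 := by rw [← mul_pow]; norm_num
        _ = _ := by rw [one_mul]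
    · calc ∑' i, min (q ^ (i + (m + 1))) (d * (2 * q) ^ (i + (m + 1)))
          ≤ ∑' i, q ^ (m + 1) * q ^ i := by
            refine Summable.tsum_le_tsum (fun i => (min_le_left _ _).trans (by rw [pow_add]; linarith))
              ((summable_nat_add_iff (m + 1)).2 (hs d hd)) (hqs.mul_left _)
        _ = q ^ (m + 1) * (1 - q)⁻¹ := by
            rw [tsum_mul_left, tsum_geometric_of_lt_one (by linarith) q1]
        _ ≤ d ^ α * (1 - q)⁻¹ := by gcongr
        _ = _ := by ring

/-- The superposition of the averages of `f` at the scales `2⁻ⁿ`. -/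
def dyadicPotential (Ψ : Plane → ℝ) (f : Plane → ℝ) (x : Plane) : ℝ :=
  ∑' n : ℕ, (1 / 4 : ℝ) ^ n * scaledAverage Ψ ((1 / 2) ^ n) f x

theorem scaledAverage_sub_const {F : Type} [NormedAddCommGroup F] [NormedSpace ℝ F]
    {Ψ : Plane → F} (hΨ : Continuous Ψ)
    (hs : Function.support Ψ ⊆ Metric.closedBall 0 1) {f : Plane → ℝ} (hf : Continuous f)
    (ε c : ℝ) (x : Plane) :
    scaledAverage Ψ ε (fun y => f y - c) x = scaledAverage Ψ ε f x - c • ∫ z, Ψ z := by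
  have h1 := integrable_scaledAverage hΨ hs hf ε x
  have h2 := integrable_scaledAverage hΨ hs (continuous_const (y := c)) ε x
  simp only [scaledAverage, sub_smul]
  rw [integral_sub h1 h2, integral_smul]

/-- Derivatives of positive order do not see constants. Replacing `f` by `f - f x` turns the bound
on `f` into its oscillation `M ε^α` at scale `ε`. -/
theorem exists_norm_iteratedFDeriv_scaledAverage_holder_le {Ψ : Plane → ℝ} (hΨ : ContDiff ℝ ∞ Ψ)
    (hs : Function.support Ψ ⊆ Metric.closedBall 0 1) {α : ℝ} (hα : 0 ≤ α) {j : ℕ} (hj : j ≠ 0) :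
    ∃ C, 0 ≤ C ∧ ∀ (f : Plane → ℝ) (M : ℝ), Continuous f → 0 ≤ M →
      (∀ x y, |f x - f y| ≤ M * dist x y ^ α) → ∀ ε > 0, ∀ x,
        ‖iteratedFDeriv ℝ j (scaledAverage Ψ ε f) x‖ ≤ C * (ε⁻¹ ^ j * (M * ε ^ α)) := by
  obtain ⟨C, hC, h⟩ := exists_norm_iteratedFDeriv_scaledAverage_le j hΨ hs
  refine ⟨C, hC, fun f M hf hM hH ε hε x => ?_⟩
  have h1 := h (fun y => f y - f x) (by fun_prop) ε hε x (M * ε ^ α) fun y hy =>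
    (hH y x).trans (by gcongr; exact hy)
  have h2 : scaledAverage Ψ ε (fun y => f y - f x)
      = scaledAverage Ψ ε f - fun _ => f x • ∫ z, Ψ z :=
    funext fun y => scaledAverage_sub_const hΨ.continuous hs hf ε (f x) y
  rwa [h2, iteratedFDeriv_sub_apply
    (((contDiff_scaledAverage hΨ hs hf hε.ne').of_le (by exact_mod_cast le_top)).contDiffAt)
    contDiffAt_const, iteratedFDeriv_const_of_ne hj, Pi.zero_apply, sub_zero] at h1

/-- The factor `4 = 2²` is the Jacobian of the dilation in the plane. -/
theorem scaledAverage_two_smul {φ : Plane → ℝ} {f : Plane → ℝ} (ε : ℝ) (x : Plane) :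
    scaledAverage (fun y => 4 * φ ((2 : ℝ) • y)) ε f x = scaledAverage φ (ε / 2) f x := by
  have h := Measure.integral_comp_smul (volume : Measure Plane)
    (fun z => f (x - (ε / 2) • z) * (4 * φ z)) 2
  simp only [smul_smul, div_mul_cancel₀ ε (two_ne_zero' ℝ)] at h
  simp only [scaledAverage, smul_eq_mul]
  rw [h, smul_eq_mul, ← integral_const_mul]
  simp only [finrank_euclideanSpace, Fintype.card_fin]
  refine integral_congr_ae (Eventually.of_forall fun z => ?_)
  norm_num
  ring

/-- The unweighted Schauder estimate. Up to order two, derivatives of the `n`-th term are `O(qⁿ)`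
with `q = 2^{-α}`, so the series may be differentiated twice term by term. In the constant, `A (1 -
q)⁻¹` serves the sup norms and `2 A K` the Hölder seminorm. -/
theorem exists_dyadicPotential_estimate {φ Ψ : Plane → ℝ} (hφ : ContDiff ℝ ∞ φ)
    (hΨ : ContDiff ℝ ∞ Ψ) (hsφ : Function.support φ ⊆ Metric.closedBall 0 1)
    (hsΨ : Function.support Ψ ⊆ Metric.closedBall 0 1) (hφ1 : ∫ y, φ y = 1)
    (hΔ : ∀ y, Laplacian.laplacian Ψ y = 4 * φ ((2 : ℝ) • y) - φ y)
    {α : ℝ} (hα : α ∈ Ioo (0 : ℝ) 1) :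
    ∃ C, 0 ≤ C ∧ ∀ (f : Plane → ℝ) (M : ℝ), Continuous f → (∀ x, |f x| ≤ M) →
      (∀ x y, |f x - f y| ≤ M * dist x y ^ α) →
      ContDiff ℝ 2 (dyadicPotential Ψ f) ∧
      (∀ j ≤ 2, ∀ x, ‖iteratedFDeriv ℝ j (dyadicPotential Ψ f) x‖ ≤ C * M) ∧
      (∀ x y, ‖iteratedFDeriv ℝ 2 (dyadicPotential Ψ f) x
        - iteratedFDeriv ℝ 2 (dyadicPotential Ψ f) y‖ ≤ C * M * dist x y ^ α) ∧
      ∀ x, Laplacian.laplacian (dyadicPotential Ψ f) x = f x - scaledAverage φ 1 f x := by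
  set q : ℝ := (1 / 2 : ℝ) ^ α with hq
  have q1 : q < 1 := Real.rpow_lt_one (by norm_num) (by norm_num) hα.1
  have q0 : 1 / 2 < q := by
    have := Real.rpow_lt_rpow_of_exponent_gt (x := 1 / 2) (by norm_num) (by norm_num) hα.2
    rwa [Real.rpow_one] at this
  have hqs : Summable fun n => q ^ n := summable_geometric_of_lt_one (by linarith) q1
  have hεq : ∀ n : ℕ, ((1 / 2 : ℝ) ^ n) ^ α = q ^ n := fun n => by
    rw [hq, ← Real.rpow_natCast, ← Real.rpow_natCast, ← Real.rpow_mul (by norm_num),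
      ← Real.rpow_mul (by norm_num), mul_comm]
  obtain ⟨K, hK, hKs⟩ := exists_tsum_min_le hα
  obtain ⟨C₀, hC₀, h₀⟩ := exists_norm_iteratedFDeriv_scaledAverage_le 0 hΨ hsΨ
  obtain ⟨C₁, hC₁, h₁⟩ := exists_norm_iteratedFDeriv_scaledAverage_holder_le hΨ hsΨ hα.1.le
    one_ne_zero
  obtain ⟨C₂, hC₂, h₂⟩ := exists_norm_iteratedFDeriv_scaledAverage_holder_le hΨ hsΨ hα.1.le
    two_ne_zero
  obtain ⟨C₃, hC₃, h₃⟩ := exists_norm_iteratedFDeriv_scaledAverage_holder_le hΨ hsΨ hα.1.le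
    three_ne_zero
  set A := C₀ + C₁ + C₂ + C₃ with hA
  have hA0 : 0 ≤ A := by positivity
  refine ⟨A * (1 - q)⁻¹ + 2 * A * K, by have : 0 < 1 - q := by linarith
                                        positivity, fun f M hf hM hH => ?_⟩
  have hM0 : 0 ≤ M := (abs_nonneg _).trans (hM 0)
  set u : ℕ → Plane → ℝ := fun n => (1 / 4 : ℝ) ^ n • scaledAverage Ψ ((1 / 2) ^ n) f with hu
  have hε : ∀ n : ℕ, (0 : ℝ) < (1 / 2) ^ n := fun n => by positivity
  have hs : ∀ n, ContDiff ℝ ∞ (scaledAverage Ψ ((1 / 2) ^ n) f) := fun n =>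
    contDiff_scaledAverage hΨ hsΨ hf (hε n).ne'
  have hus : ∀ n, ContDiff ℝ ∞ (u n) := fun n => (hs n).const_smul ((1 / 4 : ℝ) ^ n)
  have hD : ∀ (j n : ℕ) (x : Plane), ‖iteratedFDeriv ℝ j (u n) x‖
      = (1 / 4 : ℝ) ^ n * ‖iteratedFDeriv ℝ j (scaledAverage Ψ ((1 / 2) ^ n) f) x‖ := by
    intro j n x
    rw [hu, iteratedFDeriv_const_smul_apply
      (((hs n).of_le (by exact_mod_cast le_top)).contDiffAt), norm_smul, norm_of_nonneg (by positivity)]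
  have hb0 : ∀ n x, ‖iteratedFDeriv ℝ 0 (u n) x‖ ≤ A * M * q ^ n := by
    intro n x
    rw [hD]
    have := h₀ f hf _ (hε n) x M fun y _ => hM y
    have hp : (1 / 4 : ℝ) ^ n ≤ q ^ n := pow_le_pow_left₀ (by norm_num) (by linarith) n
    calc _ ≤ q ^ n * (C₀ * (((1 / 2 : ℝ) ^ n)⁻¹ ^ 0 * M)) := by gcongr
      _ = C₀ * M * q ^ n := by ring
      _ ≤ A * M * q ^ n := by gcongr; linarith
  have hb1 : ∀ n x, ‖iteratedFDeriv ℝ 1 (u n) x‖ ≤ A * M * q ^ n := by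
    intro n x
    rw [hD]
    have := h₁ f M hf hM0 hH _ (hε n) x
    rw [hεq] at this
    have hp : (1 / 4 : ℝ) ^ n * (((1 / 2 : ℝ) ^ n)⁻¹ ^ 1) ≤ 1 := by
      rw [pow_one, ← inv_pow, ← mul_pow]
      exact pow_le_one₀ (by norm_num) (by norm_num)
    calc _ ≤ (1 / 4 : ℝ) ^ n * (C₁ * (((1 / 2 : ℝ) ^ n)⁻¹ ^ 1 * (M * q ^ n))) := by gcongr
      _ = ((1 / 4 : ℝ) ^ n * (((1 / 2 : ℝ) ^ n)⁻¹ ^ 1)) * (C₁ * M * q ^ n) := by ring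
      _ ≤ 1 * (A * M * q ^ n) := by gcongr; linarith
      _ = _ := one_mul _
  have hb2 : ∀ n x, ‖iteratedFDeriv ℝ 2 (u n) x‖ ≤ A * M * q ^ n := by
    intro n x
    rw [hD]
    have := h₂ f M hf hM0 hH _ (hε n) x
    rw [hεq] at this
    have hp : (1 / 4 : ℝ) ^ n * (((1 / 2 : ℝ) ^ n)⁻¹ ^ 2) ≤ 1 := by
      rw [← inv_pow, ← pow_mul, mul_comm n 2, pow_mul, ← mul_pow]
      exact pow_le_one₀ (by norm_num) (by norm_num)
    calc _ ≤ (1 / 4 : ℝ) ^ n * (C₂ * (((1 / 2 : ℝ) ^ n)⁻¹ ^ 2 * (M * q ^ n))) := by gcongr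
      _ = ((1 / 4 : ℝ) ^ n * (((1 / 2 : ℝ) ^ n)⁻¹ ^ 2)) * (C₂ * M * q ^ n) := by ring
      _ ≤ 1 * (A * M * q ^ n) := by gcongr; linarith
      _ = _ := one_mul _
  have hb3 : ∀ n x, ‖iteratedFDeriv ℝ 3 (u n) x‖ ≤ A * M * (2 * q) ^ n := by
    intro n x
    rw [hD]
    have := h₃ f M hf hM0 hH _ (hε n) x
    rw [hεq] at this
    have hp : (1 / 4 : ℝ) ^ n * (((1 / 2 : ℝ) ^ n)⁻¹ ^ 3) = 2 ^ n := by
      rw [← inv_pow, ← pow_mul, mul_comm n 3, pow_mul, ← mul_pow]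
      norm_num
    calc _ ≤ (1 / 4 : ℝ) ^ n * (C₃ * (((1 / 2 : ℝ) ^ n)⁻¹ ^ 3 * (M * q ^ n))) := by gcongr
      _ = ((1 / 4 : ℝ) ^ n * (((1 / 2 : ℝ) ^ n)⁻¹ ^ 3)) * (C₃ * M * q ^ n) := by ring
      _ = C₃ * M * (2 * q) ^ n := by rw [hp, mul_pow]; ring
      _ ≤ _ := by gcongr; linarith
  have hb : ∀ (k n : ℕ) (x : Plane), (k : ℕ∞) ≤ (2 : ℕ∞) →
      ‖iteratedFDeriv ℝ k (u n) x‖ ≤ A * M * q ^ n := by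
    intro k n x hk
    have hk : k ≤ 2 := by exact_mod_cast hk
    interval_cases k
    exacts [hb0 n x, hb1 n x, hb2 n x]
  have hsum : ∀ k : ℕ, (k : ℕ∞) ≤ (2 : ℕ∞) → Summable fun n => A * M * q ^ n :=
    fun _ _ => hqs.mul_left _
  have hu2 : ∀ n, ContDiff ℝ ((2 : ℕ∞) : WithTop ℕ∞) (u n) := fun n => (hus n).of_le (by norm_cast)
  have hv : dyadicPotential Ψ f = fun x => ∑' n, u n x := rfl
  have hDv : ∀ k ≤ 2, ∀ x, iteratedFDeriv ℝ k (dyadicPotential Ψ f) x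
      = ∑' n, iteratedFDeriv ℝ k (u n) x := fun k hk x => by
    rw [hv]
    exact iteratedFDeriv_tsum_apply hu2 hsum hb (by exact_mod_cast hk) x
  have hDs : ∀ k ≤ 2, ∀ x, Summable fun n => iteratedFDeriv ℝ k (u n) x := fun k hk x =>
    Summable.of_norm_bounded (hsum 0 (by simp)) fun n => hb k n x (by exact_mod_cast hk)
  have hcd : ContDiff ℝ 2 (dyadicPotential Ψ f) := by
    rw [hv]
    exact contDiff_tsum hu2 hsum hb
  have hq1 : 0 < 1 - q := by linarith
  refine ⟨hcd, fun j hj x => ?_, fun x y => ?_, fun x => ?_⟩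
  · rw [hDv j hj x]
    have h1 := tsum_of_norm_bounded (hsum 0 (by simp)).hasSum
      fun n => hb j n x (by exact_mod_cast hj)
    rw [tsum_mul_left, tsum_geometric_of_lt_one (by linarith) q1] at h1
    have : 0 ≤ 2 * A * K * M := by positivity
    linarith
  · rcases eq_or_ne x y with rfl | hxy
    · simp only [sub_self, norm_zero]
      positivity
    rw [hDv 2 le_rfl x, hDv 2 le_rfl y, ← (hDs 2 le_rfl x).tsum_sub (hDs 2 le_rfl y)]
    have hd : 0 < dist x y := dist_pos.2 hxy
    -- The first bound adds the two sup norms; the second is the mean value inequality with the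
    -- third derivative, which grows like `(2q)ⁿ`.
    have hmin : ∀ n, ‖iteratedFDeriv ℝ 2 (u n) x - iteratedFDeriv ℝ 2 (u n) y‖
        ≤ 2 * A * M * min (q ^ n) (dist x y * (2 * q) ^ n) := by
      intro n
      rw [mul_min_of_nonneg _ _ (by positivity)]
      refine le_min ?_ ?_
      · refine (norm_sub_le _ _).trans ?_
        linarith [hb2 n x, hb2 n y]
      · have hdiff : Differentiable ℝ (iteratedFDeriv ℝ 2 (u n)) :=
          (hus n).differentiable_iteratedFDeriv (by norm_cast)
        have := convex_univ.norm_image_sub_le_of_norm_fderiv_le (𝕜 := ℝ)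
          (f := iteratedFDeriv ℝ 2 (u n)) (C := A * M * (2 * q) ^ n) (x := y) (y := x)
          (fun z _ => hdiff z) (fun z _ => by
            rw [norm_fderiv_iteratedFDeriv]; exact hb3 n z) (mem_univ _) (mem_univ _)
        rw [← dist_eq_norm x y] at this
        refine this.trans ?_
        have : 0 ≤ A * M * (2 * q) ^ n * dist x y := by positivity
        linarith
    have hms : Summable fun n => min (q ^ n) (dist x y * (2 * q) ^ n) :=
      Summable.of_nonneg_of_le (fun n => le_min (by positivity) (by positivity))
        (fun n => min_le_left _ _) hqs
    refine (tsum_of_norm_bounded (hms.mul_left (2 * A * M)).hasSum hmin).trans ?_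
    rw [tsum_mul_left]
    calc 2 * A * M * ∑' n, min (q ^ n) (dist x y * (2 * q) ^ n)
        ≤ 2 * A * M * (K * dist x y ^ α) := by gcongr; exact hKs _ hd
      _ = 0 + 2 * A * K * M * dist x y ^ α := by ring
      _ ≤ A * (1 - q)⁻¹ * M * dist x y ^ α + 2 * A * K * M * dist x y ^ α := by gcongr; positivity
      _ = _ := by ring
  · have hlap : ∀ g : Plane → ℝ, Laplacian.laplacian g x
        = ∑ i : Fin 2, iteratedFDeriv ℝ 2 g x
          ![EuclideanSpace.basisFun (Fin 2) ℝ i, EuclideanSpace.basisFun (Fin 2) ℝ i] := fun g =>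
      congrFun (InnerProductSpace.laplacian_eq_iteratedFDeriv_orthonormalBasis g
        (EuclideanSpace.basisFun (Fin 2) ℝ)) x
    have h1 : HasSum (fun n => Laplacian.laplacian (u n) x)
        (Laplacian.laplacian (dyadicPotential Ψ f) x) := by
      simp only [hlap]
      refine hasSum_sum fun i _ => ?_
      rw [hDv 2 le_rfl x]
      exact (hDs 2 le_rfl x).hasSum.mapL (ContinuousMultilinearMap.apply ℝ (fun _ : Fin 2 => Plane) ℝ
        ![EuclideanSpace.basisFun (Fin 2) ℝ i, EuclideanSpace.basisFun (Fin 2) ℝ i])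
    -- The weight `4⁻ⁿ` cancels the factor `ε⁻²` at `ε = 2⁻ⁿ`. The series of Laplacians therefore
    -- telescopes, from the average at scale `1` to the limit `f x`.
    have hfφ : ∀ n : ℕ, Laplacian.laplacian (u n) x = scaledAverage φ ((1 / 2) ^ (n + 1)) f x
        - scaledAverage φ ((1 / 2) ^ n) f x := by
      intro n
      have h2 : Laplacian.laplacian Ψ = fun y => 4 * φ ((2 : ℝ) • y) - φ y := funext hΔ
      have hp : (1 / 4 : ℝ) ^ n * (((1 / 2 : ℝ) ^ n)⁻¹ ^ 2) = 1 := by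
        rw [← inv_pow, ← pow_mul, mul_comm n 2, pow_mul, ← mul_pow]
        norm_num
      have hp2 : (1 / 2 : ℝ) ^ (n + 1) = (1 / 2) ^ n / 2 := by ring
      rw [hu, InnerProductSpace.laplacian_smul _ ((hs n).contDiffAt.of_le (by norm_cast)),
        laplacian_scaledAverage hΨ hsΨ hf (hε n).ne', h2, hp2, ← scaledAverage_two_smul,
        smul_eq_mul, ← mul_assoc, hp, one_mul]
      have hs2 : Function.support (fun y : Plane => 4 * φ ((2 : ℝ) • y)) ⊆ Metric.closedBall 0 1 := by
        intro y hy
        have h3 : (2 : ℝ) • y ∈ Function.support φ := fun h => hy (by simp [h])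
        have := mem_closedBall_zero_iff.1 (hsφ h3)
        rw [norm_smul, Real.norm_of_nonneg (by norm_num)] at this
        rw [mem_closedBall_zero_iff]
        linarith [norm_nonneg y]
      have hc2 : Continuous (fun y : Plane => 4 * φ ((2 : ℝ) • y)) := by
        have := hφ.continuous
        fun_prop
      simp only [scaledAverage]
      rw [← integral_sub (integrable_scaledAverage hc2 hs2 hf _ x)
        (integrable_scaledAverage hφ.continuous hsφ hf _ x)]
      simp only [smul_eq_mul, mul_sub]
    have h2 := h1.tendsto_sum_nat
    simp only [hfφ] at h2
    simp only [Finset.sum_range_sub (fun n => scaledAverage φ ((1 / 2) ^ n) f x), pow_zero] at h2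
    have h3 : Tendsto (fun n : ℕ => scaledAverage φ ((1 / 2) ^ n) f x) atTop (𝓝 (f x)) := by
      rw [tendsto_iff_norm_sub_tendsto_zero]
      have h4 : Tendsto (fun n : ℕ => (∫ z, ‖φ z‖) * (M * q ^ n)) atTop (𝓝 0) := by
        have := (tendsto_pow_atTop_nhds_zero_of_lt_one (by linarith) q1).const_mul
          ((∫ z, ‖φ z‖) * M)
        simpa [mul_assoc] using this
      refine squeeze_zero (fun _ => norm_nonneg _) (fun n => ?_) h4
      have h5 := scaledAverage_sub_const hφ.continuous hsφ hf ((1 / 2) ^ n) (f x) x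
      rw [hφ1, smul_eq_mul, mul_one] at h5
      rw [← h5]
      refine norm_scaledAverage_le hφ.continuous hsφ (hε n).le fun y hy => (hH y x).trans ?_
      rw [← hεq]
      exact mul_le_mul_of_nonneg_left (Real.rpow_le_rpow dist_nonneg hy hα.1.le) hM0
    exact tendsto_nhds_unique h2 (h3.sub_const _)

/-! ### Weights -/

theorem cosh_le_exp_mul_cosh (s t : ℝ) : cosh t ≤ exp |t - s| * cosh s := by
  rw [Real.cosh_eq, Real.cosh_eq]
  have h1 : exp t ≤ exp |t - s| * exp s := by
    rw [← Real.exp_add]; exact Real.exp_le_exp.2 (by linarith [le_abs_self (t - s)])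
  have h2 : exp (-t) ≤ exp |t - s| * exp (-s) := by
    rw [← Real.exp_add]; exact Real.exp_le_exp.2 (by linarith [neg_abs_le (t - s)])
  linarith

/-- `log cosh` is 1-Lipschitz; for negative `ρ` the roles of `s` and `t` are exchanged. -/
theorem cosh_rpow_le (ρ s t : ℝ) : cosh t ^ ρ ≤ exp (|ρ| * |t - s|) * cosh s ^ ρ := by
  have h : ∀ s t : ℝ, ∀ r ≥ 0, cosh t ^ r ≤ exp (r * |t - s|) * cosh s ^ r := fun s t r hr => by
    rw [mul_comm r, Real.exp_mul, ← Real.mul_rpow (Real.exp_pos _).le (Real.cosh_pos _).le]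
    exact Real.rpow_le_rpow (Real.cosh_pos _).le (cosh_le_exp_mul_cosh s t) hr
  rcases le_total 0 ρ with h0 | h0
  · rw [abs_of_nonneg h0]
    exact h s t ρ h0
  · have h1 := h t s (-ρ) (by linarith)
    rw [Real.rpow_neg (Real.cosh_pos _).le, Real.rpow_neg (Real.cosh_pos _).le, abs_sub_comm] at h1
    rw [abs_of_nonpos h0]
    have a : 0 < cosh s ^ ρ := Real.rpow_pos_of_pos (Real.cosh_pos _) _
    have b : 0 < cosh t ^ ρ := Real.rpow_pos_of_pos (Real.cosh_pos _) _
    calc cosh t ^ ρ = (cosh s ^ ρ)⁻¹ * (cosh t ^ ρ * cosh s ^ ρ) := by field_simp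
      _ ≤ (exp (-ρ * |t - s|) * (cosh t ^ ρ)⁻¹) * (cosh t ^ ρ * cosh s ^ ρ) := by gcongr
      _ = _ := by field_simp

/-- The weight `cosh^ρ(s)` on the plane. -/
def planeWeight (ρ : ℝ) (p : Plane) : ℝ := cosh (p 1) ^ ρ

theorem planeWeight_pos (ρ : ℝ) (p : Plane) : 0 < planeWeight ρ p :=
  Real.rpow_pos_of_pos (Real.cosh_pos _) _

theorem abs_coord_le_norm (p : Plane) (i : Fin 2) : |p i| ≤ ‖p‖ := by
  simpa using PiLp.norm_apply_le p i

theorem planeWeight_le {ρ : ℝ} (hρ : |ρ| ≤ 1) {p q : Plane} {r : ℝ} (h : dist p q ≤ r) :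
    planeWeight ρ q ≤ exp r * planeWeight ρ p := by
  refine (cosh_rpow_le ρ (p 1) (q 1)).trans ?_
  refine mul_le_mul_of_nonneg_right (Real.exp_le_exp.2 ?_) (planeWeight_pos ρ p).le
  have : |q 1 - p 1| ≤ dist p q := by
    rw [dist_comm, dist_eq_norm]
    exact abs_coord_le_norm (q - p) 1
  nlinarith [abs_nonneg (q 1 - p 1), abs_nonneg ρ]

/-- Bounds of weighted Hölder type on the unit scale. -/
structure HolderBound (ρ α N : ℝ) (f : Plane → ℝ) : Prop where
  le : ∀ p, |f p| ≤ N * planeWeight ρ p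
  holder : ∀ p q, dist p q < 1 → |f p - f q| ≤ N * planeWeight ρ p * dist p q ^ α

theorem HolderBound.nonneg {ρ α N : ℝ} {f : Plane → ℝ} (h : HolderBound ρ α N f) : 0 ≤ N := by
  have := (abs_nonneg _).trans (h.le 0)
  exact nonneg_of_mul_nonneg_left this (planeWeight_pos ρ 0)

theorem HolderBound.continuous {ρ α N : ℝ} (hα : 0 < α) {f : Plane → ℝ} (h : HolderBound ρ α N f) :
    Continuous f := by
  rw [continuous_iff_continuousAt]
  intro p
  rw [ContinuousAt, tendsto_iff_dist_tendsto_zero]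
  have h1 : Tendsto (fun q => N * planeWeight ρ p * dist p q ^ α) (𝓝 p) (𝓝 0) := by
    have : Tendsto (fun q => dist p q ^ α) (𝓝 p) (𝓝 (dist p p ^ α)) :=
      ((continuous_const.dist continuous_id).rpow_const fun _ => Or.inr hα.le).tendsto p
    rw [dist_self, Real.zero_rpow hα.ne'] at this
    simpa using this.const_mul (N * planeWeight ρ p)
  refine squeeze_zero' (Eventually.of_forall fun _ => dist_nonneg) ?_ h1
  filter_upwards [Metric.ball_mem_nhds p one_pos] with q hq
  rw [dist_comm (f q), Real.dist_eq]
  exact h.holder p q (by rwa [dist_comm])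

/-! ### The dyadic potential in weighted Hölder spaces -/

theorem scaledAverage_congr {F : Type} [NormedAddCommGroup F] [NormedSpace ℝ F] {Ψ : Plane → F}
    (hs : Function.support Ψ ⊆ Metric.closedBall 0 1) {f g : Plane → ℝ} {ε : ℝ} (h0 : 0 ≤ ε)
    {x : Plane} (h : ∀ y ∈ Metric.closedBall x ε, f y = g y) :
    scaledAverage Ψ ε f x = scaledAverage Ψ ε g x := by
  refine integral_congr_ae (Eventually.of_forall fun z => ?_)
  by_cases hz : Ψ z = 0
  · simp [hz]
  · have hz1 : ‖z‖ ≤ 1 := mem_closedBall_zero_iff.1 (hs hz)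
    have : x - ε • z ∈ Metric.closedBall x ε := by
      rw [mem_closedBall_iff_norm, sub_sub_cancel_left, norm_neg, norm_smul, norm_of_nonneg h0]
      nlinarith
    simp only [h _ this]

/-- Reduces weighted estimates to the global one. On the unit disc around `p` the dyadic potential
involves only values of `f` within distance `2` of `p`, where the cutoff equals `1`. The cutoff is
1-Lipschitz and vanishes beyond distance `3`. The factor `exp 4` compares the weights up to distance
`4`, and the `2` adds the oscillation of the cutoff to that of `f`. -/
theorem HolderBound.exists_cutoff {ρ α N : ℝ} (hρ : |ρ| ≤ 1) (hα : α ∈ Ioo (0 : ℝ) 1)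
    {f : Plane → ℝ} (h : HolderBound ρ α N f) (p : Plane) :
    ∃ g : Plane → ℝ, Continuous g ∧ (∀ x ∈ Metric.closedBall p 2, f x = g x) ∧
      (∀ x, |g x| ≤ 2 * exp 4 * N * planeWeight ρ p) ∧
      ∀ x y, |g x - g y| ≤ 2 * exp 4 * N * planeWeight ρ p * dist x y ^ α := by
  have hN := h.nonneg
  have hfc := h.continuous hα.1
  set χ : Plane → ℝ := fun x => max 0 (min 1 (3 - dist x p)) with hχ
  have χ0 : ∀ x, 0 ≤ χ x := fun x => le_max_left _ _
  have χ1 : ∀ x, χ x ≤ 1 := fun x => max_le zero_le_one (min_le_left _ _)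
  have χ3 : ∀ x, 3 ≤ dist x p → χ x = 0 := fun x hx =>
    max_eq_left ((min_le_right _ _).trans (by linarith))
  have χl : ∀ x y, |χ x - χ y| ≤ dist x y := fun x y => by
    refine (abs_max_sub_max_le_max _ _ _ _).trans ?_
    rw [sub_self, abs_zero]
    refine max_le dist_nonneg ((abs_min_sub_min_le_max _ _ _ _).trans ?_)
    rw [sub_self, abs_zero]
    refine max_le dist_nonneg ?_
    rw [sub_sub_sub_cancel_left, abs_sub_comm]
    exact abs_dist_sub_le x y p
  have hW := planeWeight_pos ρ p
  set B := exp 4 * N * planeWeight ρ p with hB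
  have hB0 : 0 ≤ B := by positivity
  have hw : ∀ x, dist x p ≤ 4 → N * planeWeight ρ x ≤ B := fun x hx => by
    have := planeWeight_le hρ (p := p) (q := x) (r := 4) (by rwa [dist_comm])
    calc _ ≤ N * (exp 4 * planeWeight ρ p) := by gcongr
      _ = B := by ring
  have hgb : ∀ x, |χ x * f x| ≤ B := fun x => by
    rcases le_total 3 (dist x p) with hx | hx
    · rw [χ3 x hx, zero_mul, abs_zero]; exact hB0
    · rw [abs_mul, abs_of_nonneg (χ0 x)]
      calc _ ≤ 1 * |f x| := by gcongr; exact χ1 x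
        _ ≤ B := by rw [one_mul]; exact (h.le x).trans (hw x (by linarith))
  have hBB : 2 * exp 4 * N * planeWeight ρ p = B + B := by ring
  simp only [hBB]
  refine ⟨fun x => χ x * f x, by fun_prop, fun x hx => ?_, fun x => by linarith [hgb x],
    fun x y => ?_⟩
  · have hx : dist x p ≤ 2 := hx
    have : χ x = 1 := by
      simp only [hχ]
      rw [min_eq_left (by linarith), max_eq_right zero_le_one]
    simp only [this, one_mul]
  · rcases le_or_gt 1 (dist x y) with hd | hd
    · have h1 : 1 ≤ dist x y ^ α := Real.one_le_rpow hd hα.1.le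
      calc |χ x * f x - χ y * f y| ≤ |χ x * f x| + |χ y * f y| := abs_sub _ _
        _ ≤ (B + B) * 1 := by linarith [hgb x, hgb y]
        _ ≤ _ := by gcongr
    · have hda : dist x y ≤ dist x y ^ α := by
        simpa using Real.rpow_le_rpow_of_exponent_ge' dist_nonneg hd.le hα.1.le hα.2.le
      by_cases hx : dist x p ≤ 4 ∧ dist y p ≤ 4
      · have e : χ x * f x - χ y * f y = χ x * (f x - f y) + (χ x - χ y) * f y := by ring
        rw [e]
        refine (abs_add_le _ _).trans ?_
        rw [abs_mul, abs_mul, abs_of_nonneg (χ0 x), add_mul]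
        refine add_le_add ?_ ?_
        · calc _ ≤ 1 * (N * planeWeight ρ x * dist x y ^ α) :=
                mul_le_mul (χ1 x) (h.holder x y hd) (abs_nonneg _) zero_le_one
            _ ≤ _ := by rw [one_mul]; gcongr; exact hw x hx.1
        · calc _ ≤ dist x y ^ α * B :=
                mul_le_mul ((χl x y).trans hda) ((h.le y).trans (hw y hx.2)) (abs_nonneg _)
                  (by positivity)
            _ = _ := mul_comm _ _
      -- The points are less than `1` apart and one is farther than `4` from `p`, so the cutoff
      -- vanishes at both.
      · have hx3 : 3 ≤ dist x p ∧ 3 ≤ dist y p := by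
          have a := dist_triangle x y p
          have b := dist_triangle y x p
          rw [dist_comm y x] at b
          rw [not_and_or, not_le, not_le] at hx
          constructor <;> rcases hx with hx | hx <;> linarith
        simp only [χ3 x hx3.1, χ3 y hx3.2, zero_mul, sub_self, abs_zero]
        positivity

theorem exists_dyadicPotential_weighted_estimate {φ Ψ : Plane → ℝ} (hφ : ContDiff ℝ ∞ φ)
    (hΨ : ContDiff ℝ ∞ Ψ) (hsφ : Function.support φ ⊆ Metric.closedBall 0 1)
    (hsΨ : Function.support Ψ ⊆ Metric.closedBall 0 1) (hφ1 : ∫ y, φ y = 1)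
    (hΔ : ∀ y, Laplacian.laplacian Ψ y = 4 * φ ((2 : ℝ) • y) - φ y)
    {ρ α : ℝ} (hρ : |ρ| ≤ 1) (hα : α ∈ Ioo (0 : ℝ) 1) :
    ∃ C, 0 ≤ C ∧ ∀ (f : Plane → ℝ) (N : ℝ), HolderBound ρ α N f →
      ContDiff ℝ 2 (dyadicPotential Ψ f) ∧
      (∀ j ≤ 2, ∀ p, ∀ x ∈ Metric.ball p 1,
        ‖iteratedFDeriv ℝ j (dyadicPotential Ψ f) x‖ ≤ C * N * planeWeight ρ p) ∧
      (∀ p, ∀ x ∈ Metric.ball p 1, ∀ y ∈ Metric.ball p 1,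
        ‖iteratedFDeriv ℝ 2 (dyadicPotential Ψ f) x - iteratedFDeriv ℝ 2 (dyadicPotential Ψ f) y‖
          ≤ C * N * planeWeight ρ p * dist x y ^ α) ∧
      ∀ x, Laplacian.laplacian (dyadicPotential Ψ f) x = f x - scaledAverage φ 1 f x := by
  obtain ⟨C, hC, h⟩ := exists_dyadicPotential_estimate hφ hΨ hsφ hsΨ hφ1 hΔ hα
  refine ⟨C * (2 * exp 4), by positivity, fun f N hf => ?_⟩
  have key : ∀ p, ∃ v : Plane → ℝ, ContDiff ℝ 2 v ∧
      (∀ x ∈ Metric.ball p 1, dyadicPotential Ψ f =ᶠ[𝓝 x] v) ∧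
      (∀ j ≤ 2, ∀ x, ‖iteratedFDeriv ℝ j v x‖ ≤ C * (2 * exp 4) * N * planeWeight ρ p) ∧
      (∀ x y, ‖iteratedFDeriv ℝ 2 v x - iteratedFDeriv ℝ 2 v y‖
        ≤ C * (2 * exp 4) * N * planeWeight ρ p * dist x y ^ α) ∧
      Laplacian.laplacian v p = f p - scaledAverage φ 1 f p := by
    intro p
    obtain ⟨g, hgc, hgf, hgb, hgh⟩ := hf.exists_cutoff hρ hα p
    obtain ⟨h1, h2, h3, h4⟩ := h g _ hgc hgb hgh
    have e : C * (2 * exp 4) * N * planeWeight ρ p = C * (2 * exp 4 * N * planeWeight ρ p) := by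
      ring
    refine ⟨_, h1, fun x hx => ?_, by rwa [e], by rwa [e], ?_⟩
    · filter_upwards [Metric.isOpen_ball.mem_nhds hx] with x hx
      refine tsum_congr fun n => ?_
      have hn : ((1 : ℝ) / 2) ^ n ≤ 1 := pow_le_one₀ (by norm_num) (by norm_num)
      rw [scaledAverage_congr hsΨ (by positivity) fun y hy => hgf y ?_]
      have a := dist_triangle y x p
      have b : dist x p < 1 := hx
      have c : dist y x ≤ (1 / 2) ^ n := hy
      rw [Metric.mem_closedBall]
      linarith
    · rw [h4, hgf p (Metric.mem_closedBall_self zero_le_two),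
        scaledAverage_congr hsφ zero_le_one fun y hy => hgf y
          (Metric.closedBall_subset_closedBall one_le_two hy)]
  refine ⟨?_, fun j hj p x hx => ?_, fun p x hx y hy => ?_, fun p => ?_⟩
  · rw [contDiff_iff_contDiffAt]
    intro p
    obtain ⟨v, hv, hve, -⟩ := key p
    exact hv.contDiffAt.congr_of_eventuallyEq (hve p (Metric.mem_ball_self one_pos))
  · obtain ⟨v, hv, hve, hvb, -⟩ := key p
    rw [((hve x hx).iteratedFDeriv ℝ j).eq_of_nhds]
    exact hvb j hj x
  · obtain ⟨v, hv, hve, -, hvh, -⟩ := key p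
    rw [((hve x hx).iteratedFDeriv ℝ 2).eq_of_nhds, ((hve y hy).iteratedFDeriv ℝ 2).eq_of_nhds]
    exact hvh x y
  · obtain ⟨v, hv, hve, -, -, hvl⟩ := key p
    rw [← hvl]
    exact (InnerProductSpace.laplacian_congr_nhds
      (hve p (Metric.mem_ball_self one_pos))).eq_of_nhds

/-! ### The source terms -/

theorem weightedNorm_zero_bounds {ρ α : ℝ} {D : Set Cylinder} {u : Cylinder → ℝ}
    (h : weightedNorm 0 α D (coshWeight ρ) u < ⊤) {p x : Plane} (hp : p ∈ cover ⁻¹' D)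
    (hx : x ∈ cover ⁻¹' D) (hpx : dist p x < 1) :
    |lift u p| ≤ (weightedNorm 0 α D (coshWeight ρ) u).toReal * planeWeight ρ p ∧
    |lift u p - lift u x|
      ≤ (weightedNorm 0 α D (coshWeight ρ) u).toReal * planeWeight ρ p * dist p x ^ α := by
  have hw := planeWeight_pos ρ p
  set W := weightedNorm 0 α D (coshWeight ρ) u with hW
  have h1 : holderNorm 0 α (cover ⁻¹' D ∩ Metric.ball p 1) (lift u)
      / ENNReal.ofReal (planeWeight ρ p) ≤ W :=
    le_iSup₂ (f := fun p (_ : p ∈ cover ⁻¹' D) =>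
      holderNorm 0 α (cover ⁻¹' D ∩ Metric.ball p 1) (lift u)
        / ENNReal.ofReal (coshWeight ρ (cover p))) p hp
  rw [ENNReal.div_le_iff (by simpa using hw) ENNReal.ofReal_ne_top, holderNorm_zero] at h1
  have hW' : W * ENNReal.ofReal (planeWeight ρ p)
      = ENNReal.ofReal (W.toReal * planeWeight ρ p) := by
    rw [ENNReal.ofReal_mul ENNReal.toReal_nonneg, ENNReal.ofReal_toReal h.ne]
  rw [hW'] at h1
  have hpp : p ∈ cover ⁻¹' D ∩ Metric.ball p 1 := ⟨hp, Metric.mem_ball_self one_pos⟩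
  have hxp : x ∈ cover ⁻¹' D ∩ Metric.ball p 1 := ⟨hx, by rwa [Metric.mem_ball, dist_comm]⟩
  have hc : 0 ≤ W.toReal * planeWeight ρ p := by positivity
  constructor
  · have h2 : ‖lift u p‖ₑ ≤ ENNReal.ofReal (W.toReal * planeWeight ρ p) :=
      (le_iSup₂ (f := fun x (_ : x ∈ cover ⁻¹' D ∩ Metric.ball p 1) => ‖lift u x‖ₑ) p hpp).trans
        (le_self_add.trans h1)
    rw [← ofReal_norm, ENNReal.ofReal_le_ofReal_iff hc] at h2
    exact h2
  · rcases eq_or_ne p x with rfl | hne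
    · simp only [sub_self, abs_zero]; positivity
    have h2 : ‖lift u p - lift u x‖ₑ / edist p x ^ α
        ≤ ENNReal.ofReal (W.toReal * planeWeight ρ p) :=
      (le_iSup₂_of_le p hpp (le_iSup₂_of_le x hxp (le_iSup_of_le hne le_rfl)) :
        _ ≤ holderSeminorm α _ _).trans (le_add_self.trans h1)
    have hd : 0 < dist p x := dist_pos.2 hne
    rw [edist_dist, ENNReal.ofReal_rpow_of_pos hd, ENNReal.div_le_iff (by simp; positivity)
      ENNReal.ofReal_ne_top, ← ENNReal.ofReal_mul hc, ← ofReal_norm,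
      ENNReal.ofReal_le_ofReal_iff (by positivity)] at h2
    exact h2

/-- The extension by zero stays Hölder because `E` vanishes on `s = ℓ`. The factor `exp 1` is needed
when the first point lies above the boundary and the second below: the norm then carries the weight
at the second point. -/
theorem holderBound_of_mem_sourceSpace {ρ α : ℝ} (hρ : |ρ| ≤ 1) (hα : 0 < α) {l : EReal}
    {E : Cylinder → ℝ} (hE : E ∈ sourceSpace ρ α l) :
    HolderBound ρ α (exp 1 * (weightedNorm 0 α (below l) (coshWeight ρ) E).toReal) (lift E) := by
  obtain ⟨⟨-, hE⟩, h0, -⟩ := hE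
  set N := (weightedNorm 0 α (below l) (coshWeight ρ) E).toReal with hN
  have hN0 : 0 ≤ N := ENNReal.toReal_nonneg
  have he : 1 ≤ exp 1 := Real.one_le_exp zero_le_one
  have hNe : N ≤ exp 1 * N := by nlinarith
  have hab : ∀ p : Plane, p ∈ cover ⁻¹' below l ∨ cover p ∈ above l := fun p =>
    le_total ((p 1 : ℝ) : EReal) l
  have hz : ∀ p : Plane, cover p ∈ above l → lift E p = 0 := fun p hp => h0 _ hp
  have hcross : ∀ p q : Plane, p ∈ cover ⁻¹' below l → cover q ∈ above l → dist p q < 1 →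
      |lift E p| ≤ N * planeWeight ρ p * dist p q ^ α := by
    intro p q hp hq hd
    have hp' : ((p 1 : ℝ) : EReal) ≤ l := hp
    have hq' : l ≤ ((q 1 : ℝ) : EReal) := hq
    lift l to ℝ using ⟨ne_top_of_le_ne_top (EReal.coe_ne_top _) hq',
      ne_bot_of_le_ne_bot (EReal.coe_ne_bot _) hp'⟩
    rw [EReal.coe_le_coe_iff] at hp' hq'
    -- The vertical projection of `p` to the boundary: `E` vanishes there, and it is no farther from
    -- `p` than `q` is.
    set b : Plane := !₂[p 0, l] with hb
    have hb1 : b 1 = l := rfl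
    have hbd : dist p b ≤ dist p q := by
      have h1 : dist p b = |p 1 - l| := by
        rw [EuclideanSpace.dist_eq]
        simp [Fin.sum_univ_two, hb, Real.dist_eq, Real.sqrt_sq_eq_abs]
      have h2 := abs_coord_le_norm (p - q) 1
      rw [← dist_eq_norm] at h2
      rw [h1]
      refine le_trans ?_ h2
      rw [PiLp.sub_apply, abs_of_nonpos (by linarith), abs_of_nonpos (by linarith)]
      linarith
    have hbb : b ∈ cover ⁻¹' below (l : EReal) := (le_refl (l : EReal) :)
    have hba : cover b ∈ above (l : EReal) := (le_refl (l : EReal) :)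
    have := (weightedNorm_zero_bounds hE hp hbb (hbd.trans_lt hd)).2
    rw [hz b hba, sub_zero] at this
    refine this.trans ?_
    have hw := planeWeight_pos ρ p
    have := hα.le
    gcongr
  refine ⟨fun p => ?_, fun p q hd => ?_⟩
  · have hw := planeWeight_pos ρ p
    rcases hab p with hp | hp
    · refine (weightedNorm_zero_bounds hE hp hp (by simp)).1.trans ?_
      gcongr
    · rw [hz p hp, abs_zero]; positivity
  · have hw := planeWeight_pos ρ p
    rcases hab p with hp | hp <;> rcases hab q with hq | hq
    · refine (weightedNorm_zero_bounds hE hp hq hd).2.trans ?_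
      gcongr
    · rw [hz q hq, sub_zero]
      refine (hcross p q hp hq hd).trans ?_
      gcongr
    · rw [hz p hp, zero_sub, abs_neg]
      refine (hcross q p hq hp (by rwa [dist_comm])).trans ?_
      rw [dist_comm q p]
      calc N * planeWeight ρ q * dist p q ^ α
          ≤ N * (exp 1 * planeWeight ρ p) * dist p q ^ α := by
            gcongr
            exact planeWeight_le hρ hd.le
        _ = _ := by ring
    · rw [hz p hp, hz q hq, sub_self, abs_zero]; positivity

/-! ### Superpositions of translates -/

section Superpose

variable {X : Type} [MeasurableSpace X]

/-- A superposition of translates of a function of the plane. -/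
def superpose {F : Type} [NormedAddCommGroup F] [NormedSpace ℝ F] (μ : Measure X) (k : X → ℝ)
    (z : X → Plane) (f : Plane → F) (p : Plane) : F :=
  ∫ a, k a • f (p - z a) ∂μ

/-- A superposition of translates of a function of the cylinder. -/
def cylSuperpose (μ : Measure X) (k : X → ℝ) (z : X → Plane) (f : Cylinder → ℝ) (q : Cylinder) :
    ℝ :=
  ∫ a, k a * f (q - cover (z a)) ∂μ

theorem cover_sub (p q : Plane) : cover (p - q) = cover p - cover q := by
  simp [cover]

theorem lift_cylSuperpose (μ : Measure X) (k : X → ℝ) (z : X → Plane) (f : Cylinder → ℝ) :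
    lift (cylSuperpose μ k z f) = superpose μ k z (lift f) := by
  funext p
  simp only [lift, cylSuperpose, superpose, cover_sub, smul_eq_mul]

/-- The kernel of a superposition which acts on the functions of growth `cosh^ρ(s)`. -/
structure AdmissibleKernel (ρ : ℝ) (μ : Measure X) (k : X → ℝ) (z : X → Plane) : Prop where
  measurable_kernel : Measurable k
  measurable_shift : Measurable z
  integrable : Integrable (fun a => k a * exp (|ρ| * |z a 1|)) μ

variable {ρ : ℝ} {μ : Measure X} {k : X → ℝ} {z : X → Plane}

/-- The norm of a superposition on the functions of growth `cosh^ρ(s)`. -/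
def kernelMass (ρ : ℝ) (μ : Measure X) (k : X → ℝ) (z : X → Plane) : ℝ :=
  ∫ a, |k a| * exp (|ρ| * |z a 1|) ∂μ

theorem kernelMass_nonneg : 0 ≤ kernelMass ρ μ k z :=
  integral_nonneg fun _ => by positivity

variable {F : Type} [NormedAddCommGroup F] [NormedSpace ℝ F]

theorem planeWeight_sub_le (ρ : ℝ) (p y : Plane) :
    planeWeight ρ (p - y) ≤ exp (|ρ| * |y 1|) * planeWeight ρ p := by
  have := cosh_rpow_le ρ (p 1) ((p - y) 1)
  rwa [PiLp.sub_apply, sub_sub_cancel_left, abs_neg] at this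

theorem AdmissibleKernel.integrable_abs (hk : AdmissibleKernel ρ μ k z) :
    Integrable (fun a => |k a| * exp (|ρ| * |z a 1|)) μ := by
  refine hk.integrable.abs.congr (Eventually.of_forall fun a => ?_)
  simp [abs_mul]

theorem norm_kernel_smul_le {Y : Type} {k : Y → ℝ} {z : Y → Plane} {f : Plane → F} {N : ℝ} (hf : ∀ p, ‖f p‖ ≤ N * planeWeight ρ p)
    (p : Plane) (a : Y) :
    ‖k a • f (p - z a)‖ ≤ |k a| * exp (|ρ| * |z a 1|) * (N * planeWeight ρ p) := by
  have hN : 0 ≤ N := nonneg_of_mul_nonneg_left ((norm_nonneg _).trans (hf 0)) (planeWeight_pos ρ 0)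
  rw [norm_smul, Real.norm_eq_abs, mul_assoc]
  refine mul_le_mul_of_nonneg_left ((hf _).trans ?_) (abs_nonneg _)
  calc _ ≤ N * (exp (|ρ| * |z a 1|) * planeWeight ρ p) := by
        gcongr
        exact planeWeight_sub_le ρ p (z a)
    _ = _ := by ring

theorem AdmissibleKernel.aestronglyMeasurable (hk : AdmissibleKernel ρ μ k z) {f : Plane → F}
    (hc : Continuous f) (p : Plane) : AEStronglyMeasurable (fun a => k a • f (p - z a)) μ := by
  have h1 := hk.measurable_kernel
  have h2 := hk.measurable_shift
  exact h1.aestronglyMeasurable.smul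
    (hc.stronglyMeasurable.comp_measurable (h2.const_sub p)).aestronglyMeasurable

theorem AdmissibleKernel.integrable_smul (hk : AdmissibleKernel ρ μ k z) {f : Plane → F}
    (hc : Continuous f) {N : ℝ} (hf : ∀ p, ‖f p‖ ≤ N * planeWeight ρ p) (p : Plane) :
    Integrable (fun a => k a • f (p - z a)) μ :=
  (hk.integrable_abs.mul_const (N * planeWeight ρ p)).mono' (hk.aestronglyMeasurable hc p)
    (Eventually.of_forall fun a => norm_kernel_smul_le hf p a)

theorem AdmissibleKernel.norm_superpose_le (hk : AdmissibleKernel ρ μ k z) {f : Plane → F}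
    {N : ℝ} (hf : ∀ p, ‖f p‖ ≤ N * planeWeight ρ p) (p : Plane) :
    ‖superpose μ k z f p‖ ≤ kernelMass ρ μ k z * N * planeWeight ρ p := by
  rw [mul_assoc, kernelMass, ← integral_mul_const]
  exact norm_integral_le_of_norm_le (hk.integrable_abs.mul_const _)
    (Eventually.of_forall fun a => norm_kernel_smul_le hf p a)

/-- Differentiation under the integral, with the derivative on `f`. The kernel may thus be as
singular as its weighted integrability allows. -/
theorem AdmissibleKernel.hasFDerivAt_superpose (hρ : |ρ| ≤ 1) (hk : AdmissibleKernel ρ μ k z)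
    {f : Plane → F} (hc : ContDiff ℝ ∞ f) {N N' : ℝ} (hf : ∀ p, ‖f p‖ ≤ N * planeWeight ρ p)
    (hf' : ∀ p, ‖fderiv ℝ f p‖ ≤ N' * planeWeight ρ p) (p : Plane) :
    HasFDerivAt (superpose μ k z f) (superpose μ k z (fderiv ℝ f) p) p := by
  have hc' := (contDiff_fderiv_of_infty hc).continuous
  have hN : 0 ≤ N' :=
    nonneg_of_mul_nonneg_left ((norm_nonneg _).trans (hf' 0)) (planeWeight_pos ρ 0)
  refine hasFDerivAt_integral_of_dominated_of_fderiv_le (μ := μ)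
    (F := fun p a => k a • f (p - z a)) (F' := fun p a => k a • fderiv ℝ f (p - z a))
    (bound := fun a => |k a| * exp (|ρ| * |z a 1|) * (N' * (exp 1 * planeWeight ρ p)))
    (Metric.ball_mem_nhds p one_pos)
    (Eventually.of_forall fun q => hk.aestronglyMeasurable hc.continuous q)
    (hk.integrable_smul hc.continuous hf p) (hk.aestronglyMeasurable hc' p) ?_
    (hk.integrable_abs.mul_const _) ?_
  · refine Eventually.of_forall fun a q hq => (norm_kernel_smul_le hf' q a).trans ?_
    gcongr
    exact planeWeight_le hρ (le_of_lt (by rwa [dist_comm]))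
  · refine Eventually.of_forall fun a q _ => ?_
    have h1 : HasFDerivAt (fun q => q - z a) (ContinuousLinearMap.id ℝ Plane) q :=
      (hasFDerivAt_id q).sub_const _
    have h2 := ((hc.differentiable (by simp)) (q - z a)).hasFDerivAt.comp q h1
    exact h2.const_smul (k a)

/-- All the derivatives of `f` have growth `cosh^ρ(s)`. -/
def SmoothGrowth (ρ : ℝ) (f : Plane → F) : Prop :=
  ContDiff ℝ ∞ f ∧ ∀ j, ∃ N, ∀ p, ‖iteratedFDeriv ℝ j f p‖ ≤ N * planeWeight ρ p

theorem SmoothGrowth.exists_norm_le {f : Plane → F} (hf : SmoothGrowth ρ f) :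
    ∃ N, ∀ p, ‖f p‖ ≤ N * planeWeight ρ p := by
  simpa only [norm_iteratedFDeriv_zero] using hf.2 0

theorem SmoothGrowth.fderiv {f : Plane → F} (hf : SmoothGrowth ρ f) :
    SmoothGrowth ρ (fderiv ℝ f) :=
  ⟨contDiff_fderiv_of_infty hf.1, fun j => by
    simpa only [norm_iteratedFDeriv_fderiv] using hf.2 (j + 1)⟩

theorem AdmissibleKernel.fderiv_superpose (hρ : |ρ| ≤ 1) (hk : AdmissibleKernel ρ μ k z)
    {f : Plane → F} (hf : SmoothGrowth ρ f) :
    _root_.fderiv ℝ (superpose μ k z f) = superpose μ k z (_root_.fderiv ℝ f) := by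
  obtain ⟨N, hN⟩ := hf.exists_norm_le
  obtain ⟨N', hN'⟩ := hf.fderiv.exists_norm_le
  exact funext fun p => (hk.hasFDerivAt_superpose hρ hf.1 hN hN' p).fderiv

theorem AdmissibleKernel.differentiable_superpose (hρ : |ρ| ≤ 1) (hk : AdmissibleKernel ρ μ k z)
    {f : Plane → F} (hf : SmoothGrowth ρ f) : Differentiable ℝ (superpose μ k z f) := by
  obtain ⟨N, hN⟩ := hf.exists_norm_le
  obtain ⟨N', hN'⟩ := hf.fderiv.exists_norm_le
  exact fun p => (hk.hasFDerivAt_superpose hρ hf.1 hN hN' p).differentiableAt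

end Superpose

section

variable {X : Type} [MeasurableSpace X] {ρ : ℝ} {μ : Measure X} {k : X → ℝ} {z : X → Plane}

theorem AdmissibleKernel.contDiff_superpose (hρ : |ρ| ≤ 1) (hk : AdmissibleKernel ρ μ k z)
    {F : Type} [NormedAddCommGroup F] [NormedSpace ℝ F] {f : Plane → F} (hf : SmoothGrowth ρ f) :
    ContDiff ℝ ∞ (superpose μ k z f) := by
  have h : ∀ n : ℕ, ∀ {F : Type} [NormedAddCommGroup F] [NormedSpace ℝ F] {f : Plane → F},
      SmoothGrowth ρ f → ContDiff ℝ n (superpose μ k z f) := by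
    intro n
    induction n with
    | zero =>
      intro F _ _ f hf
      exact contDiff_zero.2 (hk.differentiable_superpose hρ hf).continuous
    | succ n ih =>
      intro F _ _ f hf
      rw [Nat.cast_succ, contDiff_succ_iff_fderiv]
      refine ⟨hk.differentiable_superpose hρ hf, fun h => by simp at h, ?_⟩
      rw [hk.fderiv_superpose hρ hf]
      exact ih hf.fderiv
  exact contDiff_infty.2 fun n => h n hf

theorem AdmissibleKernel.norm_iteratedFDeriv_superpose_le (hρ : |ρ| ≤ 1)
    (hk : AdmissibleKernel ρ μ k z) (j : ℕ) :
    ∀ {F : Type} [NormedAddCommGroup F] [NormedSpace ℝ F] {f : Plane → F}, SmoothGrowth ρ f →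
      ∀ N, (∀ p, ‖iteratedFDeriv ℝ j f p‖ ≤ N * planeWeight ρ p) →
      ∀ p, ‖iteratedFDeriv ℝ j (superpose μ k z f) p‖ ≤ kernelMass ρ μ k z * N * planeWeight ρ p := by
  induction j with
  | zero =>
    intro F _ _ f hf N hN p
    simp only [norm_iteratedFDeriv_zero] at hN ⊢
    exact hk.norm_superpose_le hN p
  | succ j ih =>
    intro F _ _ f hf N hN p
    simp only [← norm_iteratedFDeriv_fderiv] at hN ⊢
    rw [hk.fderiv_superpose hρ hf]
    exact ih hf.fderiv N hN p

theorem AdmissibleKernel.smoothGrowth_superpose (hρ : |ρ| ≤ 1) (hk : AdmissibleKernel ρ μ k z)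
    {F : Type} [NormedAddCommGroup F] [NormedSpace ℝ F] {f : Plane → F} (hf : SmoothGrowth ρ f) :
    SmoothGrowth ρ (superpose μ k z f) :=
  ⟨hk.contDiff_superpose hρ hf, fun j => by
    obtain ⟨N, hN⟩ := hf.2 j
    exact ⟨_, hk.norm_iteratedFDeriv_superpose_le hρ j hf N hN⟩⟩

theorem AdmissibleKernel.iteratedFDeriv_two_superpose (hρ : |ρ| ≤ 1)
    (hk : AdmissibleKernel ρ μ k z) {f : Plane → ℝ} (hf : SmoothGrowth ρ f) (p v w : Plane) :
    iteratedFDeriv ℝ 2 (superpose μ k z f) p ![v, w]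
      = superpose μ k z (fun q => iteratedFDeriv ℝ 2 f q ![v, w]) p := by
  obtain ⟨N, hN⟩ := hf.fderiv.fderiv.exists_norm_le
  have hi := hk.integrable_smul hf.fderiv.fderiv.1.continuous hN p
  simp only [iteratedFDeriv_two_apply, Matrix.cons_val_zero, Matrix.cons_val_one]
  rw [hk.fderiv_superpose hρ hf, hk.fderiv_superpose hρ hf.fderiv, superpose,
    ContinuousLinearMap.integral_apply hi,
    ContinuousLinearMap.integral_apply (hi.apply_continuousLinearMap v)]
  rfl

theorem AdmissibleKernel.laplacian_superpose (hρ : |ρ| ≤ 1)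
    (hk : AdmissibleKernel ρ μ k z) {f : Plane → ℝ} (hf : SmoothGrowth ρ f) (p : Plane) :
    Laplacian.laplacian (superpose μ k z f) p = superpose μ k z (Laplacian.laplacian f) p := by
  obtain ⟨N, hN⟩ := hf.fderiv.fderiv.exists_norm_le
  have hi := hk.integrable_smul hf.fderiv.fderiv.1.continuous hN p
  rw [InnerProductSpace.laplacian_eq_iteratedFDeriv_orthonormalBasis _
    (EuclideanSpace.basisFun (Fin 2) ℝ), InnerProductSpace.laplacian_eq_iteratedFDeriv_orthonormalBasis _
    (EuclideanSpace.basisFun (Fin 2) ℝ)]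
  simp only [hk.iteratedFDeriv_two_superpose hρ hf, Fin.sum_univ_two, superpose, smul_eq_mul,
    mul_add]
  simp only [iteratedFDeriv_two_apply, Matrix.cons_val_zero, Matrix.cons_val_one]
  rw [integral_add]
  · exact (hi.apply_continuousLinearMap _).apply_continuousLinearMap _
  · exact (hi.apply_continuousLinearMap _).apply_continuousLinearMap _

/-- Superpositions of translates preserve the vanishing of the averages along meridians. -/
theorem AdmissibleKernel.zeroMeridianAverage [SFinite μ] (hk : AdmissibleKernel ρ μ k z)
    {f : Cylinder → ℝ} (hc : Continuous (lift f)) {N : ℝ}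
    (hf : ∀ p, |lift f p| ≤ N * planeWeight ρ p) (h : ZeroMeridianAverage f) :
    ZeroMeridianAverage (cylSuperpose μ k z f) := by
  intro s
  have hpi : -π ≤ π := by linarith [Real.pi_pos]
  have e : ∀ θ : ℝ, cylSuperpose μ k z f ((θ : AddCircle (2 * π)), s)
      = ∫ a, k a * lift f (!₂[θ, s] - z a) ∂μ := by
    intro θ
    have := congrFun (lift_cylSuperpose μ k z f) !₂[θ, s]
    simpa [lift, cover, superpose] using this
  simp only [e]
  rw [intervalIntegral_integral_swap]
  · have h0 : ∀ a, ∫ θ in (-π)..π, k a * lift f (!₂[θ, s] - z a) = 0 := by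
      intro a
      rw [intervalIntegral.integral_const_mul]
      have hper : Function.Periodic
          (fun θ : ℝ => f ((θ : AddCircle (2 * π)), s - z a 1)) (2 * π) := by
        intro θ
        simp
      have h1 : ∀ θ : ℝ, lift f (!₂[θ, s] - z a)
          = (fun θ : ℝ => f ((θ : AddCircle (2 * π)), s - z a 1)) (θ - z a 0) := by
        intro θ
        simp [lift, cover]
      simp only [h1]
      rw [intervalIntegral.integral_comp_sub_right
        (fun θ : ℝ => f ((θ : AddCircle (2 * π)), s - z a 1)) (z a 0)]
      have h2 := hper.intervalIntegral_add_eq (-π - z a 0) (-π)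
      rw [show -π - z a 0 + 2 * π = π - z a 0 by ring, show -π + 2 * π = π by ring] at h2
      rw [h2, h, mul_zero]
    simp [h0]
  · have hfin : IsFiniteMeasure (volume.restrict (uIoc (-π) π)) := by
      rw [uIoc_of_le hpi]
      infer_instance
    have hm : AEStronglyMeasurable (Function.uncurry fun (θ : ℝ) (a : X) =>
        k a * lift f (!₂[θ, s] - z a)) ((volume.restrict (uIoc (-π) π)).prod μ) := by
      have h1 := hk.measurable_kernel
      have h2 := hk.measurable_shift
      have h3 : Measurable fun x : ℝ × X => (!₂[x.1, s] - z x.2 : Plane) := by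
        refine Measurable.sub ?_ (h2.comp measurable_snd)
        exact (by fun_prop : Continuous fun θ : ℝ => (!₂[θ, s] : Plane)).measurable.comp
          measurable_fst
      exact ((h1.comp measurable_snd).mul (hc.measurable.comp h3)).aestronglyMeasurable
    have hg : Integrable (fun x : ℝ × X => (N * cosh s ^ ρ) * (|k x.2| * exp (|ρ| * |z x.2 1|)))
        ((volume.restrict (uIoc (-π) π)).prod μ) :=
      Integrable.mul_prod (f := fun _ : ℝ => N * cosh s ^ ρ) (integrable_const _) hk.integrable_abs
    refine hg.mono' hm (Eventually.of_forall fun x => ?_)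
    have := norm_kernel_smul_le (F := ℝ) (k := k) (z := z) (fun p => hf p) !₂[x.1, s] x.2
    refine this.trans (le_of_eq ?_)
    simp only [planeWeight]
    simp
    ring

end

theorem cylSuperpose_add {X : Type} [MeasurableSpace X] {ρ : ℝ} {μ : Measure X} {k : X → ℝ}
    {z : X → Plane} (hk : AdmissibleKernel ρ μ k z) {f g : Cylinder → ℝ}
    (hfc : Continuous (lift f)) (hgc : Continuous (lift g)) {N N' : ℝ}
    (hf : ∀ p, |lift f p| ≤ N * planeWeight ρ p) (hg : ∀ p, |lift g p| ≤ N' * planeWeight ρ p) :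
    cylSuperpose μ k z (f + g) = cylSuperpose μ k z f + cylSuperpose μ k z g := by
  funext q
  obtain ⟨p, rfl⟩ : ∃ p, cover p = q := by
    obtain ⟨⟨θ⟩, s⟩ := q
    exact ⟨!₂[θ, s], by simp [cover]; rfl⟩
  have h1 := hk.integrable_smul hfc hf p
  have h2 := hk.integrable_smul hgc hg p
  simp only [lift, smul_eq_mul, cover_sub] at h1 h2
  simp only [cylSuperpose, Pi.add_apply, mul_add]
  exact integral_add h1 h2

theorem cylSuperpose_smul {X : Type} [MeasurableSpace X] (μ : Measure X) (k : X → ℝ)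
    (z : X → Plane) (c : ℝ) (f : Cylinder → ℝ) :
    cylSuperpose μ k z (c • f) = c • cylSuperpose μ k z f := by
  funext q
  simp only [cylSuperpose, Pi.smul_apply, smul_eq_mul, ← integral_const_mul]
  congr 1
  funext a
  ring

/-! ### Countable superpositions -/

theorem integrable_count_prod {Y : Type} [MeasurableSpace Y] {ν : Measure Y} [SFinite ν]
    {F : ℕ × Y → ℝ} (hm : ∀ n, Measurable fun y => F (n, y))
    (hi : ∀ n, Integrable (fun y => F (n, y)) ν) (hs : Summable fun n => ∫ y, |F (n, y)| ∂ν) :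
    Integrable F ((Measure.count : Measure ℕ).prod ν) := by
  rw [integrable_prod_iff (measurable_from_prod_countable_right hm).aestronglyMeasurable]
  refine ⟨Eventually.of_forall hi, ?_⟩
  rw [integrable_count_iff]
  refine hs.congr fun n => ?_
  rw [Real.norm_of_nonneg (integral_nonneg fun _ => norm_nonneg _)]
  rfl

theorem hasSum_integral_count {G : ℕ → ℝ} (h : Integrable G Measure.count) :
    HasSum G (∫ n, G n ∂Measure.count) := by
  have h1 : Summable G := Summable.of_norm (integrable_count_iff.1 h)
  rw [integral_countable h]
  simpa only [Measure.real, Measure.count_singleton, ENNReal.toReal_one, one_smul] using h1.hasSum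

theorem hasSum_integral_count_prod {Y : Type} [MeasurableSpace Y] {ν : Measure Y} [SFinite ν]
    {F : ℕ × Y → ℝ} (hi : Integrable F ((Measure.count : Measure ℕ).prod ν)) :
    HasSum (fun n => ∫ y, F (n, y) ∂ν) (∫ x, F x ∂((Measure.count : Measure ℕ).prod ν)) := by
  have h : Integrable (fun n => ∫ y, F (n, y) ∂ν) (Measure.count : Measure ℕ) :=
    hi.integral_prod_left
  rw [integral_prod F hi]
  exact hasSum_integral_count h

/-! ### The local operators as superpositions -/

theorem admissibleKernel_scaledAverage (ρ : ℝ) {φ : Plane → ℝ} (hφ : Continuous φ)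
    (hs : Function.support φ ⊆ Metric.closedBall 0 1) : AdmissibleKernel ρ volume φ id := by
  refine ⟨hφ.measurable, measurable_id, ?_⟩
  refine Continuous.integrable_of_hasCompactSupport (by simp only [id]; fun_prop)
    (HasCompactSupport.intro (isCompact_closedBall 0 1) fun y hy => ?_)
  have : φ y = 0 := by
    by_contra h
    exact hy (hs h)
  simp [this]

theorem scaledAverage_eq_superpose (φ : Plane → ℝ) (f : Plane → ℝ) :
    scaledAverage φ 1 f = superpose volume φ id f := by
  funext p
  simp only [scaledAverage, superpose, one_smul, smul_eq_mul, id, mul_comm]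

/-- The kernel of the dyadic potential, as a kernel on `ℕ × Plane`. -/
def dyadicKernel (Ψ : Plane → ℝ) (a : ℕ × Plane) : ℝ := (1 / 4) ^ a.1 * Ψ a.2

/-- The shifts of the dyadic potential. -/
def dyadicShift (a : ℕ × Plane) : Plane := ((1 / 2 : ℝ) ^ a.1) • a.2

theorem admissibleKernel_dyadic (ρ : ℝ) {Ψ : Plane → ℝ} (hΨ : Continuous Ψ)
    (hs : Function.support Ψ ⊆ Metric.closedBall 0 1) :
    AdmissibleKernel ρ ((Measure.count : Measure ℕ).prod volume) (dyadicKernel Ψ) dyadicShift := by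
  have hi : ∀ n : ℕ, Integrable fun y : Plane =>
      dyadicKernel Ψ (n, y) * exp (|ρ| * |dyadicShift (n, y) 1|) := by
    intro n
    refine Continuous.integrable_of_hasCompactSupport
      (by simp only [dyadicKernel, dyadicShift, PiLp.smul_apply]; fun_prop)
      (HasCompactSupport.intro (isCompact_closedBall 0 1) fun y hy => ?_)
    have : Ψ y = 0 := by
      by_contra h
      exact hy (hs h)
    simp [dyadicKernel, this]
  have hΨi : Integrable Ψ := hΨ.integrable_of_hasCompactSupport
    (HasCompactSupport.intro (isCompact_closedBall 0 1) fun y hy => by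
      by_contra h
      exact hy (hs h))
  refine ⟨measurable_from_prod_countable_right fun n => ?_,
    measurable_from_prod_countable_right fun n => ?_,
    integrable_count_prod (fun n => ?_) hi ?_⟩
  · simp only [dyadicKernel]; fun_prop
  · simp only [dyadicShift]; fun_prop
  · simp only [dyadicKernel, dyadicShift, PiLp.smul_apply]; fun_prop
  · refine Summable.of_nonneg_of_le (fun n => integral_nonneg fun _ => abs_nonneg _) (fun n => ?_)
      ((summable_geometric_of_lt_one (r := (1 / 4 : ℝ)) (by norm_num) (by norm_num)).mul_right
        (∫ y, |Ψ y| * exp |ρ|))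
    rw [← integral_const_mul]
    refine integral_mono (hi n).abs ((hΨi.abs.mul_const _).const_mul _) fun y => ?_
    simp only [dyadicKernel, abs_mul, Real.abs_exp, abs_of_pos (show (0 : ℝ) < (1 / 4) ^ n by
      positivity), mul_assoc]
    by_cases hy : Ψ y = 0
    · simp [hy]
    have h1 : |dyadicShift (n, y) 1| ≤ 1 := by
      have a := abs_coord_le_norm y 1
      have b := mem_closedBall_zero_iff.1 (hs hy)
      have c : ((1 : ℝ) / 2) ^ n ≤ 1 := pow_le_one₀ (by norm_num) (by norm_num)
      simp only [dyadicShift, PiLp.smul_apply, smul_eq_mul, abs_mul]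
      rw [abs_of_pos (by positivity)]
      exact mul_le_one₀ c (abs_nonneg _) (a.trans b)
    gcongr
    nlinarith [abs_nonneg ρ]

/-- This form makes the potential descend to the cylinder and gives its linearity and the
preservation of zero averages. -/
theorem dyadicPotential_eq_superpose {ρ : ℝ} {Ψ : Plane → ℝ} (hΨ : Continuous Ψ)
    (hs : Function.support Ψ ⊆ Metric.closedBall 0 1) {f : Plane → ℝ} (hc : Continuous f) {N : ℝ}
    (hf : ∀ p, |f p| ≤ N * planeWeight ρ p) :
    dyadicPotential Ψ f
      = superpose ((Measure.count : Measure ℕ).prod volume) (dyadicKernel Ψ) dyadicShift f := by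
  funext p
  have h := hasSum_integral_count_prod
    ((admissibleKernel_dyadic ρ hΨ hs).integrable_smul hc hf p)
  rw [dyadicPotential, superpose, ← h.tsum_eq]
  refine tsum_congr fun n => ?_
  simp only [scaledAverage, dyadicKernel, dyadicShift, smul_eq_mul, ← integral_const_mul]
  congr 1
  funext y
  ring

theorem smoothGrowth_scaledAverage {ρ : ℝ} (hρ : |ρ| ≤ 1) {φ : Plane → ℝ} (hφ : ContDiff ℝ ∞ φ)
    (hs : Function.support φ ⊆ Metric.closedBall 0 1) (j : ℕ) :
    ∃ C, 0 ≤ C ∧ ∀ (f : Plane → ℝ) (N : ℝ), Continuous f → (∀ p, |f p| ≤ N * planeWeight ρ p) →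
      ∀ p, ‖iteratedFDeriv ℝ j (scaledAverage φ 1 f) p‖ ≤ C * N * planeWeight ρ p := by
  obtain ⟨C, hC, h⟩ := exists_norm_iteratedFDeriv_scaledAverage_le j hφ hs
  refine ⟨C * exp 1, by positivity, fun f N hc hf p => ?_⟩
  have hN : 0 ≤ N := nonneg_of_mul_nonneg_left ((abs_nonneg _).trans (hf 0)) (planeWeight_pos ρ 0)
  refine (h f hc 1 one_pos p (N * (exp 1 * planeWeight ρ p)) fun y hy => (hf y).trans ?_).trans
    (le_of_eq (by rw [inv_one, one_pow]; ring))
  gcongr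
  exact planeWeight_le hρ (by rwa [dist_comm])

/-! ### A one-dimensional Green function -/

theorem hasDerivAt_exp_mul_sub (m : ℝ) {a a' a'' : ℝ → ℝ} (h1 : ∀ t, HasDerivAt a (a' t) t)
    (h2 : ∀ t, HasDerivAt a' (a'' t) t) (t : ℝ) :
    HasDerivAt (fun t => exp (m * t) * (a' t - m * a t)) (exp (m * t) * (a'' t - m ^ 2 * a t)) t := by
  have e : HasDerivAt (fun t => exp (m * t)) (exp (m * t) * m) t := by
    simpa using ((hasDerivAt_id t).const_mul m).exp
  exact (e.mul ((h2 t).sub ((h1 t).const_mul m))).congr_deriv (by simp only [Pi.sub_apply]; ring)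

/-- Up to the factor `-2m`, `e^{-m|t|}` is the Green function of `d²/dt² - m²`. On each half-line
the integrand has the primitive `e^{∓mt}(a' ± m a)`, which tends to `0` at infinity because `σ < m`.
The two values at `0` combine to `-2 m a(0)`. -/
theorem integral_exp_neg_mul_abs_mul {m σ B : ℝ} (hσm : σ < m) {a a' a'' : ℝ → ℝ}
    (h1 : ∀ t, HasDerivAt a (a' t) t) (h2 : ∀ t, HasDerivAt a' (a'' t) t)
    (hb0 : ∀ t, |a t| ≤ B * exp (σ * |t|)) (hb1 : ∀ t, |a' t| ≤ B * exp (σ * |t|))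
    (hi : Integrable fun t => exp (-m * |t|) * (a'' t - m ^ 2 * a t)) :
    ∫ t, exp (-m * |t|) * (a'' t - m ^ 2 * a t) = -2 * m * a 0 := by
  have hB : 0 ≤ B := nonneg_of_mul_nonneg_left ((abs_nonneg _).trans (hb0 0)) (Real.exp_pos _)
  have hbd : ∀ c : ℝ, ∀ t, |a' t - c * a t| ≤ B * (1 + |c|) * exp (σ * |t|) := fun c t => by
    calc |a' t - c * a t| ≤ |a' t| + |c * a t| := abs_sub _ _
      _ ≤ B * exp (σ * |t|) + |c| * (B * exp (σ * |t|)) := by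
          rw [abs_mul]
          gcongr
          · exact hb1 t
          · exact hb0 t
      _ = _ := by ring
  have hpos : ∫ t in Ioi (0 : ℝ), exp (-m * |t|) * (a'' t - m ^ 2 * a t) = -(a' 0 + m * a 0) := by
    have hd := hasDerivAt_exp_mul_sub (-m) h1 h2
    have hlim : Tendsto (fun t => exp (-m * t) * (a' t - -m * a t)) atTop (𝓝 0) := by
      have h3 : Tendsto (fun t => B * (1 + |m|) * exp (-((m - σ) * t))) atTop (𝓝 0) := by
        have : Tendsto (fun t : ℝ => (m - σ) * t) atTop atTop :=
          tendsto_id.const_mul_atTop (by linarith)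
        simpa using (Real.tendsto_exp_neg_atTop_nhds_zero.comp this).const_mul (B * (1 + |m|))
      refine squeeze_zero_norm' ?_ h3
      filter_upwards [eventually_ge_atTop 0] with t ht
      have := hbd (-m) t
      rw [abs_of_nonneg ht, abs_neg] at this
      rw [Real.norm_eq_abs, abs_mul, Real.abs_exp]
      calc _ ≤ exp (-m * t) * (B * (1 + |m|) * exp (σ * t)) := by gcongr
        _ = B * (1 + |m|) * (exp (-m * t) * exp (σ * t)) := by ring
        _ = _ := by rw [← Real.exp_add]; ring_nf
    have e : ∀ t ∈ Ioi (0 : ℝ), exp (-m * |t|) * (a'' t - m ^ 2 * a t)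
        = exp (-m * t) * (a'' t - (-m) ^ 2 * a t) := fun t ht => by
      rw [abs_of_pos ht, neg_sq]
    rw [setIntegral_congr_fun measurableSet_Ioi e,
      integral_Ioi_of_hasDerivAt_of_tendsto' (fun t _ => hd t)
        (hi.integrableOn.congr_fun e measurableSet_Ioi) hlim]
    simp
  have hneg : ∫ t in Iic (0 : ℝ), exp (-m * |t|) * (a'' t - m ^ 2 * a t) = a' 0 - m * a 0 := by
    have hd := hasDerivAt_exp_mul_sub m h1 h2
    have hlim : Tendsto (fun t => exp (m * t) * (a' t - m * a t)) atBot (𝓝 0) := by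
      have h3 : Tendsto (fun t => B * (1 + |m|) * exp ((m - σ) * t)) atBot (𝓝 0) := by
        have : Tendsto (fun t : ℝ => (m - σ) * t) atBot atBot :=
          tendsto_id.const_mul_atBot (by linarith)
        simpa using (Real.tendsto_exp_atBot.comp this).const_mul (B * (1 + |m|))
      refine squeeze_zero_norm' ?_ h3
      filter_upwards [eventually_le_atBot 0] with t ht
      have := hbd m t
      rw [abs_of_nonpos ht] at this
      rw [Real.norm_eq_abs, abs_mul, Real.abs_exp]
      calc _ ≤ exp (m * t) * (B * (1 + |m|) * exp (σ * -t)) := by gcongr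
        _ = B * (1 + |m|) * (exp (m * t) * exp (σ * -t)) := by ring
        _ = _ := by rw [← Real.exp_add]; ring_nf
    have e : ∀ t ∈ Iic (0 : ℝ), exp (-m * |t|) * (a'' t - m ^ 2 * a t)
        = exp (m * t) * (a'' t - m ^ 2 * a t) := fun t ht => by
      rw [abs_of_nonpos ht, neg_mul_neg]
    rw [setIntegral_congr_fun measurableSet_Iic e,
      integral_Iic_of_hasDerivAt_of_tendsto' (fun t _ => hd t)
        (hi.integrableOn.congr_fun e measurableSet_Iic) hlim]
    simp
  rw [← intervalIntegral.integral_Iic_add_Ioi hi.integrableOn hi.integrableOn, hpos, hneg]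
  ring

/-! ### Fourier inversion -/

theorem integral_cos_mul_deriv_two {g g' g'' : ℝ → ℝ} (h1 : ∀ t, HasDerivAt g (g' t) t)
    (h2 : ∀ t, HasDerivAt g' (g'' t) t) (hc : Continuous g'')
    (hp' : Function.Periodic g' (2 * π)) (n : ℕ) :
    ∫ y in 0..2 * π, cos (n * y) * g'' y = -(n : ℝ) ^ 2 * ∫ y in 0..2 * π, cos (n * y) * g y := by
  have hg : Continuous g := continuous_iff_continuousAt.2 fun t => (h1 t).continuousAt
  have hd : ∀ t, HasDerivAt (fun t => cos (n * t) * g' t + n * (sin (n * t) * g t))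
      (cos (n * t) * g'' t + n ^ 2 * (cos (n * t) * g t)) t := by
    intro t
    have a : HasDerivAt (fun t : ℝ => (n : ℝ) * t) n t := by
      simpa using (hasDerivAt_id t).const_mul (n : ℝ)
    exact ((a.cos.mul (h2 t)).add ((a.sin.mul (h1 t)).const_mul (n : ℝ))).congr_deriv (by ring)
  have h := intervalIntegral.integral_eq_sub_of_hasDerivAt (a := 0) (b := 2 * π) (fun t _ => hd t)
    (Continuous.intervalIntegrable (by fun_prop) _ _)
  rw [intervalIntegral.integral_add (Continuous.intervalIntegrable (by fun_prop) _ _)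
    (Continuous.intervalIntegrable (by fun_prop) _ _), intervalIntegral.integral_const_mul] at h
  have e1 : cos (n * (2 * π)) = 1 := Real.cos_nat_mul_two_pi n
  have e2 : sin (n * (2 * π)) = 0 := by
    have := Real.sin_nat_mul_pi (2 * n)
    push_cast at this
    rw [← this]
    ring_nf
  have e3 : g' (2 * π) = g' 0 := by simpa using hp' 0
  simp only [e1, e2, e3, mul_zero, Real.cos_zero, Real.sin_zero] at h
  linarith

theorem hasSum_cos_div_sq {y : ℝ} (hy : y ∈ Icc 0 (2 * π)) :
    HasSum (fun n : ℕ => cos ((n + 1 : ℕ) * y) / ((n + 1 : ℕ) : ℝ) ^ 2)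
      (π ^ 2 / 6 - π * y / 2 + y ^ 2 / 4) := by
  have hpi := Real.pi_pos
  have h := hasSum_one_div_nat_pow_mul_cos one_ne_zero (x := y / (2 * π))
    ⟨by have := hy.1; positivity, (div_le_one (by positivity)).2 hy.2⟩
  -- The term `n = 0` that is split off is zero, because `1 / 0 = 0`.
  have h' := (hasSum_nat_add_iff' 1).2 h
  have e : (Polynomial.map (algebraMap ℚ ℝ) (Polynomial.bernoulli (2 * 1))).eval (y / (2 * π))
      = (y / (2 * π)) ^ 2 - y / (2 * π) + 1 / 6 := by
    simp [Polynomial.bernoulli, Finset.sum_range_succ, bernoulli_one, bernoulli_two]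
    ring
  rw [e] at h'
  have hv : π ^ 2 / 6 - π * y / 2 + y ^ 2 / 4 = (-1) ^ (1 + 1) * (2 * π) ^ (2 * 1) / 2
      / ((2 * 1).factorial : ℝ) * ((y / (2 * π)) ^ 2 - y / (2 * π) + 1 / 6)
      - ∑ i ∈ Finset.range 1, 1 / (i : ℝ) ^ (2 * 1) * cos (2 * π * i * (y / (2 * π))) := by
    simp
    field_simp
    ring
  rw [hv]
  refine h'.congr_fun fun n => ?_
  · rw [show 2 * π * ((n + 1 : ℕ) : ℝ) * (y / (2 * π)) = ((n + 1 : ℕ) : ℝ) * y by field_simp]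
    ring

/-- Fourier inversion at `0` for a `C²` function. Two integrations by parts give each coefficient a
factor `1/m²`, so the sum passes under the integral and becomes the quadratic polynomial of
`hasSum_cos_div_sq`. Integrating by parts back leaves a boundary term. -/
theorem hasSum_integral_cos_mul {g g' g'' : ℝ → ℝ} (h1 : ∀ t, HasDerivAt g (g' t) t)
    (h2 : ∀ t, HasDerivAt g' (g'' t) t) (hc : Continuous g'') (hp : Function.Periodic g (2 * π))
    (hp' : Function.Periodic g' (2 * π)) (h0 : ∫ y in 0..2 * π, g y = 0) :
    HasSum (fun n : ℕ => ∫ y in 0..2 * π, cos ((n + 1 : ℕ) * y) * g y) (π * g 0) := by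
  have hpi := Real.pi_pos
  have hg : Continuous g := continuous_iff_continuousAt.2 fun t => (h1 t).continuousAt
  set F : ℕ → ℝ → ℝ := fun n y => -(cos ((n + 1 : ℕ) * y) / ((n + 1 : ℕ) : ℝ) ^ 2 * g'' y) with hF
  obtain ⟨B, hB⟩ := (isCompact_Icc (a := (0 : ℝ)) (b := 2 * π)).exists_bound_of_continuousOn
    hc.continuousOn
  have hsq : Summable fun n : ℕ => 1 / ((n + 1 : ℕ) : ℝ) ^ 2 :=
    (summable_nat_add_iff 1).2 (Real.summable_one_div_nat_pow.2 one_lt_two)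
  have hs : HasSum (fun n => ∫ y in 0..2 * π, F n y)
      (∫ y in 0..2 * π, -((π ^ 2 / 6 - π * y / 2 + y ^ 2 / 4) * g'' y)) := by
    refine intervalIntegral.hasSum_integral_of_dominated_convergence
      (fun n _ => 1 / ((n + 1 : ℕ) : ℝ) ^ 2 * B) (fun n => ?_) (fun n => ?_) ?_ ?_ ?_
    · exact (Continuous.aestronglyMeasurable (by fun_prop))
    · refine Eventually.of_forall fun y hy => ?_
      rw [uIoc_of_le (by positivity)] at hy
      rw [norm_neg, norm_mul, norm_div, Real.norm_eq_abs, Real.norm_of_nonneg (by positivity)]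
      have a := hB y ⟨hy.1.le, hy.2⟩
      have b := Real.abs_cos_le_one ((n + 1 : ℕ) * y)
      gcongr
    · exact Eventually.of_forall fun y _ => hsq.mul_right B
    · simp
    · refine Eventually.of_forall fun y hy => ?_
      rw [uIoc_of_le (by positivity)] at hy
      exact ((hasSum_cos_div_sq ⟨hy.1.le, hy.2⟩).mul_right _).neg
  have e1 : ∀ n : ℕ, ∫ y in 0..2 * π, F n y = ∫ y in 0..2 * π, cos ((n + 1 : ℕ) * y) * g y := by
    intro n
    have a := integral_cos_mul_deriv_two h1 h2 hc hp' (n + 1)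
    have b : ∀ y, F n y = -(1 / ((n + 1 : ℕ) : ℝ) ^ 2) * (cos ((n + 1 : ℕ) * y) * g'' y) := by
      intro y
      simp only [hF]
      ring
    simp only [b]
    rw [intervalIntegral.integral_const_mul, a]
    have : ((n + 1 : ℕ) : ℝ) ≠ 0 := by positivity
    field_simp
  have e2 : ∫ y in 0..2 * π, -((π ^ 2 / 6 - π * y / 2 + y ^ 2 / 4) * g'' y) = π * g 0 := by
    -- The polynomial has equal values at `0` and `2π`, so the term in `g'` cancels. Its derivative
    -- jumps by `π`, which produces `π g(0)`; its second derivative `1/2` multiplies the mean of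
    -- `g`, which is zero.
    have hd : ∀ y, HasDerivAt (fun y => -((π ^ 2 / 6 - π * y / 2 + y ^ 2 / 4) * g' y)
        + (-π / 2 + y / 2) * g y)
        (-((π ^ 2 / 6 - π * y / 2 + y ^ 2 / 4) * g'' y) + 1 / 2 * g y) y := by
      intro y
      have a : HasDerivAt (fun y => π ^ 2 / 6 - π * y / 2 + y ^ 2 / 4) (-π / 2 + y / 2) y := by
        have := (((hasDerivAt_id y).const_mul π).div_const 2).const_sub (π ^ 2 / 6)
        have := this.add (((hasDerivAt_id y).pow 2).div_const 4)
        refine HasDerivAt.congr_deriv this ?_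
        simp
        ring
      have b : HasDerivAt (fun y => -π / 2 + y / 2) (1 / 2) y :=
        ((hasDerivAt_id y).div_const 2).const_add (-π / 2)
      exact ((a.mul (h2 y)).neg.add (b.mul (h1 y))).congr_deriv (by ring)
    have h := intervalIntegral.integral_eq_sub_of_hasDerivAt (a := 0) (b := 2 * π)
      (fun t _ => hd t) (Continuous.intervalIntegrable (by fun_prop) _ _)
    rw [intervalIntegral.integral_add (Continuous.intervalIntegrable (by fun_prop) _ _)
      (Continuous.intervalIntegrable (by fun_prop) _ _), intervalIntegral.integral_const_mul, h0,
      mul_zero, add_zero] at h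
    rw [h]
    have e3 : g' (2 * π) = g' 0 := by simpa using hp' 0
    have e4 : g (2 * π) = g 0 := by simpa using hp 0
    rw [e3, e4]
    ring
  rw [← e2]
  simpa only [e1] using hs

/-! ### The Green operator on functions with zero average -/

theorem integrable_exp_neg_mul_abs {b : ℝ} (hb : 0 < b) : Integrable fun t : ℝ => exp (-b * |t|) := by
  have h := exp_neg_integrableOn_Ioi 0 hb
  have h1 : IntegrableOn (fun t : ℝ => exp (-b * |t|)) (Ioi 0) :=
    h.congr_fun (fun t ht => by simp only; rw [abs_of_pos ht]) measurableSet_Ioi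
  have h2 : IntegrableOn (fun t : ℝ => exp (-b * |t|)) (Iic 0) := by
    have := (integrableOn_exp_mul_Iic hb 0)
    exact this.congr_fun (fun t ht => by simp only; rw [abs_of_nonpos ht, neg_mul_neg])
      measurableSet_Iic
  have := h2.union h1
  rwa [Iic_union_Ioi, integrableOn_univ] at this

theorem integral_exp_neg_mul_abs {b : ℝ} (hb : 0 < b) : ∫ t : ℝ, exp (-b * |t|) = 2 / b := by
  rw [integral_comp_abs (f := fun t => exp (-b * t)), integral_exp_mul_Ioi (by linarith) 0]
  simp
  ring

/-- The measure of the Fourier representation of the Green function: a Fourier mode and a point of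
a fundamental domain of the cylinder. -/
def greenMeasure : Measure (ℕ × (ℝ × ℝ)) :=
  Measure.count.prod ((volume.restrict (Ioc 0 (2 * π))).prod volume)

/-- The Fourier modes of the Green function of the cylinder. -/
def greenKernel (a : ℕ × (ℝ × ℝ)) : ℝ :=
  -(1 / (2 * π)) * (1 / ((a.1 + 1 : ℕ) : ℝ)) * (cos ((a.1 + 1 : ℕ) * a.2.1)
    * exp (-((a.1 + 1 : ℕ) : ℝ) * |a.2.2|))

/-- The shifts of the Green operator. -/
def greenShift (a : ℕ × (ℝ × ℝ)) : Plane := !₂[a.2.1, a.2.2]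

/-- For `m ≥ 1` one has `m - |ρ| ≥ m (1 - |ρ|)`. Keeping the factor `m` in the exponent makes the
integral over the line gain another `1/m`. -/
theorem abs_greenKernel_mul_le {ρ : ℝ} (n : ℕ) (x : ℝ × ℝ) :
    |greenKernel (n, x) * exp (|ρ| * |greenShift (n, x) 1|)|
      ≤ 1 / (2 * π) * (1 / ((n + 1 : ℕ) : ℝ)) * exp (-(((n + 1 : ℕ) : ℝ) * (1 - |ρ|)) * |x.2|) := by
  have hpi := Real.pi_pos
  have h1 : (1 : ℝ) ≤ ((n + 1 : ℕ) : ℝ) := by push_cast; linarith [n.cast_nonneg (α := ℝ)]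
  have hs : greenShift (n, x) 1 = x.2 := rfl
  simp only [greenKernel, hs, abs_mul, abs_neg, Real.abs_exp, mul_assoc]
  rw [abs_of_pos (show 0 < 1 / (2 * π) by positivity), abs_of_pos (show 0 < 1 / ((n + 1 : ℕ) : ℝ) by
    positivity), ← Real.exp_add]
  gcongr
  refine (mul_le_of_le_one_left (Real.exp_pos _).le (Real.abs_cos_le_one _)).trans ?_
  refine Real.exp_le_exp.2 ?_
  have := mul_nonneg (mul_nonneg (sub_nonneg.2 h1) (abs_nonneg ρ)) (abs_nonneg x.2)
  nlinarith

theorem admissibleKernel_green_mode {ρ : ℝ} (hρ : |ρ| < 1) (n : ℕ) :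
    AdmissibleKernel ρ ((volume.restrict (Ioc 0 (2 * π))).prod (volume : Measure ℝ))
      (fun x => greenKernel (n, x)) (fun x => greenShift (n, x)) := by
  have hk : Continuous fun x : ℝ × ℝ => greenKernel (n, x) := by
    simp only [greenKernel]; fun_prop
  have hz : Continuous fun x : ℝ × ℝ => greenShift (n, x) := by
    simp only [greenShift]; fun_prop
  refine ⟨hk.measurable, hz.measurable, ?_⟩
  have hb : 0 < ((n + 1 : ℕ) : ℝ) * (1 - |ρ|) := mul_pos (by positivity) (by linarith)
  refine Integrable.mono' (Integrable.mul_prod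
    (f := fun _ : ℝ => 1 / (2 * π) * (1 / ((n + 1 : ℕ) : ℝ))) (integrable_const _)
    (integrable_exp_neg_mul_abs hb)) (Continuous.aestronglyMeasurable (by fun_prop))
    (Eventually.of_forall fun x => abs_greenKernel_mul_le n x)

/-- The mass of mode `m` is `O(1/m²)`: one factor `1/m` is the coefficient, the other the integral
of the exponential. -/
theorem admissibleKernel_green {ρ : ℝ} (hρ : |ρ| < 1) :
    AdmissibleKernel ρ greenMeasure greenKernel greenShift := by
  have h := admissibleKernel_green_mode hρ
  have hpi := Real.pi_pos
  have hρ' : 0 < 1 - |ρ| := by linarith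
  refine ⟨measurable_from_prod_countable_right fun n => (h n).measurable_kernel,
    measurable_from_prod_countable_right fun n => (h n).measurable_shift,
    integrable_count_prod (fun n => ?_) (fun n => (h n).integrable) ?_⟩
  · have h1 := (h n).measurable_kernel
    have h2 : Continuous fun x : ℝ × ℝ => greenShift (n, x) 1 := by
      simp only [greenShift]; fun_prop
    have := h2.measurable
    fun_prop
  · have hsq : Summable fun n : ℕ => 1 / ((n + 1 : ℕ) : ℝ) ^ 2 :=
      (summable_nat_add_iff 1).2 (Real.summable_one_div_nat_pow.2 one_lt_two)
    refine Summable.of_nonneg_of_le (fun n => integral_nonneg fun _ => abs_nonneg _) (fun n => ?_)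
      (hsq.mul_left (2 / (1 - |ρ|)))
    have hb : 0 < ((n + 1 : ℕ) : ℝ) * (1 - |ρ|) := mul_pos (by positivity) hρ'
    have hi : Integrable (fun x : ℝ × ℝ => (1 / (2 * π) * (1 / ((n + 1 : ℕ) : ℝ)))
        * exp (-(((n + 1 : ℕ) : ℝ) * (1 - |ρ|)) * |x.2|))
        ((volume.restrict (Ioc 0 (2 * π))).prod volume) := Integrable.mul_prod
      (f := fun _ : ℝ => 1 / (2 * π) * (1 / ((n + 1 : ℕ) : ℝ))) (integrable_const _)
      (integrable_exp_neg_mul_abs hb)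
    refine (integral_mono (h n).integrable.abs hi fun x => abs_greenKernel_mul_le n x).trans
      (le_of_eq ?_)
    rw [integral_prod_mul (f := fun _ : ℝ => 1 / (2 * π) * (1 / ((n + 1 : ℕ) : ℝ)))
      (g := fun t : ℝ => exp (-(((n + 1 : ℕ) : ℝ) * (1 - |ρ|)) * |t|)), integral_exp_neg_mul_abs hb]
    simp only [integral_const, smul_eq_mul, measureReal_restrict_apply_univ, Real.volume_real_Ioc]
    rw [sub_zero, max_eq_left (by positivity)]
    field_simp

theorem hasDerivAt_line {F : Type} [NormedAddCommGroup F] [NormedSpace ℝ F] {G : Plane → F}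
    (hG : Differentiable ℝ G) (p v : Plane) (t : ℝ) :
    HasDerivAt (fun t : ℝ => G (p - t • v)) (-(fderiv ℝ G (p - t • v) v)) t := by
  have h1 : HasDerivAt (fun t : ℝ => p - t • v) (-v) t := by
    simpa using ((hasDerivAt_id t).smul_const v).const_sub p
  have := (hG (p - t • v)).hasFDerivAt.comp_hasDerivAt t h1
  rwa [map_neg] at this

theorem hasDerivAt_line_two {G : Plane → ℝ} (hG : ContDiff ℝ ∞ G) (p v : Plane) (t : ℝ) :
    HasDerivAt (fun t : ℝ => -(fderiv ℝ G (p - t • v) v)) (iteratedFDeriv ℝ 2 G (p - t • v) ![v, v])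
      t := by
  have h := hasDerivAt_line (G := fun q => fderiv ℝ G q v)
    (((contDiff_fderiv_of_infty hG).clm_apply contDiff_const).differentiable (by simp)) p v t
  refine h.neg.congr_deriv ?_
  rw [fderiv_clm_apply ((contDiff_fderiv_of_infty hG).differentiable (by simp) _)
    (differentiableAt_const _)]
  simp [iteratedFDeriv_two_apply]

/-- The Fourier coefficient along the meridian, as a superposition of translates. -/
theorem admissibleKernel_cos (ρ : ℝ) (m : ℕ) :
    AdmissibleKernel ρ (volume.restrict (Ioc 0 (2 * π))) (fun y : ℝ => cos (m * y))
      (fun y : ℝ => y • EuclideanSpace.single (0 : Fin 2) (1 : ℝ)) := by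
  refine ⟨by fun_prop, by fun_prop, ?_⟩
  have h : Continuous fun y : ℝ => cos (m * y)
      * exp (|ρ| * |(y • EuclideanSpace.single (0 : Fin 2) (1 : ℝ) : Plane) 1|) := by
    simp only [PiLp.smul_apply]
    fun_prop
  exact (h.integrableOn_Icc (a := 0) (b := 2 * π)).mono_set Ioc_subset_Icc_self

theorem laplacian_eq_sum_coord (f : Plane → ℝ) (p : Plane) :
    Laplacian.laplacian f p
      = iteratedFDeriv ℝ 2 f p ![EuclideanSpace.single 0 1, EuclideanSpace.single 0 1]
        + iteratedFDeriv ℝ 2 f p ![EuclideanSpace.single 1 1, EuclideanSpace.single 1 1] := by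
  rw [InnerProductSpace.laplacian_eq_iteratedFDeriv_orthonormalBasis _
    (EuclideanSpace.basisFun (Fin 2) ℝ)]
  simp [Fin.sum_univ_two]

theorem SmoothGrowth.laplacian {ρ : ℝ} {f : Plane → ℝ} (hf : SmoothGrowth ρ f) :
    Continuous (Laplacian.laplacian f) ∧
      ∃ N, ∀ q, ‖Laplacian.laplacian f q‖ ≤ N * planeWeight ρ q := by
  constructor
  · have := (contDiff_fderiv_of_infty (contDiff_fderiv_of_infty hf.1)).continuous
    rw [funext fun q => laplacian_eq_sum_coord f q]
    simp only [iteratedFDeriv_two_apply]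
    fun_prop
  · obtain ⟨N, hN⟩ := hf.2 2
    refine ⟨N + N, fun q => ?_⟩
    rw [laplacian_eq_sum_coord, add_mul]
    refine (norm_add_le _ _).trans (add_le_add ?_ ?_) <;>
    · refine (ContinuousMultilinearMap.le_opNorm _ _).trans ?_
      simpa [Fin.prod_univ_two] using hN q

theorem fderiv_sub_of_forall_sub {f : Plane → ℝ} (v : Plane) (h : ∀ p, f (p - v) = f p) (p : Plane) :
    _root_.fderiv ℝ f (p - v) = _root_.fderiv ℝ f p := by
  have := fderiv_comp_sub (𝕜 := ℝ) (f := f) (x := p) v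
  rw [← this, funext h]

theorem superpose_cos_iteratedFDeriv_two {ρ : ℝ} {f : Plane → ℝ} (hf : SmoothGrowth ρ f)
    (hper : ∀ p, f (p - (2 * π) • EuclideanSpace.single (0 : Fin 2) (1 : ℝ)) = f p) (m : ℕ)
    (p : Plane) :
    superpose (volume.restrict (Ioc 0 (2 * π))) (fun y : ℝ => cos (m * y))
      (fun y : ℝ => y • EuclideanSpace.single (0 : Fin 2) (1 : ℝ))
      (fun q => iteratedFDeriv ℝ 2 f q ![EuclideanSpace.single 0 1, EuclideanSpace.single 0 1]) p
    = -(m : ℝ) ^ 2 * superpose (volume.restrict (Ioc 0 (2 * π))) (fun y : ℝ => cos (m * y))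
      (fun y : ℝ => y • EuclideanSpace.single (0 : Fin 2) (1 : ℝ)) f p := by
  have hpi : (0 : ℝ) ≤ 2 * π := by positivity
  set e : Plane := EuclideanSpace.single (0 : Fin 2) (1 : ℝ) with he
  simp only [superpose, smul_eq_mul]
  rw [← intervalIntegral.integral_of_le hpi, ← intervalIntegral.integral_of_le hpi]
  have hd := fderiv_sub_of_forall_sub _ hper
  refine integral_cos_mul_deriv_two (g := fun y => f (p - y • e))
    (fun t => hasDerivAt_line (hf.1.differentiable (by simp)) p e t)
    (fun t => hasDerivAt_line_two hf.1 p e t) ?_ (fun t => ?_) m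
  · have := (contDiff_fderiv_of_infty (contDiff_fderiv_of_infty hf.1)).continuous
    simp only [iteratedFDeriv_two_apply]
    fun_prop
  · simp only [add_smul, ← sub_sub, hd]

/-- Integrating first along the meridian replaces `f` by its Fourier coefficient `A` of frequency `m
= n + 1`, for which the Laplacian acts as `∂ₛ² - m²`. The one-dimensional Green formula then
evaluates the integral in `s`, and `-(1/(2πm)) · (-2m) = 1/π`. -/
theorem green_mode {ρ : ℝ} (hρ : |ρ| < 1) {f : Plane → ℝ} (hf : SmoothGrowth ρ f)
    (hper : ∀ p, f (p - (2 * π) • EuclideanSpace.single (0 : Fin 2) (1 : ℝ)) = f p) (n : ℕ)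
    (p : Plane) :
    ∫ x, greenKernel (n, x) • Laplacian.laplacian f (p - greenShift (n, x))
        ∂((volume.restrict (Ioc 0 (2 * π))).prod volume)
      = 1 / π * ∫ y in 0..2 * π, cos ((n + 1 : ℕ) * y)
          * f (p - y • EuclideanSpace.single (0 : Fin 2) (1 : ℝ)) := by
  have hpi := Real.pi_pos
  set e₀ : Plane := EuclideanSpace.single (0 : Fin 2) (1 : ℝ) with he₀
  set e₁ : Plane := EuclideanSpace.single (1 : Fin 2) (1 : ℝ) with he₁
  have hc := admissibleKernel_cos ρ (n + 1)
  set A : Plane → ℝ := superpose (volume.restrict (Ioc 0 (2 * π)))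
    (fun y : ℝ => cos ((n + 1 : ℕ) * y)) (fun y : ℝ => y • e₀) f with hA
  have hAs : SmoothGrowth ρ A := hc.smoothGrowth_superpose hρ.le hf
  have hΔA : ∀ q, superpose (volume.restrict (Ioc 0 (2 * π)))
      (fun y : ℝ => cos ((n + 1 : ℕ) * y)) (fun y : ℝ => y • e₀) (Laplacian.laplacian f) q
      = iteratedFDeriv ℝ 2 A q ![e₁, e₁] - ((n + 1 : ℕ) : ℝ) ^ 2 * A q := by
    intro q
    rw [← hc.laplacian_superpose hρ.le hf, laplacian_eq_sum_coord,
      hc.iteratedFDeriv_two_superpose hρ.le hf q (EuclideanSpace.single 0 1),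
      superpose_cos_iteratedFDeriv_two hf hper]
    ring
  obtain ⟨N, hN⟩ := hAs.exists_norm_le
  obtain ⟨N', hN'⟩ := hAs.fderiv.exists_norm_le
  obtain ⟨hΔc, NΔ, hNΔ⟩ := hf.laplacian
  have hi := (admissibleKernel_green_mode hρ n).integrable_smul hΔc hNΔ p
  set m : ℝ := ((n + 1 : ℕ) : ℝ) with hm
  have hm1 : 1 ≤ m := by rw [hm]; push_cast; linarith [n.cast_nonneg (α := ℝ)]
  set c : ℝ := -(1 / (2 * π)) * (1 / m) with hcc
  have hc0 : c ≠ 0 := by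
    rw [hcc]
    have : 0 < 1 / (2 * π) * (1 / m) := by positivity
    linarith
  have hinner : ∀ t : ℝ, ∫ y in Ioc 0 (2 * π),
      greenKernel (n, (y, t)) • Laplacian.laplacian f (p - greenShift (n, (y, t)))
      = c * (exp (-m * |t|)
        * (iteratedFDeriv ℝ 2 A (p - t • e₁) ![e₁, e₁] - m ^ 2 * A (p - t • e₁))) := by
    intro t
    rw [← hΔA, superpose, ← integral_const_mul, ← integral_const_mul]
    refine integral_congr_ae (Eventually.of_forall fun y => ?_)
    have : p - greenShift (n, (y, t)) = p - t • e₁ - y • e₀ := by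
      ext i
      fin_cases i <;> simp [greenShift, he₀, he₁]
    simp only [this, greenKernel, smul_eq_mul]
    ring
  rw [integral_prod_symm _ hi]
  have hi2 := hi.integral_prod_right
  simp only [hinner] at hi2 ⊢
  rw [integral_const_mul]
  -- Integrability in `t` is inherited from Fubini, after division by the nonzero constant `c`.
  have hi3 : Integrable fun t : ℝ => exp (-m * |t|)
      * (iteratedFDeriv ℝ 2 A (p - t • e₁) ![e₁, e₁] - m ^ 2 * A (p - t • e₁)) := by
    have := hi2.const_mul c⁻¹
    simpa only [← mul_assoc, inv_mul_cancel₀ hc0, one_mul] using this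
  have hw : ∀ t : ℝ, planeWeight ρ (p - t • e₁) ≤ exp (|ρ| * |t|) * planeWeight ρ p := by
    intro t
    simpa [he₁] using planeWeight_sub_le ρ p (t • e₁)
  have hN0 : 0 ≤ N := nonneg_of_mul_nonneg_left ((norm_nonneg _).trans (hN 0)) (planeWeight_pos ρ 0)
  have hN0' : 0 ≤ N' :=
    nonneg_of_mul_nonneg_left ((norm_nonneg _).trans (hN' 0)) (planeWeight_pos ρ 0)
  have hwp := planeWeight_pos ρ p
  rw [integral_exp_neg_mul_abs_mul (σ := |ρ|) (B := (N + N') * planeWeight ρ p) (by linarith)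
    (a := fun t => A (p - t • e₁))
    (fun t => hasDerivAt_line (hAs.1.differentiable (by simp)) p e₁ t)
    (fun t => hasDerivAt_line_two hAs.1 p e₁ t) (fun t => ?_) (fun t => ?_) hi3]
  · simp only [zero_smul, sub_zero, hA, superpose, smul_eq_mul]
    rw [intervalIntegral.integral_of_le (by positivity), hcc]
    field_simp
  · calc |A (p - t • e₁)| ≤ N * planeWeight ρ (p - t • e₁) := hN _
      _ ≤ (N + N') * (exp (|ρ| * |t|) * planeWeight ρ p) := by
          exact mul_le_mul (by linarith) (hw t) (planeWeight_pos _ _).le (by linarith)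
      _ = _ := by ring
  · rw [abs_neg]
    calc |fderiv ℝ A (p - t • e₁) e₁| ≤ ‖fderiv ℝ A (p - t • e₁)‖ * ‖e₁‖ :=
          (fderiv ℝ A (p - t • e₁)).le_opNorm e₁
      _ = ‖fderiv ℝ A (p - t • e₁)‖ := by simp [he₁]
      _ ≤ N' * planeWeight ρ (p - t • e₁) := hN' _
      _ ≤ (N + N') * (exp (|ρ| * |t|) * planeWeight ρ p) := by
          exact mul_le_mul (by linarith) (hw t) (planeWeight_pos _ _).le (by linarith)
      _ = _ := by ring

/-- The Green operator inverts the Laplacian on smooth functions with zero average. -/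
theorem laplacian_superpose_green {ρ : ℝ} (hρ : |ρ| < 1) {f : Plane → ℝ} (hf : SmoothGrowth ρ f)
    (hper : ∀ p, f (p - (2 * π) • EuclideanSpace.single (0 : Fin 2) (1 : ℝ)) = f p)
    (h0 : ∀ p, ∫ y in 0..2 * π, f (p - y • EuclideanSpace.single (0 : Fin 2) (1 : ℝ)) = 0)
    (p : Plane) :
    Laplacian.laplacian (superpose greenMeasure greenKernel greenShift f) p = f p := by
  have hpi := Real.pi_pos
  set e₀ : Plane := EuclideanSpace.single (0 : Fin 2) (1 : ℝ) with he₀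
  obtain ⟨hΔc, N, hN⟩ := hf.laplacian
  have h1 := hasSum_integral_count_prod ((admissibleKernel_green hρ).integrable_smul hΔc hN p)
  -- With the Laplacian moved onto `f`, each mode contributes a Fourier coefficient of `f` at `p`,
  -- and Fourier inversion sums them.
  rw [(admissibleKernel_green hρ).laplacian_superpose hρ.le hf]
  simp only [green_mode hρ hf hper] at h1
  have hd := fderiv_sub_of_forall_sub _ hper
  have h2 := hasSum_integral_cos_mul (g := fun y => f (p - y • e₀))
    (fun t => hasDerivAt_line (hf.1.differentiable (by simp)) p e₀ t)
    (fun t => hasDerivAt_line_two hf.1 p e₀ t) (by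
      have := (contDiff_fderiv_of_infty (contDiff_fderiv_of_infty hf.1)).continuous
      simp only [iteratedFDeriv_two_apply]
      fun_prop) (fun t => by simp only [add_smul, ← sub_sub, hper])
    (fun t => by simp only [add_smul, ← sub_sub, hd]) (h0 p)
  have h3 := (h2.mul_left (1 / π)).unique h1
  rw [superpose, greenMeasure]
  rw [← h3]
  simp only [zero_smul, sub_zero]
  field_simp

/-! ### Decay of harmonic functions with zero average -/

/-- A periodic holomorphic function on a half-plane of growth less than `exp (im z)` which
vanishes at `i∞` decays like `exp (-im z)`. -/
theorem norm_le_exp_of_periodic {f : ℂ → ℂ} (hp : Function.Periodic f ((2 * π : ℝ) : ℂ)) {c s₀ : ℝ}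
    (hs : c < s₀) (hd : ∀ z : ℂ, c < z.im → DifferentiableAt ℂ f z) {A σ : ℝ} (hσ : σ < 1)
    (hA : ∀ z : ℂ, c < z.im → ‖f z‖ ≤ A * exp (σ * z.im)) {B : ℝ}
    (hB : ∀ z : ℂ, z.im = s₀ → ‖f z‖ ≤ B)
    (hL : ∀ L : ℂ, Tendsto f (comap Complex.im atTop) (𝓝 L) → L = 0) (z : ℂ) (hz : s₀ ≤ z.im) :
    ‖f z‖ ≤ B * exp (-(z.im - s₀)) := by
  have hpi := Real.pi_pos
  have h2π : 0 < 2 * π := by positivity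
  -- `f` as a function of `q = e^{iz}`: the half-plane becomes the punctured disc of radius
  -- `e^{-c}`, and `|q| = e^{-im z}`.
  set F := Function.Periodic.cuspFunction (2 * π) f with hF
  have him : ∀ q : ℂ, (Function.Periodic.invQParam (2 * π) q).im = -Real.log ‖q‖ := by
    intro q
    rw [Function.Periodic.im_invQParam, neg_div, div_self h2π.ne', neg_one_mul]
  have hqn : ∀ z : ℂ, ‖Function.Periodic.qParam (2 * π) z‖ = exp (-z.im) := by
    intro z
    rw [Function.Periodic.norm_qParam]
    congr 1
    field_simp
  have hball : ∀ q : ℂ, q ≠ 0 → ‖q‖ < exp (-c) → c < (Function.Periodic.invQParam (2 * π) q).im := by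
    intro q hq hqr
    rw [him]
    have := Real.log_lt_log (norm_pos_iff.2 hq) hqr
    rw [Real.log_exp] at this
    linarith
  have hFd : ∀ q : ℂ, q ≠ 0 → ‖q‖ < exp (-c) → DifferentiableAt ℂ F q := by
    intro q hq hqr
    have := Function.Periodic.differentiableAt_cuspFunction h2π.ne' hp (hd _ (hball q hq hqr))
    rwa [Function.Periodic.qParam_right_inv h2π.ne' hq] at this
  have hFb : ∀ q : ℂ, q ≠ 0 → ‖q‖ < exp (-c) → ‖F q‖ ≤ A * exp (-σ * Real.log ‖q‖) := by
    intro q hq hqr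
    rw [hF, Function.Periodic.cuspFunction_eq_of_nonzero _ _ hq]
    refine (hA _ (hball q hq hqr)).trans (le_of_eq ?_)
    rw [him]
    ring_nf
  have hnhds : Metric.ball (0 : ℂ) (exp (-c)) ∈ 𝓝 (0 : ℂ) := Metric.ball_mem_nhds 0 (exp_pos _)
  -- The growth hypothesis reads `|F q| ≤ A |q|^{-σ}`. Since `σ < 1`, this is `o(1/|q|)` and the
  -- singularity is removable.
  have hFo : (fun q => F q - F 0) =o[𝓝[≠] (0 : ℂ)] fun q => (q - 0)⁻¹ := by
    have hn : Tendsto (fun q : ℂ => ‖q‖) (𝓝[≠] 0) (𝓝[>] 0) := tendsto_norm_nhdsNE_zero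
    have hlog : Tendsto (fun q : ℂ => exp ((1 - σ) * Real.log ‖q‖)) (𝓝[≠] 0) (𝓝 0) :=
      Real.tendsto_exp_atBot.comp
        ((Real.tendsto_log_nhdsGT_zero.comp hn).const_mul_atBot (by linarith))
    have hn' : Tendsto (fun q : ℂ => ‖q‖) (𝓝[≠] 0) (𝓝 0) := hn.mono_right nhdsWithin_le_nhds
    have hlim : Tendsto (fun q : ℂ => A * exp ((1 - σ) * Real.log ‖q‖) + ‖F 0‖ * ‖q‖) (𝓝[≠] 0)
        (𝓝 0) := by
      simpa using (hlog.const_mul A).add (hn'.const_mul ‖F 0‖)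
    rw [Asymptotics.isLittleO_iff_tendsto' (by
      filter_upwards [self_mem_nhdsWithin] with q hq h
      simp at h
      exact absurd h hq)]
    refine squeeze_zero_norm' ?_ hlim
    filter_upwards [self_mem_nhdsWithin, mem_nhdsWithin_of_mem_nhds hnhds] with q hq hqb
    have hq0 : q ≠ 0 := hq
    have hqr : ‖q‖ < exp (-c) := by simpa using hqb
    rw [sub_zero, div_inv_eq_mul, norm_mul]
    calc ‖F q - F 0‖ * ‖q‖ ≤ (A * exp (-σ * Real.log ‖q‖) + ‖F 0‖) * ‖q‖ := by
          gcongr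
          exact (norm_sub_le _ _).trans (add_le_add (hFb q hq0 hqr) le_rfl)
      _ = A * (exp (-σ * Real.log ‖q‖) * exp (Real.log ‖q‖)) + ‖F 0‖ * ‖q‖ := by
          rw [Real.exp_log (norm_pos_iff.2 hq0)]
          ring
      _ = _ := by rw [← Real.exp_add]; ring_nf
  have hFD : DifferentiableOn ℂ F (Metric.ball 0 (exp (-c))) := by
    have := Complex.differentiableOn_update_limUnder_of_isLittleO hnhds (f := F) (fun q hq =>
      (hFd q hq.2 (by simpa using hq.1)).differentiableWithinAt) hFo
    rwa [← Function.Periodic.cuspFunction_zero_eq_limUnder_nhds_ne, Function.update_eq_self] at this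
  have hF0 : F 0 = 0 := by
    refine hL _ ?_
    have h1 : Tendsto F (𝓝[≠] 0) (𝓝 (F 0)) :=
      ((hFD.differentiableAt hnhds).continuousAt.tendsto).mono_left nhdsWithin_le_nhds
    have h2 := h1.comp (Function.Periodic.qParam_tendsto h2π)
    refine h2.congr fun z => ?_
    exact Function.Periodic.eq_cuspFunction h2π.ne' hp z
  have hg : DifferentiableOn ℂ (dslope F 0) (Metric.ball 0 (exp (-c))) :=
    (Complex.differentiableOn_dslope hnhds).2 hFD
  have hr : exp (-s₀) < exp (-c) := Real.exp_lt_exp.2 (by linarith)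
  -- The Schwarz lemma: the maximum principle for `F(q)/q` on the disc whose boundary circle is `im
  -- z = s₀`.
  have hmax : ∀ q ∈ closure (Metric.ball (0 : ℂ) (exp (-s₀))), ‖dslope F 0 q‖ ≤ B / exp (-s₀) := by
    intro q hq
    refine Complex.norm_le_of_forall_mem_frontier_norm_le Metric.isBounded_ball ?_ ?_ hq
    · refine (hg.mono ?_).diffContOnCl
      rw [closure_ball _ (exp_pos _).ne']
      exact Metric.closedBall_subset_ball hr
    · intro q hq
      rw [frontier_ball _ (exp_pos _).ne', mem_sphere_zero_iff_norm] at hq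
      have hq0 : q ≠ 0 := norm_pos_iff.1 (by rw [hq]; exact exp_pos _)
      rw [dslope_of_ne _ hq0, slope_def_field, hF0, sub_zero, sub_zero, norm_div, hq]
      gcongr
      rw [hF, Function.Periodic.cuspFunction_eq_of_nonzero _ _ hq0]
      exact hB _ (by rw [him, hq, Real.log_exp, neg_neg])
  set q := Function.Periodic.qParam (2 * π) z with hq
  have hq0 : q ≠ 0 := Function.Periodic.qParam_ne_zero z
  have hqc : q ∈ closure (Metric.ball (0 : ℂ) (exp (-s₀))) := by
    rw [closure_ball _ (exp_pos _).ne', mem_closedBall_zero_iff, hqn]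
    exact Real.exp_le_exp.2 (by linarith)
  have h1 := hmax q hqc
  have hFq : F q = f z := Function.Periodic.eq_cuspFunction h2π.ne' hp z
  rw [dslope_of_ne _ hq0, slope_def_field, hF0, sub_zero, sub_zero, norm_div, hqn,
    hFq, div_le_iff₀ (exp_pos _)] at h1
  refine h1.trans (le_of_eq ?_)
  rw [neg_sub, sub_eq_add_neg, Real.exp_add, Real.exp_neg s₀]
  field_simp

theorem exists_eq_zero_of_intervalIntegral_eq_zero {g : ℝ → ℝ} (hg : Continuous g) {a b : ℝ}
    (hab : a < b) (h : ∫ y in a..b, g y = 0) : ∃ y ∈ Ioo a b, g y = 0 := by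
  have hd : ∀ t, HasDerivAt (fun t => ∫ y in a..t, g y) (g t) t := fun t =>
    intervalIntegral.integral_hasDerivAt_right (hg.intervalIntegrable _ _)
      hg.aestronglyMeasurable.stronglyMeasurableAtFilter hg.continuousAt
  exact exists_hasDerivAt_eq_zero hab (fun t _ => (hd t).continuousAt.continuousWithinAt)
    (by simp [h]) fun t _ => hd t

theorem hasDerivAt_comp_add_mul {U : ℂ → ℝ} (hU : Differentiable ℝ U) (z v : ℂ) (t : ℝ) :
    HasDerivAt (fun t : ℝ => U (z + t * v)) (fderiv ℝ U (z + t * v) v) t := by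
  have h1 : HasDerivAt (fun t : ℝ => z + (t : ℂ) * v) v t := by
    simpa using ((Complex.ofRealCLM.hasDerivAt (x := t)).mul_const v).const_add z
  exact (hU (z + t * v)).hasFDerivAt.comp_hasDerivAt t h1

/-- The complex gradient `∂₁ U - i ∂₂ U`. -/
def complexGradient (U : ℂ → ℝ) (z : ℂ) : ℂ := fderiv ℝ U z 1 - Complex.I * fderiv ℝ U z Complex.I

/-- Each component of the gradient has zeros at arbitrary height, so its limit is zero. For `∂₁`,
Rolle applies on a horizontal period. For `∂₂`, the difference of `U` at heights `s + 1` and `s` has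
zero mean, hence vanishes somewhere, and Rolle applies on that vertical segment. -/
theorem complexGradient_tendsto_eq_zero {U : ℂ → ℝ} (hU : ContDiff ℝ 2 U)
    (hp : ∀ z, U (z + ((2 * π : ℝ) : ℂ)) = U z)
    (h0 : ∀ z : ℂ, ∫ y in (0 : ℝ)..2 * π, U (z + y) = 0) {L : ℂ}
    (hL : Tendsto (complexGradient U) (comap Complex.im atTop) (𝓝 L)) : L = 0 := by
  have hpi := Real.pi_pos
  have hd : Differentiable ℝ U := hU.differentiable two_ne_zero
  have key : ∀ v : ℂ, ∀ a : ℝ, Tendsto (fun z => fderiv ℝ U z v) (comap Complex.im atTop) (𝓝 a) →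
      (∀ s : ℝ, ∃ z : ℂ, s ≤ z.im ∧ fderiv ℝ U z v = 0) → a = 0 := by
    intro v a ha hz
    by_contra hne
    have h1 := ha.eventually_ne hne
    rw [eventually_comap] at h1
    obtain ⟨s, hs⟩ := eventually_atTop.1 h1
    obtain ⟨z, hzs, hz0⟩ := hz s
    exact hs z.im hzs z rfl hz0
  have hre : Tendsto (fun z => fderiv ℝ U z 1) (comap Complex.im atTop) (𝓝 L.re) := by
    refine ((Complex.continuous_re.tendsto L).comp hL).congr fun z => ?_
    simp [complexGradient]
  have him : Tendsto (fun z => fderiv ℝ U z Complex.I) (comap Complex.im atTop) (𝓝 (-L.im)) := by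
    refine ((Complex.continuous_im.tendsto L).comp hL).neg.congr fun z => ?_
    simp [complexGradient]
  have h1 : L.re = 0 := by
    refine key 1 _ hre fun s => ?_
    have hc : ∀ t : ℝ, HasDerivAt (fun t : ℝ => U (s * Complex.I + t * 1)) _ t :=
      hasDerivAt_comp_add_mul hd (s * Complex.I) 1
    obtain ⟨t, -, ht⟩ := exists_hasDerivAt_eq_zero (a := 0) (b := 2 * π) (by positivity)
      (fun t _ => (hc t).continuousAt.continuousWithinAt) (by
        have := hp (s * Complex.I)
        simp only [mul_one, Complex.ofReal_zero, add_zero]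
        exact this.symm) (fun t _ => hc t)
    exact ⟨_, by simp, ht⟩
  have h2 : -L.im = 0 := by
    refine key Complex.I _ him fun s => ?_
    have hUc : Continuous U := hU.continuous
    obtain ⟨y, -, hy⟩ := exists_eq_zero_of_intervalIntegral_eq_zero (a := 0) (b := 2 * π)
      (g := fun y : ℝ => U ((s + 1 : ℝ) * Complex.I + y) - U (s * Complex.I + y)) (by fun_prop)
      (by positivity) (by
        rw [intervalIntegral.integral_sub, h0, h0, sub_zero]
        · exact Continuous.intervalIntegrable (by fun_prop) _ _
        · exact Continuous.intervalIntegrable (by fun_prop) _ _)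
    have hc : ∀ t : ℝ, HasDerivAt (fun t : ℝ => U (y + t * Complex.I)) _ t :=
      hasDerivAt_comp_add_mul hd y Complex.I
    obtain ⟨t, ht1, ht⟩ := exists_hasDerivAt_eq_zero (a := s) (b := s + 1) (by linarith)
      (fun t _ => (hc t).continuousAt.continuousWithinAt) (by
        simp only [add_comm (y : ℂ)]
        linarith) (fun t _ => hc t)
    exact ⟨_, by simpa using ht1.1.le, ht⟩
  exact Complex.ext h1 (by simpa using h2)

/-- The real linear form `v ↦ Re (w v)`. -/
def reMulCLM : ℂ →L[ℝ] ℂ →L[ℝ] ℝ :=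
  (ContinuousLinearMap.compL ℝ ℂ ℂ ℝ Complex.reCLM).comp (ContinuousLinearMap.mul ℝ ℂ)

theorem fderiv_eq_reMulCLM (U : ℂ → ℝ) (z : ℂ) :
    fderiv ℝ U z = reMulCLM (complexGradient U z) := by
  refine ContinuousLinearMap.ext fun v => ?_
  have h : v = v.re • (1 : ℂ) + v.im • Complex.I := by
    simp [Complex.re_add_im]
  have e : reMulCLM (complexGradient U z) v = (complexGradient U z * v).re := rfl
  rw [e, Complex.mul_re]
  conv_lhs => rw [h, map_add, map_smul, map_smul]
  simp [complexGradient]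
  ring

theorem norm_complexGradient_le (U : ℂ → ℝ) (z : ℂ) :
    ‖complexGradient U z‖ ≤ 2 * ‖fderiv ℝ U z‖ := by
  have h1 := (fderiv ℝ U z).le_opNorm 1
  have h2 := (fderiv ℝ U z).le_opNorm Complex.I
  rw [norm_one, mul_one] at h1
  rw [Complex.norm_I, mul_one] at h2
  calc ‖complexGradient U z‖ ≤ ‖((fderiv ℝ U z 1 : ℝ) : ℂ)‖
        + ‖Complex.I * ((fderiv ℝ U z Complex.I : ℝ) : ℂ)‖ := norm_sub_le _ _
    _ ≤ _ := by
      rw [norm_mul, Complex.norm_I, one_mul, Complex.norm_real, Complex.norm_real]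
      linarith

/-- The real derivative of a holomorphic function is multiplication by its complex derivative, and
multiplication has norm at most one. This transfers the Cauchy estimates to real derivatives. -/
theorem norm_iteratedFDeriv_real_le (j : ℕ) : ∀ {f : ℂ → ℂ} {s : Set ℂ}, IsOpen s →
    DifferentiableOn ℂ f s → ∀ z ∈ s, ‖iteratedFDeriv ℝ j f z‖ ≤ ‖iteratedDeriv j f z‖ := by
  induction j with
  | zero => intro f s _ _ z _; simp
  | succ j ih =>
    intro f s hs hf z hz
    have hf' := hf.deriv hs
    have e : fderiv ℝ f =ᶠ[𝓝 z] fun w => ContinuousLinearMap.mul ℝ ℂ (deriv f w) := by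
      filter_upwards [hs.mem_nhds hz] with w hw
      have h1 := ((hf.differentiableAt (hs.mem_nhds hw)).hasFDerivAt.restrictScalars ℝ).fderiv
      rw [h1]
      ext v
      simp [fderiv_eq_smul_deriv, mul_comm]
    have hcd : ContDiffAt ℝ j (deriv f) z :=
      ((hf'.contDiffOn hs).contDiffAt (hs.mem_nhds hz)).restrict_scalars ℝ
    rw [← norm_iteratedFDeriv_fderiv, (e.iteratedFDeriv ℝ j).eq_of_nhds, iteratedDeriv_succ']
    refine ((ContinuousLinearMap.mul ℝ ℂ).norm_iteratedFDeriv_comp_left hcd le_rfl).trans ?_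
    have h1 : ‖ContinuousLinearMap.mul ℝ ℂ‖ ≤ 1 := ContinuousLinearMap.opNorm_mul_le ℝ ℂ
    calc _ ≤ 1 * ‖iteratedFDeriv ℝ j (deriv f) z‖ := by gcongr
      _ ≤ _ := by rw [one_mul]; exact ih hs hf' z hz

/-- Decay of all the derivatives of a periodic harmonic function with zero average on a
half-plane. -/
theorem exists_norm_iteratedFDeriv_le_exp (j : ℕ) : ∃ K, 0 ≤ K ∧ ∀ {U : ℂ → ℝ}, ContDiff ℝ 2 U →
    (∀ z, U (z + ((2 * π : ℝ) : ℂ)) = U z) →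
    (∀ z : ℂ, ∫ y in (0 : ℝ)..2 * π, U (z + y) = 0) →
    ∀ {c s₀ : ℝ}, c < s₀ → (∀ z : ℂ, c < z.im → Laplacian.laplacian U z = 0) →
    ∀ {A σ : ℝ}, σ < 1 → (∀ z : ℂ, c < z.im → ‖fderiv ℝ U z‖ ≤ A * exp (σ * z.im)) →
    ∀ {B : ℝ}, (∀ z : ℂ, z.im = s₀ → ‖fderiv ℝ U z‖ ≤ B) →
    ∀ z : ℂ, s₀ + 1 / 2 ≤ z.im → ‖iteratedFDeriv ℝ j U z‖ ≤ K * B * exp (-(z.im - s₀)) := by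
  have hpi := Real.pi_pos
  have grad : ∀ {U : ℂ → ℝ}, ContDiff ℝ 2 U →
      (∀ z, U (z + ((2 * π : ℝ) : ℂ)) = U z) →
      (∀ z : ℂ, ∫ y in (0 : ℝ)..2 * π, U (z + y) = 0) →
      ∀ {c s₀ : ℝ}, c < s₀ → (∀ z : ℂ, c < z.im → Laplacian.laplacian U z = 0) →
      ∀ {A σ : ℝ}, σ < 1 → (∀ z : ℂ, c < z.im → ‖fderiv ℝ U z‖ ≤ A * exp (σ * z.im)) →
      ∀ {B : ℝ}, (∀ z : ℂ, z.im = s₀ → ‖fderiv ℝ U z‖ ≤ B) →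
      DifferentiableOn ℂ (complexGradient U) {z | c < z.im} ∧
      ∀ z : ℂ, s₀ ≤ z.im → ‖complexGradient U z‖ ≤ 2 * B * exp (-(z.im - s₀)) := by
    intro U hU hp h0 c s₀ hs hΔ A σ hσ hA B hB
    have hopen : IsOpen {z : ℂ | c < z.im} := isOpen_lt continuous_const Complex.continuous_im
    have hdiff : ∀ z : ℂ, c < z.im → DifferentiableAt ℂ (complexGradient U) z := by
      intro z hz
      refine HarmonicAt.differentiableAt_complex_partial ⟨hU.contDiffAt, ?_⟩
      filter_upwards [hopen.mem_nhds hz] with w hw using hΔ w hw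
    refine ⟨fun z hz => (hdiff z hz).differentiableWithinAt, ?_⟩
    have hper : ∀ z, fderiv ℝ U (z + ((2 * π : ℝ) : ℂ)) = fderiv ℝ U z := by
      intro z
      rw [← fderiv_comp_add_right, funext hp]
    refine norm_le_exp_of_periodic (A := 2 * A) (fun z => ?_) hs hdiff hσ (fun z hz => ?_)
      (fun z hz => ?_) (fun L hL => complexGradient_tendsto_eq_zero hU hp h0 hL)
    · simp only [complexGradient, hper]
    · refine (norm_complexGradient_le U z).trans ?_
      linarith [hA z hz]
    · refine (norm_complexGradient_le U z).trans ?_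
      linarith [hB z hz]
  rcases j with _ | j
  -- For `U` itself: the zero average provides a zero at the same height within distance `2π`, and
  -- the gradient bound is integrated from there.
  · refine ⟨2 * π * (‖reMulCLM‖ * 2), by positivity, ?_⟩
    intro U hU hp h0 c s₀ hs hΔ A σ hσ hA B hB z hz
    obtain ⟨-, hg⟩ := grad hU hp h0 hs hΔ hσ hA hB
    rw [norm_iteratedFDeriv_zero]
    have hd : Differentiable ℝ U := hU.differentiable two_ne_zero
    have hUc := hU.continuous
    obtain ⟨y, hy, hy0⟩ := exists_eq_zero_of_intervalIntegral_eq_zero (a := 0) (b := 2 * π)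
      (g := fun y : ℝ => U (z + y)) (by fun_prop) (by positivity) (h0 z)
    have hc : ∀ t : ℝ, HasDerivAt (fun t : ℝ => U (z + t * 1)) _ t :=
      hasDerivAt_comp_add_mul hd z 1
    have hbd : ∀ t : ℝ, ‖fderiv ℝ U (z + t * 1) 1‖ ≤ ‖reMulCLM‖ * 2 * B * exp (-(z.im - s₀)) := by
      intro t
      have h1 := (fderiv ℝ U (z + t * 1)).le_opNorm 1
      rw [norm_one] at h1
      refine h1.trans ?_
      rw [mul_one ‖_‖, fderiv_eq_reMulCLM]
      have h2 := hg (z + t * 1) (by simp; linarith)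
      simp only [mul_one, Complex.add_im, Complex.ofReal_im, add_zero] at h2 ⊢
      calc _ ≤ ‖reMulCLM‖ * ‖complexGradient U (z + t)‖ := ContinuousLinearMap.le_opNorm _ _
        _ ≤ ‖reMulCLM‖ * (2 * B * exp (-(z.im - s₀))) := by gcongr
        _ = _ := by ring
    have := convex_univ.norm_image_sub_le_of_norm_hasDerivWithin_le (x := y) (y := 0)
      (fun t _ => (hc t).hasDerivWithinAt) (fun t _ => hbd t) (mem_univ _) (mem_univ _)
    simp only [mul_one, hy0, Complex.ofReal_zero, add_zero, sub_zero, zero_sub, norm_neg] at this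
    refine this.trans ?_
    rw [Real.norm_of_nonneg hy.1.le]
    have hB0 : 0 ≤ ‖reMulCLM‖ * 2 * B * exp (-(z.im - s₀)) := (norm_nonneg _).trans (hbd 0)
    calc _ ≤ ‖reMulCLM‖ * 2 * B * exp (-(z.im - s₀)) * (2 * π) := by gcongr; exact hy.2.le
      _ = _ := by ring
  -- Cauchy estimates for the complex gradient on discs of radius `1/2`, which stay in `im ≥ s₀`.
  -- Descending by `1/2` costs the factor `exp (1/2)`.
  · refine ⟨‖reMulCLM‖ * (j.factorial * (2 * exp (1 / 2)) / (1 / 2) ^ j), by positivity, ?_⟩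
    intro U hU hp h0 c s₀ hs hΔ A σ hσ hA B hB z hz
    obtain ⟨hd, hg⟩ := grad hU hp h0 hs hΔ hσ hA hB
    have hopen : IsOpen {z : ℂ | c < z.im} := isOpen_lt continuous_const Complex.continuous_im
    have hzc : z ∈ {z : ℂ | c < z.im} := by simp only [mem_ofPred_eq]; linarith
    have e : fderiv ℝ U = reMulCLM ∘ complexGradient U := funext fun z => fderiv_eq_reMulCLM U z
    have hcd : ContDiffAt ℝ j (complexGradient U) z :=
      ((hd.contDiffOn hopen).contDiffAt (hopen.mem_nhds hzc)).restrict_scalars ℝ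
    have him : ∀ w ∈ Metric.closedBall z (1 / 2), z.im - 1 / 2 ≤ w.im := by
      intro w hw
      have := (Complex.abs_im_le_norm (w - z)).trans (mem_closedBall_iff_norm.1 hw)
      rw [Complex.sub_im] at this
      linarith [(abs_le.1 this).1]
    have hB0 : 0 ≤ B := (norm_nonneg _).trans (hB (s₀ * Complex.I) (by simp))
    have hcauchy := Complex.norm_iteratedDeriv_le_of_forall_mem_sphere_norm_le (c := z)
      (R := 1 / 2) (f := complexGradient U) (C := 2 * B * exp (-(z.im - 1 / 2 - s₀))) j (by norm_num)
      ((hd.mono (by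
        rw [closure_ball _ (by norm_num)]
        intro w hw
        have := him w hw
        simp only [mem_ofPred_eq]
        linarith)).diffContOnCl) (fun w hw => by
        have h1 := him w (Metric.sphere_subset_closedBall hw)
        refine (hg w (by linarith)).trans ?_
        gcongr)
    rw [← norm_iteratedFDeriv_fderiv, e]
    refine (reMulCLM.norm_iteratedFDeriv_comp_left hcd le_rfl).trans ?_
    have h2 := (norm_iteratedFDeriv_real_le j hopen hd z hzc).trans hcauchy
    calc _ ≤ ‖reMulCLM‖ * (j.factorial * (2 * B * exp (-(z.im - 1 / 2 - s₀))) / (1 / 2) ^ j) := by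
          gcongr
      _ = _ := by
          rw [show -(z.im - 1 / 2 - s₀) = 1 / 2 + -(z.im - s₀) by ring, Real.exp_add]
          ring

/-! ### Bounds of the weighted Hölder norms -/

theorem dist_le_two_mul_rpow {α d : ℝ} (hα : α ∈ Ioo (0 : ℝ) 1) (h0 : 0 ≤ d) (h2 : d ≤ 2) :
    d ≤ 2 * d ^ α := by
  rcases h0.eq_or_lt with rfl | hd
  · positivity
  have h1 : d ^ (1 - α) ≤ 2 := by
    calc d ^ (1 - α) ≤ 2 ^ (1 - α) := Real.rpow_le_rpow h0 h2 (by linarith [hα.2])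
      _ ≤ 2 ^ (1 : ℝ) := Real.rpow_le_rpow_of_exponent_le (by norm_num) (by linarith [hα.1])
      _ = 2 := Real.rpow_one 2
  calc d = d ^ (1 - α) * d ^ α := by rw [← Real.rpow_add hd]; simp
    _ ≤ _ := by gcongr

/-- One more derivative controls the Hölder seminorm; the factor `2` converts Lipschitz into Hölder
on sets of diameter at most `2`. -/
theorem norm_iteratedFDeriv_sub_le {α A : ℝ} (hα : α ∈ Ioo (0 : ℝ) 1) {k : ℕ} {S : Set Plane}
    {u : Plane → ℝ} (hS : Convex ℝ S) (hd : ∀ x ∈ S, ∀ y ∈ S, dist x y ≤ 2)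
    (hu : ∀ x ∈ S, ContDiffAt ℝ (k + 1 : ℕ) u x)
    (h : ∀ x ∈ S, ‖iteratedFDeriv ℝ (k + 1) u x‖ ≤ A) {x y : Plane} (hx : x ∈ S) (hy : y ∈ S) :
    ‖iteratedFDeriv ℝ k u x - iteratedFDeriv ℝ k u y‖ ≤ 2 * A * dist x y ^ α := by
  have hA : 0 ≤ A := (norm_nonneg _).trans (h x hx)
  have h1 := hS.norm_image_sub_le_of_norm_fderiv_le (𝕜 := ℝ) (f := iteratedFDeriv ℝ k u) (C := A)
    (fun z hz => (hu z hz).differentiableAt_iteratedFDeriv (by exact_mod_cast k.lt_succ_self))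
    (fun z hz => by rw [norm_fderiv_iteratedFDeriv]; exact h z hz) hy hx
  rw [← dist_eq_norm x y] at h1
  refine h1.trans ?_
  rw [mul_comm 2, mul_assoc]
  gcongr
  exact dist_le_two_mul_rpow hα dist_nonneg (hd x hx y hy)

/-- The factor `k + 2` counts the `k + 1` sup norms and the seminorm. Coordinate derivatives are
values on unit vectors, hence bounded by the operator norm. -/
theorem holderNorm_le {α A : ℝ} {k : ℕ} {S : Set Plane} {u : Plane → ℝ}
    (hA : 0 ≤ A) (hS : UniqueDiffOn ℝ S) (hu : ∀ x ∈ S, ContDiffAt ℝ k u x)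
    (h : ∀ j ≤ k, ∀ x ∈ S, ‖iteratedFDeriv ℝ j u x‖ ≤ A)
    (hh : ∀ x ∈ S, ∀ y ∈ S,
      ‖iteratedFDeriv ℝ k u x - iteratedFDeriv ℝ k u y‖ ≤ A * dist x y ^ α) :
    holderNorm k α S u ≤ ENNReal.ofReal ((k + 2) * A) := by
  have e : ∀ j ≤ k, ∀ β : Fin j → Fin 2, ∀ x ∈ S, partialDeriv β S u x
      = iteratedFDeriv ℝ j u x (fun i => EuclideanSpace.single (β i) 1) := by
    intro j hj β x hx
    rw [partialDeriv, iteratedFDerivWithin_eq_iteratedFDeriv hS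
      ((hu x hx).of_le (by exact_mod_cast hj)) hx]
  have hn : ∀ {j : ℕ} (β : Fin j → Fin 2) (T : ContinuousMultilinearMap ℝ (fun _ : Fin j => Plane) ℝ),
      ‖T (fun i => EuclideanSpace.single (β i) 1)‖ ≤ ‖T‖ := by
    intro j β T
    simpa using T.le_opNorm (fun i => EuclideanSpace.single (β i) (1 : ℝ))
  have h1 : (∑ j ∈ Finset.range (k + 1), ⨆ (β : Fin j → Fin 2) (x ∈ S), ‖partialDeriv β S u x‖ₑ)
      ≤ ∑ j ∈ Finset.range (k + 1), ENNReal.ofReal A := by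
    refine Finset.sum_le_sum fun j hj => iSup_le fun β => iSup₂_le fun x hx => ?_
    have hj' : j ≤ k := Nat.lt_succ_iff.1 (Finset.mem_range.1 hj)
    rw [e j hj' β x hx, ← ofReal_norm]
    exact ENNReal.ofReal_le_ofReal ((hn β _).trans (h j hj' x hx))
  have h2 : (⨆ β : Fin k → Fin 2, holderSeminorm α S (partialDeriv β S u)) ≤ ENNReal.ofReal A := by
    refine iSup_le fun β => iSup₂_le fun x hx => iSup₂_le fun y hy => iSup_le fun hxy => ?_
    have hd : 0 < dist x y := dist_pos.2 hxy
    rw [e k le_rfl β x hx, e k le_rfl β y hy, ← ofReal_norm, edist_dist,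
      ENNReal.ofReal_rpow_of_pos hd, ← ENNReal.ofReal_div_of_pos (Real.rpow_pos_of_pos hd _)]
    refine ENNReal.ofReal_le_ofReal ?_
    rw [div_le_iff₀ (Real.rpow_pos_of_pos hd _), ← sub_apply]
    exact (hn β _).trans (hh x hx y hy)
  refine (add_le_add h1 h2).trans (le_of_eq ?_)
  rw [Finset.sum_const, Finset.card_range, nsmul_eq_mul, ← ENNReal.ofReal_natCast,
    ← ENNReal.ofReal_mul (by positivity), ← ENNReal.ofReal_add (by positivity) hA]
  congr 1
  push_cast
  ring

theorem weightedNorm_le {k : ℕ} {α A : ℝ} {D : Set Cylinder} {f u : Cylinder → ℝ}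
    (hf : ∀ q ∈ D, 0 < f q)
    (h : ∀ p ∈ cover ⁻¹' D, holderNorm k α (cover ⁻¹' D ∩ Metric.ball p 1) (lift u)
      ≤ ENNReal.ofReal (A * f (cover p))) : weightedNorm k α D f u ≤ ENNReal.ofReal A := by
  refine iSup₂_le fun p hp => ?_
  have hp' := hf _ hp
  refine ENNReal.div_le_of_le_mul ?_
  rw [← ENNReal.ofReal_mul' hp'.le]
  exact h p hp

theorem dist_le_two_of_mem_ball {p x y : Plane} (hx : x ∈ Metric.ball p 1)
    (hy : y ∈ Metric.ball p 1) : dist x y ≤ 2 := by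
  have := dist_triangle_right x y p
  rw [Metric.mem_ball] at hx hy
  linarith

theorem weightedNorm_univ_le {ρ α A : ℝ} {u : Cylinder → ℝ} (hA : 0 ≤ A)
    (hu : ContDiff ℝ 2 (lift u))
    (h : ∀ j ≤ 2, ∀ p, ∀ x ∈ Metric.ball p 1,
      ‖iteratedFDeriv ℝ j (lift u) x‖ ≤ A * planeWeight ρ p)
    (hh : ∀ p, ∀ x ∈ Metric.ball p 1, ∀ y ∈ Metric.ball p 1,
      ‖iteratedFDeriv ℝ 2 (lift u) x - iteratedFDeriv ℝ 2 (lift u) y‖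
        ≤ A * planeWeight ρ p * dist x y ^ α) :
    MemWeightedHolder 2 α univ (coshWeight ρ) u ∧
      weightedNorm 2 α univ (coshWeight ρ) u ≤ ENNReal.ofReal (4 * A) := by
  have key : weightedNorm 2 α univ (coshWeight ρ) u ≤ ENNReal.ofReal (4 * A) := by
    refine weightedNorm_le (fun q _ => Real.rpow_pos_of_pos (Real.cosh_pos _) _) fun p _ => ?_
    rw [preimage_univ, univ_inter]
    refine (holderNorm_le (mul_nonneg hA (planeWeight_pos ρ p).le)
      Metric.isOpen_ball.uniqueDiffOn (fun x _ => hu.contDiffAt) (fun j hj => h j hj p)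
      (hh p)).trans (ENNReal.ofReal_le_ofReal (le_of_eq ?_))
    change _ = 4 * A * planeWeight ρ p
    push_cast
    ring
  exact ⟨⟨hu.contDiffOn, key.trans_lt ENNReal.ofReal_lt_top⟩, key⟩

theorem weightedNorm_above_le {k : ℕ} {ρ α A c : ℝ} {l : EReal} (hα : α ∈ Ioo (0 : ℝ) 1)
    {u : Cylinder → ℝ} (hA : 0 ≤ A) (hD : cover ⁻¹' above (l + 1) = {p : Plane | c ≤ p 1})
    (hu : ∀ p : Plane, c ≤ p 1 → ContDiffAt ℝ ∞ (lift u) p)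
    (h : ∀ j ≤ k + 1, ∀ p : Plane, c ≤ p 1 →
      ‖iteratedFDeriv ℝ j (lift u) p‖ ≤ A * decayWeight ρ l (cover p)) :
    MemWeightedHolder k α (above (l + 1)) (decayWeight ρ l) u ∧
      weightedNorm k α (above (l + 1)) (decayWeight ρ l) u
        ≤ ENNReal.ofReal ((k + 2) * (2 * exp 1 * A)) := by
  have hpos : ∀ q, 0 < decayWeight ρ l q := fun q =>
    div_pos (Real.rpow_pos_of_pos (Real.cosh_pos _) _) (Real.cosh_pos _)
  have hle : ∀ p x : Plane, x ∈ Metric.ball p 1 →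
      decayWeight ρ l (cover x) ≤ exp 1 * decayWeight ρ l (cover p) := by
    intro p x hx
    have h1 := cosh_le_exp_mul_cosh (x 1) (p 1)
    have h2 : |p 1 - x 1| ≤ 1 := by
      rw [Metric.mem_ball, dist_comm, dist_eq_norm] at hx
      exact (abs_coord_le_norm (p - x) 1).trans hx.le
    have h3 : cosh (p 1) ≤ exp 1 * cosh (x 1) := h1.trans (by gcongr)
    change cosh l.toReal ^ ρ / cosh (x 1) ≤ exp 1 * (cosh l.toReal ^ ρ / cosh (p 1))
    rw [← mul_div_assoc, div_le_div_iff₀ (Real.cosh_pos _) (Real.cosh_pos _)]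
    have : 0 < cosh l.toReal ^ ρ := Real.rpow_pos_of_pos (Real.cosh_pos _) _
    nlinarith
  have key : weightedNorm k α (above (l + 1)) (decayWeight ρ l) u
      ≤ ENNReal.ofReal ((k + 2) * (2 * exp 1 * A)) := by
    refine weightedNorm_le (fun q _ => hpos q) fun p hp => ?_
    rw [hD] at hp ⊢
    set S := {p : Plane | c ≤ p 1} ∩ Metric.ball p 1
    have hconv : Convex ℝ S :=
      (convex_halfSpace_ge (f := fun p : Plane => p 1) ⟨fun _ _ => rfl, fun _ _ => rfl⟩ c).inter
        (convex_ball p 1)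
    -- A convex set with nonempty interior has unique derivatives. As `p` may lie on the boundary
    -- line, the interior point is found half a unit above it.
    have hint : (interior S).Nonempty := by
      refine ⟨p + EuclideanSpace.single 1 (1 / 2), mem_interior.2
        ⟨{p : Plane | c < p 1} ∩ Metric.ball p 1, inter_subset_inter_left _ fun x hx => ?_,
          (isOpen_lt continuous_const (by fun_prop)).inter Metric.isOpen_ball, ?_, ?_⟩⟩
      · exact le_of_lt (show c < x 1 from hx)
      · have : c ≤ p 1 := hp
        simp only [mem_ofPred_eq, PiLp.add_apply, PiLp.single_apply, if_true]
        linarith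
      · rw [mem_ball_iff_norm, add_sub_cancel_left, PiLp.norm_single]
        norm_num
    have hb : ∀ j ≤ k + 1, ∀ x ∈ S,
        ‖iteratedFDeriv ℝ j (lift u) x‖ ≤ exp 1 * A * decayWeight ρ l (cover p) := by
      intro j hj x hx
      refine (h j hj x hx.1).trans ?_
      calc _ ≤ A * (exp 1 * decayWeight ρ l (cover p)) := by gcongr; exact hle p x hx.2
        _ = _ := by ring
    have hA' : 0 ≤ exp 1 * A * decayWeight ρ l (cover p) :=
      mul_nonneg (by positivity) (hpos _).le
    refine (holderNorm_le (A := 2 * (exp 1 * A * decayWeight ρ l (cover p))) (by linarith)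
      (uniqueDiffOn_convex hconv hint)
      (fun x hx => (hu x hx.1).of_le (by exact_mod_cast le_top))
      (fun j hj x hx => (hb j (by lia) x hx).trans (by linarith)) fun x hx y hy =>
        norm_iteratedFDeriv_sub_le hα hconv (fun x hx y hy => dist_le_two_of_mem_ball hx.2 hy.2)
          (fun x hx => (hu x hx.1).of_le (by exact_mod_cast le_top)) (hb (k + 1) le_rfl)
          hx hy).trans (ENNReal.ofReal_le_ofReal (le_of_eq ?_))
    ring
  refine ⟨⟨fun x hx => ?_, key.trans_lt ENNReal.ofReal_lt_top⟩, key⟩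
  rw [hD] at hx
  exact ((hu x hx).of_le (by exact_mod_cast le_top)).contDiffWithinAt

/-! ### Decay of harmonic functions on the cylinder -/

theorem lift_add_period (u : Cylinder → ℝ) (p q : Plane) (h0 : q 0 = p 0 + 2 * π)
    (h1 : q 1 = p 1) : lift u q = lift u p := by
  simp only [lift, cover, h0, h1, AddCircle.coe_add_period]

theorem ZeroMeridianAverage.integral_eq_zero {u : Cylinder → ℝ} (h : ZeroMeridianAverage u)
    (x s : ℝ) : ∫ y in 0..2 * π, u (((x + y : ℝ) : AddCircle (2 * π)), s) = 0 := by
  have hper : Function.Periodic (fun y : ℝ => u ((y : AddCircle (2 * π)), s)) (2 * π) := fun y => by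
    simp only [AddCircle.coe_add_period]
  rw [intervalIntegral.integral_comp_add_left (fun y : ℝ => u ((y : AddCircle (2 * π)), s)) x,
    add_zero, hper.intervalIntegral_add_eq x (-π), show -π + 2 * π = π by ring]
  exact h s

theorem laplacian_comp_repr {f : Plane → ℝ} (hf : ContDiff ℝ 2 f) (z : ℂ) :
    Laplacian.laplacian (f ∘ Complex.orthonormalBasisOneI.repr) z
      = Laplacian.laplacian f (Complex.orthonormalBasisOneI.repr z) := by
  set g : ℂ →L[ℝ] Plane :=
    (Complex.orthonormalBasisOneI.repr.toContinuousLinearEquiv : ℂ →L[ℝ] Plane) with hg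
  have e := g.iteratedFDeriv_comp_right hf z (i := 2) le_rfl
  have e1 : g 1 = EuclideanSpace.single 0 1 := by
    ext i; fin_cases i <;> simp [hg]
  have e2 : g Complex.I = EuclideanSpace.single 1 1 := by
    ext i; fin_cases i <;> simp [hg]
  rw [InnerProductSpace.laplacian_eq_iteratedFDeriv_complexPlane, laplacian_eq_sum_coord]
  have e3 : ∀ v : ℂ, iteratedFDeriv ℝ 2 (f ∘ Complex.orthonormalBasisOneI.repr) z ![v, v]
      = iteratedFDeriv ℝ 2 f (Complex.orthonormalBasisOneI.repr z) ![g v, g v] := by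
    intro v
    have := congrArg (fun T => T ![v, v]) e
    refine this.trans ?_
    simp only [ContinuousMultilinearMap.compContinuousLinearMap_apply]
    congr 1
    ext i
    fin_cases i <;> rfl
  simp only [e3, e1, e2]

/-- The half-plane estimate is applied with `c = l` and `s₀ = l + 1/2`, so that it covers `s ≥ l +
1`. The factor `exp 1` replaces the weight at `s₀` by the weight at `l`; `exp (l + 1/2)` converts
`e^{-(s - s₀)}` into `1 / cosh s`. Smoothness holds because `u` is harmonic there. -/
theorem exists_decay_estimate {ρ : ℝ} (hρ : |ρ| < 1) {l : ℝ} (hl : 0 < l) (j : ℕ) : ∃ K, 0 ≤ K ∧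
    ∀ {u : Cylinder → ℝ}, ContDiff ℝ 2 (lift u) → ZeroMeridianAverage u →
    (∀ p : Plane, l < p 1 → Laplacian.laplacian (lift u) p = 0) →
    ∀ {N : ℝ}, 0 ≤ N → (∀ p, ‖fderiv ℝ (lift u) p‖ ≤ N * planeWeight ρ p) →
    ∀ p : Plane, l + 1 ≤ p 1 → ContDiffAt ℝ ∞ (lift u) p ∧
      ‖iteratedFDeriv ℝ j (lift u) p‖ ≤ K * N * (cosh l ^ ρ / cosh (p 1)) := by
  obtain ⟨K, hK, h⟩ := exists_norm_iteratedFDeriv_le_exp j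
  refine ⟨K * exp 1 * exp (l + 1 / 2), by positivity, fun {u} hu h0 hΔ {N} hN hb => ?_⟩
  set g := Complex.orthonormalBasisOneI.repr with hg
  have g0 : ∀ z : ℂ, g z 0 = z.re := fun z => by simp [hg]
  have g1 : ∀ z : ℂ, g z 1 = z.im := fun z => by simp [hg]
  set U : ℂ → ℝ := lift u ∘ g with hU
  have hUc : ContDiff ℝ 2 U := hu.comp g.contDiff
  have hUΔ : ∀ z : ℂ, l < z.im → Laplacian.laplacian U z = 0 := fun z hz => by
    rw [hU, laplacian_comp_repr hu]
    exact hΔ _ (by rw [g1]; exact hz)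
  have hUd : ∀ z, ‖fderiv ℝ U z‖ ≤ N * cosh z.im ^ ρ := fun z => by
    rw [← norm_iteratedFDeriv_one, hU, g.norm_iteratedFDeriv_comp_right, norm_iteratedFDeriv_one]
    have := hb (g z)
    rwa [planeWeight, g1] at this
  have hUj := h hUc (fun z => lift_add_period u _ _ (by simp [g0]) (by simp [g1])) (fun z => by
      refine Eq.trans ?_ (h0.integral_eq_zero z.re z.im)
      refine intervalIntegral.integral_congr fun y _ => ?_
      simp only [hU, Function.comp_apply, lift, cover, g0, g1]
      simp) (c := l) (s₀ := l + 1 / 2) (by linarith) hUΔ (A := N) hρ (fun z hz => by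
      refine (hUd z).trans ?_
      gcongr
      have := cosh_rpow_le ρ 0 z.im
      rwa [sub_zero, Real.cosh_zero, Real.one_rpow, mul_one, abs_of_pos (hl.trans hz)] at this)
    (B := exp 1 * (N * cosh l ^ ρ)) (fun z hz => by
      refine (hUd z).trans ?_
      have h1 := cosh_rpow_le ρ l z.im
      have h2 : |ρ| * |z.im - l| ≤ 1 := by
        rw [hz, add_sub_cancel_left]
        norm_num
        linarith
      calc _ ≤ N * (exp 1 * cosh l ^ ρ) := by
            gcongr
            exact h1.trans (by gcongr)
        _ = _ := by ring)
  intro p hp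
  obtain ⟨z, rfl⟩ := g.surjective p
  rw [g1] at hp ⊢
  refine ⟨?_, ?_⟩
  · have hopen : IsOpen {z : ℂ | l < z.im} := isOpen_lt continuous_const Complex.continuous_im
    have hh : InnerProductSpace.HarmonicAt U z := by
      refine ⟨hUc.contDiffAt, ?_⟩
      filter_upwards [hopen.mem_nhds (show l < z.im by linarith)] with w hw using hUΔ w hw
    have h1 : ContDiffAt ℝ ∞ U z := (HarmonicAt.analyticAt hh).contDiffAt
    have h2 : lift u = U ∘ g.symm := by funext p; simp [hU]
    rw [h2]
    exact ContDiffAt.comp (g z) (by rw [g.symm_apply_apply]; exact h1) g.symm.contDiff.contDiffAt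
  · rw [← g.norm_iteratedFDeriv_comp_right]
    refine (hUj z (by linarith)).trans ?_
    have h1 : exp (-(z.im - (l + 1 / 2))) ≤ exp (l + 1 / 2) * (1 / cosh z.im) := by
      rw [neg_sub, sub_eq_add_neg, Real.exp_add, Real.exp_neg, ← one_div]
      gcongr
      rw [Real.cosh_eq]
      have : exp (-z.im) ≤ exp z.im := Real.exp_le_exp.2 (by linarith)
      linarith
    have h2 : 0 ≤ cosh l ^ ρ := (Real.rpow_pos_of_pos (Real.cosh_pos _) _).le
    calc _ ≤ K * (exp 1 * (N * cosh l ^ ρ)) * (exp (l + 1 / 2) * (1 / cosh z.im)) := by gcongr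
      _ = _ := by ring

/-! ### The solution operator -/

instance : SFinite greenMeasure := by unfold greenMeasure; infer_instance

/-- The solution operator: the dyadic potential of `E`, corrected by the Green operator of the
cylinder applied to the average of `E`. -/
def solutionOperator (φ Ψ : Plane → ℝ) (E : Cylinder → ℝ) : Cylinder → ℝ :=
  cylSuperpose ((Measure.count : Measure ℕ).prod volume) (dyadicKernel Ψ) dyadicShift E
    + cylSuperpose greenMeasure greenKernel greenShift (cylSuperpose volume φ id E)

theorem lift_cylSuperpose_id (φ : Plane → ℝ) (E : Cylinder → ℝ) :
    lift (cylSuperpose volume φ id E) = scaledAverage φ 1 (lift E) := by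
  rw [lift_cylSuperpose, scaledAverage_eq_superpose]

theorem smoothGrowth_average {ρ : ℝ} (hρ : |ρ| ≤ 1) {φ : Plane → ℝ} (hφ : ContDiff ℝ ∞ φ)
    (hs : Function.support φ ⊆ Metric.closedBall 0 1) {f : Plane → ℝ} (hc : Continuous f) {N : ℝ}
    (hf : ∀ p, |f p| ≤ N * planeWeight ρ p) : SmoothGrowth ρ (scaledAverage φ 1 f) :=
  ⟨contDiff_scaledAverage hφ hs hc one_ne_zero, fun j => by
    obtain ⟨C, -, h⟩ := smoothGrowth_scaledAverage hρ hφ hs j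
    exact ⟨C * N, h f N hc hf⟩⟩

theorem solutionOperator_smul (φ Ψ : Plane → ℝ) (c : ℝ) (E : Cylinder → ℝ) :
    solutionOperator φ Ψ (c • E) = c • solutionOperator φ Ψ E := by
  simp only [solutionOperator, cylSuperpose_smul, smul_add]

theorem ZeroMeridianAverage.add {u v : Cylinder → ℝ} (hu : ZeroMeridianAverage u)
    (hv : ZeroMeridianAverage v) (huc : Continuous (lift u)) (hvc : Continuous (lift v)) :
    ZeroMeridianAverage (u + v) := by
  intro s
  have key : ∀ {w : Cylinder → ℝ}, Continuous (lift w) →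
      IntervalIntegrable (fun θ : ℝ => w ((θ : AddCircle (2 * π)), s)) volume (-π) π := by
    intro w hw
    have h : Continuous fun θ : ℝ => (!₂[θ, s] : Plane) := by fun_prop
    exact (hw.comp h).intervalIntegrable _ _
  have := intervalIntegral.integral_add (key huc) (key hvc)
  rw [hu s, hv s, add_zero] at this
  exact this

section

variable {ρ α : ℝ} {φ Ψ : Plane → ℝ}

theorem solutionOperator_add (hρ : |ρ| < 1) (hφ : ContDiff ℝ ∞ φ) (hΨ : ContDiff ℝ ∞ Ψ)
    (hsφ : Function.support φ ⊆ Metric.closedBall 0 1)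
    (hsΨ : Function.support Ψ ⊆ Metric.closedBall 0 1) (hα : 0 < α) {E E' : Cylinder → ℝ}
    {N N' : ℝ} (hE : HolderBound ρ α N (lift E)) (hE' : HolderBound ρ α N' (lift E')) :
    solutionOperator φ Ψ (E + E') = solutionOperator φ Ψ E + solutionOperator φ Ψ E' := by
  have hc := hE.continuous hα
  have hc' := hE'.continuous hα
  have hg := smoothGrowth_average hρ.le hφ hsφ hc hE.le
  have hg' := smoothGrowth_average hρ.le hφ hsφ hc' hE'.le
  obtain ⟨M, hM⟩ := hg.exists_norm_le
  obtain ⟨M', hM'⟩ := hg'.exists_norm_le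
  have e := hg.1.continuous
  have e' := hg'.1.continuous
  rw [← lift_cylSuperpose_id] at hM hM' e e'
  rw [solutionOperator, cylSuperpose_add (admissibleKernel_dyadic ρ hΨ.continuous hsΨ) hc hc'
    hE.le hE'.le, cylSuperpose_add (admissibleKernel_scaledAverage ρ hφ.continuous hsφ) hc hc'
    hE.le hE'.le, cylSuperpose_add (admissibleKernel_green hρ) e e' hM hM']
  simp only [solutionOperator]
  abel

/-- The two Laplacians add up to `(E - φ * E) + φ * E`. The Green term is bounded through three
derivatives of `φ * E`, the third giving the Hölder seminorm. In its constant, `exp 1` compares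
weights on a unit disc and `2` comes from `norm_iteratedFDeriv_sub_le`. -/
theorem exists_solutionOperator_estimate (hρ : |ρ| < 1) (hα : α ∈ Ioo (0 : ℝ) 1)
    (hφ : ContDiff ℝ ∞ φ) (hΨ : ContDiff ℝ ∞ Ψ)
    (hsφ : Function.support φ ⊆ Metric.closedBall 0 1)
    (hsΨ : Function.support Ψ ⊆ Metric.closedBall 0 1) (hφ1 : ∫ y, φ y = 1)
    (hΔ : ∀ y, Laplacian.laplacian Ψ y = 4 * φ ((2 : ℝ) • y) - φ y) :
    ∃ C, 0 ≤ C ∧ ∀ (E : Cylinder → ℝ) (N : ℝ), HolderBound ρ α N (lift E) →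
      ZeroMeridianAverage E →
      ContDiff ℝ 2 (lift (solutionOperator φ Ψ E)) ∧
      (∀ j ≤ 2, ∀ p, ∀ x ∈ Metric.ball p 1,
        ‖iteratedFDeriv ℝ j (lift (solutionOperator φ Ψ E)) x‖ ≤ C * N * planeWeight ρ p) ∧
      (∀ p, ∀ x ∈ Metric.ball p 1, ∀ y ∈ Metric.ball p 1,
        ‖iteratedFDeriv ℝ 2 (lift (solutionOperator φ Ψ E)) x
          - iteratedFDeriv ℝ 2 (lift (solutionOperator φ Ψ E)) y‖
          ≤ C * N * planeWeight ρ p * dist x y ^ α) ∧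
      ZeroMeridianAverage (solutionOperator φ Ψ E) ∧
      ∀ p, Laplacian.laplacian (lift (solutionOperator φ Ψ E)) p = lift E p := by
  have hk := admissibleKernel_green hρ
  obtain ⟨C, hC, h⟩ := exists_dyadicPotential_weighted_estimate hφ hΨ hsφ hsΨ hφ1 hΔ hρ.le hα
  choose B hB hb using smoothGrowth_scaledAverage hρ.le hφ hsφ
  set M := kernelMass ρ greenMeasure greenKernel greenShift with hM
  have hM0 : 0 ≤ M := kernelMass_nonneg
  set G := M * (B 0 + B 1 + B 2 + B 3) with hG
  have hG0 : 0 ≤ G := mul_nonneg hM0 (by linarith [hB 0, hB 1, hB 2, hB 3])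
  refine ⟨C + 2 * exp 1 * G, by positivity, fun E N hE h0 => ?_⟩
  have hN := hE.nonneg
  have hc := hE.continuous hα.1
  obtain ⟨hv2, hvj, hvh, hvΔ⟩ := h (lift E) N hE
  have hsg := smoothGrowth_average hρ.le hφ hsφ hc hE.le
  set A := scaledAverage φ 1 (lift E) with hA
  set g := superpose greenMeasure greenKernel greenShift A with hg
  set v := dyadicPotential Ψ (lift E) with hv
  have hgs := hk.smoothGrowth_superpose hρ.le hsg
  have ev : lift (cylSuperpose ((Measure.count : Measure ℕ).prod volume) (dyadicKernel Ψ)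
      dyadicShift E) = v := by
    rw [lift_cylSuperpose, hv, dyadicPotential_eq_superpose hΨ.continuous hsΨ hc hE.le]
  have ea : lift (cylSuperpose volume φ id E) = A := lift_cylSuperpose_id φ E
  have eg : lift (cylSuperpose greenMeasure greenKernel greenShift
      (cylSuperpose volume φ id E)) = g := by
    rw [lift_cylSuperpose, ea]
  have eu : lift (solutionOperator φ Ψ E) = v + g := by
    rw [← ev, ← eg]; rfl
  have hg2 : ContDiff ℝ 2 g := by exact_mod_cast contDiff_infty.1 hgs.1 2
  have hw := planeWeight_pos ρ
  have hgj : ∀ j ≤ 3, ∀ p, ∀ x ∈ Metric.ball p 1,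
      ‖iteratedFDeriv ℝ j g x‖ ≤ exp 1 * G * N * planeWeight ρ p := by
    intro j hj p x hx
    have h1 := hk.norm_iteratedFDeriv_superpose_le hρ.le j hsg (B j * N)
      (hb j (lift E) N hc hE.le) x
    have h2 : planeWeight ρ x ≤ exp 1 * planeWeight ρ p :=
      planeWeight_le hρ.le (by rw [dist_comm]; exact (Metric.mem_ball.1 hx).le)
    have h3 : B j ≤ B 0 + B 1 + B 2 + B 3 := by
      interval_cases j <;> linarith [hB 0, hB 1, hB 2, hB 3]
    have h4 := hB j
    have h5 := (hw x).le
    have h6 : 0 ≤ B 0 + B 1 + B 2 + B 3 := h4.trans h3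
    calc _ ≤ M * (B j * N) * planeWeight ρ x := h1
      _ ≤ M * ((B 0 + B 1 + B 2 + B 3) * N) * (exp 1 * planeWeight ρ p) := by gcongr
      _ = _ := by rw [hG]; ring
  have hzv := (admissibleKernel_dyadic ρ hΨ.continuous hsΨ).zeroMeridianAverage hc hE.le h0
  have hza := (admissibleKernel_scaledAverage ρ hφ.continuous hsφ).zeroMeridianAverage hc hE.le h0
  obtain ⟨N', hN'⟩ := hsg.exists_norm_le
  have hzg := hk.zeroMeridianAverage (by rw [ea]; exact hsg.1.continuous)
    (by rw [ea]; exact hN') hza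
  have haux : ∀ j ≤ 2, ∀ x, iteratedFDeriv ℝ j (v + g) x
      = iteratedFDeriv ℝ j v x + iteratedFDeriv ℝ j g x := fun j hj x =>
    iteratedFDeriv_add_apply (hv2.contDiffAt.of_le (by exact_mod_cast hj))
      (hg2.contDiffAt.of_le (by exact_mod_cast hj))
  rw [eu]
  refine ⟨hv2.add hg2, fun j hj p x hx => ?_, fun p x hx y hy => ?_,
    hzv.add hzg (by rw [ev]; exact hv2.continuous) (by rw [eg]; exact hg2.continuous),
    fun p => ?_⟩
  · rw [haux j hj]
    refine (norm_add_le _ _).trans ?_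
    have h1 := hvj j hj p x hx
    have h2 := hgj j (by lia) p x hx
    have h3 : 0 ≤ exp 1 * G * N * planeWeight ρ p := mul_nonneg (by positivity) (hw p).le
    linarith
  · rw [haux 2 le_rfl, haux 2 le_rfl, add_sub_add_comm]
    refine (norm_add_le _ _).trans ?_
    have h1 := hvh p x hx y hy
    have h2 := norm_iteratedFDeriv_sub_le hα (k := 2) (convex_ball p 1)
      (fun x hx y hy => dist_le_two_of_mem_ball hx hy)
      (fun x _ => (contDiff_infty.1 hgs.1 (2 + 1)).contDiffAt) (hgj 3 le_rfl p) hx hy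
    linarith
  · rw [ContDiffAt.laplacian_add hv2.contDiffAt hg2.contDiffAt, hvΔ,
      laplacian_superpose_green hρ hsg]
    · ring
    · intro p
      rw [← ea]
      exact (lift_add_period _ _ _ (by simp) (by simp)).symm
    -- The average is needed along `p - y e₀`. The reflection `y ↦ 2π - y` turns it into a forward
    -- integral starting at `p 0 - 2π`.
    · intro p
      have h1 := hza.integral_eq_zero (p 0 - 2 * π) (p 1)
      have h2 := intervalIntegral.integral_comp_sub_left (a := 0) (b := 2 * π)
        (fun y : ℝ => cylSuperpose volume φ id E
          (((p 0 - 2 * π + y : ℝ) : AddCircle (2 * π)), p 1)) (2 * π)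
      rw [sub_self, sub_zero, h1] at h2
      rw [← ea]
      refine Eq.trans ?_ h2
      refine intervalIntegral.integral_congr fun y _ => ?_
      simp only [lift, cover]
      congr 2
      · congr 1
        simp
      · simp

end

/-- For `l = ∞` the region is empty and nothing is required. For finite `l`, derivatives up to order
`k + 1` are bounded, the last one for the Hölder seminorm. -/
theorem exists_solution_decay {ρ : ℝ} (hρ : |ρ| < 1) (k : ℕ) {l : EReal} (hl : 0 < l) {α : ℝ}
    (hα : α ∈ Ioo (0 : ℝ) 1) : ∃ K, 0 ≤ K ∧ ∀ {u : Cylinder → ℝ}, ContDiff ℝ 2 (lift u) →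
    ZeroMeridianAverage u →
    (∀ p, cover p ∈ above l → Laplacian.laplacian (lift u) p = 0) →
    ∀ {N : ℝ}, 0 ≤ N → (∀ p, ‖fderiv ℝ (lift u) p‖ ≤ N * planeWeight ρ p) →
    MemWeightedHolder k α (above (l + 1)) (decayWeight ρ l) u ∧
      weightedNorm k α (above (l + 1)) (decayWeight ρ l) u ≤ ENNReal.ofReal (K * N) := by
  induction l with
  | bot => exact absurd hl (by simp)
  | top =>
    refine ⟨0, le_rfl, fun {u} _ _ _ {N} _ _ => ?_⟩
    have e : above ((⊤ : EReal) + 1) = ∅ := by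
      rw [EReal.top_add_of_ne_bot (by decide)]
      ext q
      simp [above]
    rw [e]
    simp [MemWeightedHolder, weightedNorm]
  | coe l =>
    have hl' : 0 < l := by exact_mod_cast hl
    choose K hK h using fun j => exists_decay_estimate hρ hl' j
    refine ⟨(k + 2) * (2 * exp 1 * ∑ j ∈ Finset.range (k + 2), K j), ?_, ?_⟩
    · have := Finset.sum_nonneg fun j (_ : j ∈ Finset.range (k + 2)) => hK j
      positivity
    intro u hu h0 hΔ N hN hb
    have hS : 0 ≤ ∑ j ∈ Finset.range (k + 2), K j := Finset.sum_nonneg fun j _ => hK j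
    have hΔ' : ∀ p : Plane, l < p 1 → Laplacian.laplacian (lift u) p = 0 := fun p hp =>
      hΔ p (EReal.coe_le_coe_iff.2 hp.le)
    have := weightedNorm_above_le (k := k) (ρ := ρ) (A := (∑ j ∈ Finset.range (k + 2), K j) * N)
      (c := l + 1) (l := l) hα (u := u) (by positivity)
      (by
        ext p
        change (l : EReal) + 1 ≤ (p 1 : EReal) ↔ l + 1 ≤ p 1
        exact_mod_cast Iff.rfl)
      (fun p hp => (h 0 hu h0 hΔ' hN hb p hp).1)
      (fun j hj p hp => (h j hu h0 hΔ' hN hb p hp).2.trans (by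
        have h1 : K j ≤ ∑ j ∈ Finset.range (k + 2), K j :=
          Finset.single_le_sum (fun j _ => hK j) (Finset.mem_range.2 (by lia))
        have h2 : 0 ≤ decayWeight ρ l (cover p) :=
          (div_pos (Real.rpow_pos_of_pos (Real.cosh_pos _) _) (Real.cosh_pos _)).le
        change _ * decayWeight ρ l (cover p) ≤ _
        gcongr))
    refine ⟨this.1, this.2.trans (le_of_eq ?_)⟩
    congr 1
    ring

end FlatCylinder

end

/-! ### Proof of the proposition -/

open FlatCylinder

theorem mainTheorem6 (ρ : ℝ) (hρ : ρ ∈ Set.Ioo (-1 : ℝ) 1) (hρ0 : ρ ≠ 0) (k : ℕ)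
    (l : EReal) (hl : 0 < l) (α : ℝ) (hα : α ∈ Set.Ioo (0 : ℝ) 1) :
    ∃ (R : sourceSpace ρ α l →ₗ[ℝ] (Cylinder → ℝ)) (C : NNReal),
      ∀ E : sourceSpace ρ α l,
        MemWeightedHolder 2 α Set.univ (coshWeight ρ) (R E) ∧
        ZeroMeridianAverage (R E) ∧
        MemWeightedHolder k α (above (l + 1)) (decayWeight ρ l) (R E) ∧
        (∀ p : Plane, Laplacian.laplacian (lift (R E)) p = lift (E : Cylinder → ℝ) p) ∧
        weightedNorm 2 α Set.univ (coshWeight ρ) (R E)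
            + weightedNorm k α (above (l + 1)) (decayWeight ρ l) (R E)
          ≤ (C : ENNReal) * weightedNorm 0 α (below l) (coshWeight ρ) (E : Cylinder → ℝ) := by
  have hρ' : |ρ| < 1 := abs_lt.2 hρ
  obtain ⟨φ, Ψ, hφ, hΨ, hsφ, hsΨ, hφ1, hΔ⟩ := exists_dyadic_kernel
  obtain ⟨C, hC, h⟩ := exists_solutionOperator_estimate hρ' hα hφ hΨ hsφ hsΨ hφ1 hΔ
  obtain ⟨K, hK, hdecay⟩ := exists_solution_decay hρ' k hl hα
  have hb := fun E : sourceSpace ρ α l => holderBound_of_mem_sourceSpace hρ'.le hα.1 E.2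
  refine ⟨⟨⟨fun E => solutionOperator φ Ψ E, fun E E' =>
    solutionOperator_add hρ' hφ hΨ hsφ hsΨ hα.1 (hb E) (hb E')⟩,
    fun c E => solutionOperator_smul φ Ψ c E⟩,
    -- `4 C` bounds the norm on the whole cylinder and `K C` the norm on the far end, where `C` also
    -- bounds the gradient. The factor `exp 1` is the cost of extending `E` by zero.
    Real.toNNReal ((4 * C + K * C) * Real.exp 1), fun E => ?_⟩
  change MemWeightedHolder 2 α Set.univ (coshWeight ρ) (solutionOperator φ Ψ E) ∧
    ZeroMeridianAverage (solutionOperator φ Ψ E) ∧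
    MemWeightedHolder k α (above (l + 1)) (decayWeight ρ l) (solutionOperator φ Ψ E) ∧
    (∀ p : Plane, Laplacian.laplacian (lift (solutionOperator φ Ψ E)) p = lift E p) ∧
    weightedNorm 2 α Set.univ (coshWeight ρ) (solutionOperator φ Ψ E)
      + weightedNorm k α (above (l + 1)) (decayWeight ρ l) (solutionOperator φ Ψ E) ≤ _
  set W := weightedNorm 0 α (below l) (coshWeight ρ) (E : Cylinder → ℝ) with hW
  have hWt : W ≠ ⊤ := E.2.1.2.ne
  obtain ⟨h1, h2, h3, h4, h5⟩ := h E _ (hb E) E.2.2.2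
  have hN : 0 ≤ C * (exp 1 * W.toReal) := by positivity
  obtain ⟨a1, a2⟩ := weightedNorm_univ_le hN h1 h2 h3
  obtain ⟨b1, b2⟩ := hdecay h1 h4 (fun p hp => by rw [h5]; exact E.2.2.1 _ hp) hN (fun p => by
    rw [← norm_iteratedFDeriv_one]
    exact h2 1 one_le_two p p (Metric.mem_ball_self one_pos))
  refine ⟨a1, h4, b1, h5, (add_le_add a2 b2).trans (le_of_eq ?_)⟩
  rw [← ENNReal.ofReal_add (by positivity) (by positivity), ← ENNReal.ofReal_toReal hWt,
    ENNReal.toReal_ofReal (by positivity)]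
  change _ = ENNReal.ofReal ((4 * C + K * C) * Real.exp 1) * _
  rw [← ENNReal.ofReal_mul (by positivity)]
  congr 1
  ring
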